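/- Let $k\ge 0$, $n=2k+1$, and let $\Omega\subset\mathbb{R}^{n}$ be a compact domain with piecewise smooth boundary: $\Omega$ is compact, is the closure of its interior, and $\partial\Omega$ is a smooth hypersurface with $\Omega$ on one side of it, outside a set of edges and corners of $(n-1)$-dimensional Hausdorff measure zero (empty if the boundary is smooth). Let $\alpha$ be a smooth closed Dirichlet $(k+1)$-form on $\Omega$, i.e. $d\alpha=0$ and $\alpha(V_1,\dots,V_{k+1})=0$ whenever $V_1,\dots,V_{k+1}$ are tangent to $\partial\Omega$ at a smooth boundary point. On pairs $(x,y)$ with $x\ne y$ let $\alpha_y$ be the pullback of $\alpha$ under $(x,y)\mapsto y$, let $g(x,y)=(y-x)/\|y-x\|\in S^{2k}$ be the Gauss map, and let $\mathrm{dVol}$ be the standard volume form of $S^{2k}$, of total mass $\mathrm{Vol}(S^{2k})$. The Biot--Savart operator is integration over the fibre $C_{2,1}[\Omega]$ of $(x,y)\mapsto x$ (the fibre over $x$ has interior part $\{y\in\Omega: y\neq x\}$, and its remaining boundary does not contribute), \[ BS(\alpha)=\frac{1}{\mathrm{Vol}(S^{2k})}\int_{C_{2,1}[\Omega]}\alpha_y\wedge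 g^*\mathrm{dVol}, \] with fibre directions placed first and the fibre oriented by the coordinates of the offset $x-y$; that is, \[ BS(\alpha)_x(v_1,\dots,v_k)=\frac{1}{\mathrm{Vol}(S^{2k})}\int_{\Omega\setminus\{x\}}(\alpha_y\wedge g^*\mathrm{dVol})_{(x,y)}\Bigl(-\tfrac{\partial}{\partial y_1},\dots,-\tfrac{\partial}{\partial y_n},v_1,\dots,v_k\Bigr)\,dy , \] where $v_j$ stands for the vector $(v_j,0)$. Then these integrals converge absolutely for every $x$, and $BS(\alpha)$ is a primitive of $\alpha$: at every interior point and every smooth boundary point of $\Omega$ (so on all of $\Omega$ if the boundary is smooth), $BS(\alpha)$ is differentiable within $\Omega$ and \[ d(BS(\alpha))=\alpha . \] -/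

import Mathlib

open scoped ContDiff

noncomputable section

namespace BiotSavart

/-- Euclidean space `ℝⁿ` with its Euclidean norm, standard orientation and Lebesgue measure. -/
abbrev Eu (n : ℕ) : Type := EuclideanSpace ℝ (Fin n)

/-! ### Compact domains with piecewise smooth boundary -/

/-- `f` is a smooth defining function of `Ω` on the open neighbourhood `U` of the boundary
point `p`: the differential of `f` does not vanish at `p`, and inside `U` the set `Ω` is
`{f ≤ 0}`. Then `∂Ω` is near `p` the smooth hypersurface `{f = 0}`, with `Ω` on one side. -/
structure IsLocalDefiningFunction {n : ℕ} (Ω : Set (Eu n)) (p : Eu n) (U : Set (Eu n))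
    (f : Eu n → ℝ) : Prop where
  isOpen : IsOpen U
  mem : p ∈ U
  smooth : ContDiffOn ℝ ∞ f U
  zero : f p = 0
  fderiv_ne_zero : fderiv ℝ f p ≠ 0
  mem_iff : ∀ q ∈ U, q ∈ Ω ↔ f q ≤ 0

/-- The boundary of `Ω` is a smooth hypersurface near its point `p`. -/
def IsSmoothBoundaryPoint {n : ℕ} (Ω : Set (Eu n)) (p : Eu n) : Prop :=
  ∃ U f, IsLocalDefiningFunction Ω p U f

/-- A compact subdomain of `ℝⁿ` with piecewise smooth boundary: a compact set which is the closure
of its interior and whose boundary is a smooth hypersurface outside a set (edges, corners, ...)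
of `(n-1)`-dimensional Hausdorff measure zero. When that set is empty, the boundary is smooth. -/
structure IsCompactDomain {n : ℕ} (Ω : Set (Eu n)) : Prop where
  isCompact : IsCompact Ω
  closure_interior : closure (interior Ω) = Ω
  singular_null :
    MeasureTheory.Measure.hausdorffMeasure ((n : ℝ) - 1)
      {p ∈ frontier Ω | ¬ IsSmoothBoundaryPoint Ω p} = 0

/-! ### Closed forms and Dirichlet forms -/

/-- The `p`-form `α` is closed on `Ω`. For forms that are `C¹` on the closure of the interior, it
is the same to ask `dα = 0` in the interior. -/
def IsClosedForm {n p : ℕ} (Ω : Set (Eu n)) (α : Eu n → Eu n [⋀^Fin p]→L[ℝ] ℝ) : Prop :=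
  ∀ x ∈ interior Ω, extDeriv α x = 0

/-- The `p`-form `α` is a Dirichlet form on `Ω`: `α(V₁, …, V_p) = 0` whenever `V₁, …, V_p` are
tangent to `∂Ω` at a (smooth) point of the boundary, that is, are in the kernel of the differential
of a local defining function. -/
def IsDirichletForm {n p : ℕ} (Ω : Set (Eu n)) (α : Eu n → Eu n [⋀^Fin p]→L[ℝ] ℝ) : Prop :=
  ∀ (x : Eu n) (U : Set (Eu n)) (f : Eu n → ℝ), IsLocalDefiningFunction Ω x U f →
    ∀ V : Fin p → Eu n, (∀ i, fderiv ℝ f x (V i) = 0) → α x V = 0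

/-! ### Exterior algebra -/

/-- The wedge product of alternating forms (the sum over shuffles). -/
def wedge {W : Type} [AddCommGroup W] [Module ℝ W] {p q r : ℕ} (h : p + q = r)
    (a : W [⋀^Fin p]→ₗ[ℝ] ℝ) (b : W [⋀^Fin q]→ₗ[ℝ] ℝ) : W [⋀^Fin r]→ₗ[ℝ] ℝ :=
  ((LinearMap.mul' ℝ ℝ).compAlternatingMap (a.domCoprod b)).domDomCongr
    (finSumFinEquiv.trans (finCongr h))

/-- The Euclidean volume form `det` of `ℝⁿ`. -/
def volForm (n : ℕ) : Eu n [⋀^Fin n]→ₗ[ℝ] ℝ :=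
  (EuclideanSpace.basisFun (Fin n) ℝ).toBasis.det

/-- The standard volume form of the unit sphere `S^m ⊆ ℝ^{m+1}` at the point `u`: contraction
of the Euclidean volume form with the outward unit normal `u`. -/
def sphereVolForm {m : ℕ} (u : Eu (m + 1)) : Eu (m + 1) [⋀^Fin m]→ₗ[ℝ] ℝ :=
  (volForm (m + 1)).curryLeft u

/-- The total volume of the unit sphere `S^m`. -/
def sphereVol (m : ℕ) : ℝ :=
  (MeasureTheory.volume : MeasureTheory.Measure (Eu (m + 1))).toSphere.real Set.univ

/-! ### The Gauss map and the integrand on the configuration space of pairs `(x, y)`, `x ≠ y` -/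

/-- The Gauss map `g(x, y) = (y - x) / ‖y - x‖`. -/
def gaussMap {n : ℕ} (p : Eu n × Eu n) : Eu n := ‖p.2 - p.1‖⁻¹ • (p.2 - p.1)

/-- The pullback `g^* dVol` of the volume form of `S^m` under the Gauss map. -/
def gaussForm {m : ℕ} (p : Eu (m + 1) × Eu (m + 1)) :
    (Eu (m + 1) × Eu (m + 1)) [⋀^Fin m]→ₗ[ℝ] ℝ :=
  (sphereVolForm (gaussMap p)).compLinearMap (fderiv ℝ gaussMap p).toLinearMap

/-- The pullback `α_y` of `α` under `(x, y) ↦ y`. -/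
def pullbackY {n p : ℕ} (α : Eu n → Eu n [⋀^Fin p]→L[ℝ] ℝ) (z : Eu n × Eu n) :
    (Eu n × Eu n) [⋀^Fin p]→ₗ[ℝ] ℝ :=
  (α z.2).toAlternatingMap.compLinearMap (LinearMap.snd ℝ (Eu n) (Eu n))

/-- The `(3k+1)`-form `α_y ∧ g^* dVol`. -/
def bsForm {k : ℕ} (α : Eu (2 * k + 1) → Eu (2 * k + 1) [⋀^Fin (k + 1)]→L[ℝ] ℝ)
    (z : Eu (2 * k + 1) × Eu (2 * k + 1)) :
    (Eu (2 * k + 1) × Eu (2 * k + 1)) [⋀^Fin ((2 * k + 1) + k)]→ₗ[ℝ] ℝ :=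
  wedge (by omega) (pullbackY α z) (gaussForm z)

/-! ### Integration over the fibre of `(x, y) ↦ x` -/

/-- The fibre over `x` of the configuration space of pairs of distinct points of `Ω`. The fibre
`C_{2,1}[Ω]` of the compactified configuration space adds to it only a boundary, which
does not contribute to integrals over the fibre. -/
def configFiber {n : ℕ} (Ω : Set (Eu n)) (x : Eu n) : Set (Eu n) := {y ∈ Ω | y ≠ x}

/-- An alternating map on a Euclidean space is continuous. -/
theorem continuous_alternating {n k : ℕ} (f : Eu n [⋀^Fin k]→ₗ[ℝ] ℝ) : Continuous f := by
  have h : (f : (Fin k → Eu n) → ℝ) = fun v => ∑ r : Fin k → Fin n,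
      (∏ i, v i (r i)) * f (fun i => EuclideanSpace.basisFun (Fin n) ℝ (r i)) := by
    funext v
    have hv : v = fun i => ∑ j, v i j • EuclideanSpace.basisFun (Fin n) ℝ j := by
      funext i
      simpa using ((EuclideanSpace.basisFun (Fin n) ℝ).sum_repr (v i)).symm
    conv_lhs => rw [hv]
    rw [← AlternatingMap.coe_multilinearMap, MultilinearMap.map_sum]
    refine Finset.sum_congr rfl fun r _ => ?_
    rw [MultilinearMap.map_smul_univ]
    rfl
  rw [h]
  fun_prop

/-- The fibre directions, ordered as a frame: the fibre is oriented by the coordinates of the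
offset `x - y`, so that the frame is `(-∂/∂y₁, …, -∂/∂yₙ)`. -/
def fiberFrame (n : ℕ) (i : Fin n) : Eu n × Eu n :=
  (0, -EuclideanSpace.basisFun (Fin n) ℝ i)

/-- Contraction of an `(n+k)`-form with the fibre frame, the fibre directions coming first:
`(v₁, …, v_k) ↦ β(-∂/∂y₁, …, -∂/∂yₙ, v₁, …, v_k)`, with `v_j` lifted to `(v_j, 0)`.
Any other lift differs by a fibre direction and gives the same value. -/
def fiberContract {n k : ℕ} (β : (Eu n × Eu n) [⋀^Fin (n + k)]→ₗ[ℝ] ℝ) :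
    Eu n [⋀^Fin k]→L[ℝ] ℝ :=
  let f : Eu n [⋀^Fin k]→ₗ[ℝ] ℝ :=
    { toFun := fun v => (β.domDomCongr finSumFinEquiv.symm)
        (Sum.elim (fiberFrame n) (fun j => LinearMap.inl ℝ (Eu n) (Eu n) (v j)))
      map_update_add' := by
        intro _ v j a b
        have key : ∀ c : Eu n, Sum.elim (fiberFrame n)
            (fun i => LinearMap.inl ℝ (Eu n) (Eu n) (Function.update v j c i)) =
            Function.update (Sum.elim (fiberFrame n)
              (fun i => LinearMap.inl ℝ (Eu n) (Eu n) (v i))) (Sum.inr j)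
              (LinearMap.inl ℝ (Eu n) (Eu n) c) := by
          intro c
          funext s
          rcases s with i | i
          · simp
          · by_cases hij : i = j
            · subst hij; simp
            · simp [Function.update, hij]
        rw [key, key, key, map_add, AlternatingMap.map_update_add]
      map_update_smul' := by
        intro _ v j c a
        have key : ∀ c : Eu n, Sum.elim (fiberFrame n)
            (fun i => LinearMap.inl ℝ (Eu n) (Eu n) (Function.update v j c i)) =
            Function.update (Sum.elim (fiberFrame n)
              (fun i => LinearMap.inl ℝ (Eu n) (Eu n) (v i))) (Sum.inr j)
              (LinearMap.inl ℝ (Eu n) (Eu n) c) := by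
          intro c
          funext s
          rcases s with i | i
          · simp
          · by_cases hij : i = j
            · subst hij; simp
            · simp [Function.update, hij]
        rw [key, key, map_smul, AlternatingMap.map_update_smul]
      map_eq_zero_of_eq' := by
        intro v i j hv hij
        refine AlternatingMap.map_eq_zero_of_eq _ _ (i := Sum.inr i) (j := Sum.inr j) ?_ ?_
        · simp [hv]
        · simpa using hij }
  { f with cont := continuous_alternating f }

theorem fiberContract_apply {n k : ℕ} (β : (Eu n × Eu n) [⋀^Fin (n + k)]→ₗ[ℝ] ℝ)
    (v : Fin k → Eu n) :
    fiberContract β v = β (Fin.append (fiberFrame n) (fun j => (v j, 0))) := by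
  change β _ = _
  congr 1
  funext s
  refine Fin.addCases (fun i => ?_) (fun i => ?_) s <;> simp

/-- Integration over the fibre: the `k`-form
`(v₁, …, v_k) ↦ ∫_{y ∈ F} β_{(x,y)}(-∂/∂y₁, …, -∂/∂yₙ, v₁, …, v_k) dy` at `x`. -/
def fiberIntegral {n k : ℕ} (F : Set (Eu n))
    (β : Eu n × Eu n → (Eu n × Eu n) [⋀^Fin (n + k)]→ₗ[ℝ] ℝ) (x : Eu n) :
    Eu n [⋀^Fin k]→L[ℝ] ℝ :=
  ∫ y in F, fiberContract (β (x, y))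

/-- The Biot-Savart operator
`BS(α) = (1 / Vol S^{2k}) ∫_{C_{2,1}[Ω]} α_y ∧ g^* dVol`. -/
def BS {k : ℕ} (Ω : Set (Eu (2 * k + 1)))
    (α : Eu (2 * k + 1) → Eu (2 * k + 1) [⋀^Fin (k + 1)]→L[ℝ] ℝ) (x : Eu (2 * k + 1)) :
    Eu (2 * k + 1) [⋀^Fin k]→L[ℝ] ℝ :=
  (1 / sphereVol (2 * k)) • fiberIntegral (configFiber Ω x) (bsForm α) x

end BiotSavart

end

/-!
The contraction of the integrand with the fibre frame is elementary (`fiberContract_bsForm`): with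
`K(w) = w / ‖w‖ⁿ` the Newtonian field, `BS(α)_x(v) = Vol⁻¹ ∫ α_y(K(x - y), v) dy`, so that the
components of `BS(α)` are sums of components of the vector potentials `∫ a(y) K(x - y) dy` of the
coefficients `a` of `α`. Replacing `‖w‖` by `√(‖w‖² + ε²)` gives a smooth field `K_ε` whose
differential is symmetric, and whose divergence is an approximate identity times `Vol`.

For a closed Dirichlet form and `ψ ∈ C¹(ℝⁿ)`, the integral of `dψ ∧ α` over `Ω` vanishes
(`integral_formField_eq_zero`). For `ψ` the components of `K_ε(x - ·)` this says that `Vol` times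
the exterior derivative of the regularised `BS(α)` is the trace of the derivative of the potential
of `α`, that is, the mollification of `α` (`sum_potentialDeriv_eq`). As `ε → 0` the formula
`d BS(α) = α` appears in the interior, provided the derivatives of the potentials converge; it holds
at a smooth boundary point by continuity, provided the limits extend continuously and the potentials
are differentiable there.

The integral of `dψ ∧ α` is that of the divergence of `ψ Y`, where the field `Y` is divergence free
in the interior and tangent to the boundary. Tangency makes a divergence theorem without surface
integrals possible: in a chart with defining function `f`, the field is cut off in a thin layer
along `{f = 0}`, and the derivative of the cut-off is paired with a field which is `O(f)` in the
normal direction (`integral_divergence_interior_eq_zero`). The edges and corners, a compact set of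
vanishing `(n-1)`-dimensional measure, are removed by a cut-off function whose gradient has
arbitrarily small integral (`exists_cutoff`).

Convergence and continuity up to the boundary of the derivatives of a potential
(`exists_hasFDerivWithinAt_potential`) are obtained without singular integrals. The derivative in
the direction of a field tangent to the boundary is, by the same divergence theorem, a weakly
singular integral, which converges uniformly; the trace converges by the previous paragraphs; and a
symmetric matrix is determined by its values on a hyperplane and its trace (`recoverMap_eq`). A
bounded limit of derivatives which is continuous at a boundary point is the derivative of the limit
there (`hasFDerivWithinAt_of_tendsto`).
-/

noncomputable section

namespace BiotSavart

/-! ### Exterior algebra of the integrand -/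

/-- Adding multiples of one argument to all the others does not change the value of an
alternating map. -/
theorem map_add_smul_of_ne {W ι : Type*} [AddCommGroup W] [Module ℝ W] [Fintype ι] [DecidableEq ι]
    (f : W [⋀^ι]→ₗ[ℝ] ℝ) (v : ι → W) (j : ι) (c : ι → ℝ) :
    f (fun i => if i = j then v j else v i + c i • v j) = f v := by
  have key : ∀ s : Finset ι, j ∉ s → f (fun i => if i ∈ s then v i + c i • v j else v i) = f v := by
    intro s
    induction s using Finset.induction_on with
    | empty => intro _; simp
    | insert a s ha ih =>
      intro hj
      have hja : j ≠ a := fun h => hj (by simp [h])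
      have hjs : j ∉ s := fun h => hj (by simp [h])
      set w : ι → W := fun i => if i ∈ s then v i + c i • v j else v i with hw
      have hwj : w j = v j := by simp [hw, hjs]
      have hwa : w a = v a := by simp [hw, ha]
      have h1 : (fun i => if i ∈ insert a s then v i + c i • v j else v i)
          = Function.update w a (w a + c a • w j) := by
        funext i
        by_cases hi : i = a
        · subst hi; simp [hwj, hwa]
        · simp [hw, hi]
      rw [h1, AlternatingMap.map_update_add, AlternatingMap.map_update_smul,
        Function.update_eq_self, AlternatingMap.map_update_self f w hja.symm, smul_zero, add_zero]
      exact ih hjs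
  convert! key (Finset.univ.erase j) (by simp) using 3 with i
  by_cases hi : i = j <;> simp [hi]

theorem map_swap_blocks {W κ : Type*} [AddCommGroup W] [Module ℝ W] [Fintype κ] [DecidableEq κ]
    (g : W [⋀^κ ⊕ κ]→ₗ[ℝ] ℝ) (f v : κ → W) :
    g (Sum.elim f v) = (-1) ^ Fintype.card κ * g (Sum.elim v f) := by
  have hs : Equiv.Perm.sign (Equiv.sumComm κ κ : Equiv.Perm (κ ⊕ κ)) = (-1) ^ Fintype.card κ := by
    have h := Equiv.Perm.sign_prodCongrRight (fun _ : κ => Equiv.swap false true)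
    rw [Equiv.Perm.sign_eq_sign_of_equiv (Equiv.sumComm κ κ)
      (Equiv.prodCongrRight fun _ : κ => Equiv.swap false true)
      ((Equiv.boolProdEquivSum κ).symm.trans (Equiv.prodComm _ _)) ?_, h]
    · simp
    · rintro (x | x) <;> simp
  have h := g.map_perm (Sum.elim v f) (Equiv.sumComm κ κ)
  rw [hs] at h
  have h2 : (Sum.elim v f ∘ (Equiv.sumComm κ κ : Equiv.Perm (κ ⊕ κ))) = Sum.elim f v := by
    funext s; rcases s with s | s <;> rfl
  rw [h2] at h
  rw [h]
  rcases Nat.even_or_odd (Fintype.card κ) with h | h <;> simp [h.neg_one_pow]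

/-- A wedge product all of whose shuffles vanish. -/
theorem domCoprod_eq_zero_of_forall {W ι κ : Type*} [AddCommGroup W] [Module ℝ W] [Fintype ι]
    [DecidableEq ι] [Fintype κ] [DecidableEq κ] (a : W [⋀^ι]→ₗ[ℝ] ℝ) (b : W [⋀^κ]→ₗ[ℝ] ℝ)
    (z : ι ⊕ κ → W)
    (h : ∀ σ : Equiv.Perm (ι ⊕ κ),
      a (fun i => z (σ (Sum.inl i))) * b (fun j => z (σ (Sum.inr j))) = 0) :
    (LinearMap.mul' ℝ ℝ).compAlternatingMap (a.domCoprod b) z = 0 := by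
  rw [LinearMap.compAlternatingMap_apply, AlternatingMap.domCoprod_apply,
    _root_.sum_apply, map_sum]
  refine Finset.sum_eq_zero fun σ _ => ?_
  induction σ using Quotient.inductionOn' with
  | h σ =>
    rw [AlternatingMap.domCoprod.summand_mk'']
    have := h σ
    simp only [_root_.smul_apply, MultilinearMap.domDomCongr_apply, MultilinearMap.domCoprod_apply,
      AlternatingMap.coe_multilinearMap, map_zsmul_unit, LinearMap.mul'_apply, this, smul_zero]

/-- A wedge product in which only the identity shuffle contributes. -/
theorem domCoprod_eq_mul_of_forall {W ι κ : Type*} [AddCommGroup W] [Module ℝ W] [Fintype ι]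
    [DecidableEq ι] [Fintype κ] [DecidableEq κ] (a : W [⋀^ι]→ₗ[ℝ] ℝ) (b : W [⋀^κ]→ₗ[ℝ] ℝ)
    (z : ι ⊕ κ → W)
    (h : ∀ σ : Equiv.Perm (ι ⊕ κ), (∃ i j, σ (Sum.inl i) = Sum.inr j) →
      a (fun i => z (σ (Sum.inl i))) * b (fun j => z (σ (Sum.inr j))) = 0) :
    (LinearMap.mul' ℝ ℝ).compAlternatingMap (a.domCoprod b) z
      = a (fun i => z (Sum.inl i)) * b (fun j => z (Sum.inr j)) := by
  rw [LinearMap.compAlternatingMap_apply, AlternatingMap.domCoprod_apply,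
    _root_.sum_apply, map_sum]
  refine (Finset.sum_eq_single (Quotient.mk'' (1 : Equiv.Perm (ι ⊕ κ)) :
    Equiv.Perm.ModSumCongr ι κ) ?_ ?_).trans ?_
  · intro σ _ hσ
    induction σ using Quotient.inductionOn' with
    | h σ =>
      rw [AlternatingMap.domCoprod.summand_mk'']
      have h0 : ∃ i j, σ (Sum.inl i) = Sum.inr j := by
        by_contra hcon
        push Not at hcon
        apply hσ
        have hm : Set.MapsTo σ (Set.range Sum.inl) (Set.range Sum.inl) := by
          rintro _ ⟨i, rfl⟩
          rcases hi : σ (Sum.inl i) with l | r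
          · exact ⟨l, rfl⟩
          · exact (hcon i r hi).elim
        apply Quotient.sound'
        rw [QuotientGroup.leftRel_apply, mul_one]
        exact inv_mem (Equiv.Perm.mem_sumCongrHom_range_of_perm_mapsTo_inl hm)
      have := h σ h0
      simp only [_root_.smul_apply, MultilinearMap.domDomCongr_apply,
        MultilinearMap.domCoprod_apply, AlternatingMap.coe_multilinearMap, map_zsmul_unit,
        LinearMap.mul'_apply, this, smul_zero]
  · intro h; exact (h (Finset.mem_univ _)).elim
  · rw [AlternatingMap.domCoprod.summand_mk'']
    simp

/-- An alternating map on `ι ⊕ κ` with the arguments in `κ` fixed. -/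
def fixRight {W ι κ : Type*} [AddCommGroup W] [Module ℝ W]
    (g : W [⋀^ι ⊕ κ]→ₗ[ℝ] ℝ) (u : κ → W) : W [⋀^ι]→ₗ[ℝ] ℝ where
  toFun v := g (Sum.elim v u)
  map_update_add' v i x y := by
    classical
    have h : ∀ c, Sum.elim (Function.update v i c) u
        = Function.update (Sum.elim v u) (Sum.inl i) c := fun c => by
      rw [Sum.update_elim_inl]
    simp only [h]
    exact g.map_update_add _ _ _ _
  map_update_smul' v i c x := by
    classical
    have h : ∀ c, Sum.elim (Function.update v i c) u
        = Function.update (Sum.elim v u) (Sum.inl i) c := fun c => by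
      rw [Sum.update_elim_inl]
    simp only [h]
    exact g.map_update_smul _ _ _ _
  map_eq_zero_of_eq' v i j hv hij :=
    g.map_eq_zero_of_eq (Sum.elim v u) (i := Sum.inl i) (j := Sum.inl j) (by simpa using hv)
      (by simpa using hij)

/-- The Gauss form in closed form: `g^* dVol` is minus the solid angle form of the offset
`x - y`, since the Gauss map is its direction composed with the antipodal map of an even-dimensional
sphere. -/
theorem gaussForm_apply {m : ℕ} (hm : Even m) {x y : Eu (m + 1)} (hxy : y ≠ x)
    (z : Fin m → Eu (m + 1) × Eu (m + 1)) :
    gaussForm (x, y) z = -(‖x - y‖ ^ (m + 1))⁻¹ *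
      volForm (m + 1) (Fin.cons (x - y) fun i => (z i).1 - (z i).2) := by
  have hd : y - x ≠ 0 := sub_ne_zero.mpr hxy
  set r : ℝ := ‖y - x‖ with hr
  have hr0 : r ≠ 0 := by simpa [hr] using hd
  have h1 : HasFDerivAt (fun p : Eu (m + 1) × Eu (m + 1) => p.2 - p.1)
      (ContinuousLinearMap.snd ℝ _ _ - ContinuousLinearMap.fst ℝ _ _) (x, y) :=
    hasFDerivAt_snd.sub hasFDerivAt_fst
  have h2 : DifferentiableAt ℝ (fun p : Eu (m + 1) × Eu (m + 1) => ‖p.2 - p.1‖⁻¹) (x, y) := by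
    refine DifferentiableAt.inv ?_ (by simpa using hd)
    exact DifferentiableAt.norm ℝ h1.differentiableAt (by simpa using hd)
  have h3 := (h2.hasFDerivAt.smul h1).fderiv
  set c := fderiv ℝ (fun p : Eu (m + 1) × Eu (m + 1) => ‖p.2 - p.1‖⁻¹) (x, y) with hc
  have h4 : ∀ ζ : Eu (m + 1) × Eu (m + 1), fderiv ℝ gaussMap (x, y) ζ
      = r⁻¹ • (ζ.2 - ζ.1) + c ζ • (y - x) := by
    intro ζ
    change fderiv ℝ (fun p : Eu (m + 1) × Eu (m + 1) => ‖p.2 - p.1‖⁻¹ • (p.2 - p.1)) (x, y) ζ = _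
    erw [h3]
    simp [hr]
  set V : Fin (m + 1) → Eu (m + 1) := Fin.cons (x - y) fun i => (z i).1 - (z i).2 with hV
  have h5 : gaussForm (x, y) z = volForm (m + 1) (Fin.cons (r⁻¹ • (y - x)) fun i =>
      r⁻¹ • ((z i).2 - (z i).1) + c (z i) • (y - x)) := by
    change volForm (m + 1) (Matrix.vecCons (gaussMap (x, y))
      (fun i => fderiv ℝ gaussMap (x, y) (z i))) = _
    simp only [h4]
    rfl
  rw [h5]
  have h6 := map_add_smul_of_ne (volForm (m + 1)) (fun i => (-r⁻¹) • V i) 0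
    (Fin.cons 0 fun i => c (z i) * r)
  have h7 : (Fin.cons (r⁻¹ • (y - x)) fun i =>
      r⁻¹ • ((z i).2 - (z i).1) + c (z i) • (y - x) : Fin (m + 1) → Eu (m + 1)) =
      fun i => if i = 0 then (-r⁻¹) • V 0 else
        (-r⁻¹) • V i + (Fin.cons 0 fun i => c (z i) * r : Fin (m + 1) → ℝ) i • (-r⁻¹) • V 0 := by
    funext i
    refine Fin.cases ?_ (fun i => ?_) i
    · simp only [Fin.cons_zero, if_true, hV]
      rw [neg_smul, ← smul_neg, neg_sub]
    · simp only [Fin.cons_succ, Fin.succ_ne_zero, if_false, hV, Fin.cons_zero]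
      rw [neg_smul, ← smul_neg, neg_sub, neg_smul, ← smul_neg, neg_sub, smul_smul, mul_assoc,
        mul_inv_cancel₀ hr0, mul_one]
  rw [h7, h6]
  have h8 := (volForm (m + 1)).map_smul_univ (fun _ => -r⁻¹) V
  rw [h8]
  have hrw : ‖x - y‖ = r := norm_sub_rev _ _
  rw [hrw]
  simp [hm.add_one.neg_pow]

/-- The first `k + 1` and the last `k` of `2k + 1` indices. -/
def splitFrame (k : ℕ) : Fin (k + 1) ⊕ Fin k ≃ Fin (2 * k + 1) :=
  finSumFinEquiv.trans (finCongr (by omega))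

/-- The first and the last `k` of `2k` indices. -/
def splitEven (k : ℕ) : Fin k ⊕ Fin k ≃ Fin (2 * k) :=
  finSumFinEquiv.trans (finCongr (by omega))

/-- The arguments of `α_y ∧ g^* dVol` for the fibre frame `-e` and the horizontal vectors `v`, in
the order in which the identity shuffle distributes them. -/
def bsArgs {k : ℕ} (e : Fin (2 * k + 1) → Eu (2 * k + 1)) (v : Fin k → Eu (2 * k + 1)) :
    Fin (k + 1) ⊕ Fin (2 * k) → Eu (2 * k + 1) × Eu (2 * k + 1) := fun s =>
  (Fin.append (fun i => (0, -e i)) (fun j => (v j, 0)) :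
      Fin ((2 * k + 1) + k) → Eu (2 * k + 1) × Eu (2 * k + 1))
    (finCongr (by omega) (finSumFinEquiv s : Fin ((k + 1) + 2 * k)))

section
variable {k : ℕ} (e : Fin (2 * k + 1) → Eu (2 * k + 1)) (v : Fin k → Eu (2 * k + 1))

theorem bsArgs_inl (i : Fin (k + 1)) :
    bsArgs e v (Sum.inl i) = (0, -e (splitFrame k (Sum.inl i))) := by
  unfold bsArgs
  have : finCongr (by omega) (finSumFinEquiv (Sum.inl i) : Fin ((k + 1) + 2 * k))
      = Fin.castAdd k (splitFrame k (Sum.inl i)) := by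
    ext; simp [splitFrame]
  rw [this, Fin.append_left]

theorem bsArgs_inr_inl (j : Fin k) :
    bsArgs e v (Sum.inr (splitEven k (Sum.inl j))) = (0, -e (splitFrame k (Sum.inr j))) := by
  unfold bsArgs
  have : finCongr (by omega)
        (finSumFinEquiv (Sum.inr (splitEven k (Sum.inl j))) : Fin ((k + 1) + 2 * k))
      = Fin.castAdd k (splitFrame k (Sum.inr j)) := by
    ext; simp [splitFrame, splitEven]
  rw [this, Fin.append_left]

theorem bsArgs_inr_inr (j : Fin k) :
    bsArgs e v (Sum.inr (splitEven k (Sum.inr j))) = (v j, 0) := by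
  unfold bsArgs
  have : finCongr (by omega)
        (finSumFinEquiv (Sum.inr (splitEven k (Sum.inr j))) : Fin ((k + 1) + 2 * k))
      = Fin.natAdd (2 * k + 1) j := by
    ext; simp [splitEven]; omega
  rw [this, Fin.append_right]

/-- If a horizontal vector is not an argument of the second factor, it is one of the first. -/
theorem exists_inr_of_perm_ne {σ : Equiv.Perm (Fin (k + 1) ⊕ Fin (2 * k))}
    (a : Eu (2 * k + 1) [⋀^Fin (k + 1)]→ₗ[ℝ] ℝ)
    (ha : a (fun i => (bsArgs e v (σ (Sum.inl i))).2) ≠ 0) (j : Fin k) :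
    ∃ l, σ (Sum.inr l) = Sum.inr (splitEven k (Sum.inr j)) := by
  obtain ⟨s, hs⟩ := σ.surjective (Sum.inr (splitEven k (Sum.inr j)))
  rcases s with i | l
  · refine (ha (a.map_coord_zero i ?_)).elim
    rw [hs, bsArgs_inr_inr]
  · exact ⟨l, hs⟩

end

/-- The contraction of `α_y ∧ g^* dVol` with the fibre frame is the interior product of `α` with
the Newtonian field: moving to a frame whose first vectors are `x - y, v₁, …, v_k`, the identity
is the only shuffle which contributes. -/
theorem fiberContract_bsForm {k : ℕ}
    (α : Eu (2 * k + 1) → Eu (2 * k + 1) [⋀^Fin (k + 1)]→L[ℝ] ℝ) {x y : Eu (2 * k + 1)}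
    (hxy : y ≠ x) (v : Fin k → Eu (2 * k + 1)) :
    fiberContract (bsForm α (x, y)) v
      = (‖x - y‖ ^ (2 * k + 1))⁻¹ * α y (Fin.cons (x - y) v) := by
  set A : Eu (2 * k + 1) [⋀^Fin (k + 1)]→ₗ[ℝ] ℝ := (α y).toAlternatingMap with hA
  set a := pullbackY α (x, y) with ha
  have haA : ∀ z, a z = A (fun i => (z i).2) := fun z => rfl
  set b : (Eu (2 * k + 1) × Eu (2 * k + 1)) [⋀^Fin (2 * k)]→ₗ[ℝ] ℝ := gaussForm (x, y) with hb
  set c : ℝ := -(‖x - y‖ ^ (2 * k + 1))⁻¹ with hc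
  set w := x - y with hw
  have hbc : ∀ z, b z = c * volForm (2 * k + 1) (Fin.cons w fun i => (z i).1 - (z i).2) :=
    gaussForm_apply (even_two_mul k) hxy
  set u : Fin (k + 1) → Eu (2 * k + 1) := Fin.cons w v with hu
  -- the value on the frame `-e`, as a multiple of the determinant of `e`
  set β : (Eu (2 * k + 1) × Eu (2 * k + 1)) [⋀^Fin (2 * k + 1 + k)]→ₗ[ℝ] ℝ := bsForm α (x, y) with hβ
  set Q : Eu (2 * k + 1) [⋀^Fin (2 * k + 1)]→ₗ[ℝ] ℝ :=
    (fixRight (β.domDomCongr finSumFinEquiv.symm) fun j => (v j, 0)).compLinearMap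
      (-(LinearMap.inr ℝ (Eu (2 * k + 1)) (Eu (2 * k + 1)))) with hQ
  have hQe : ∀ e, Q e = (LinearMap.mul' ℝ ℝ).compAlternatingMap (a.domCoprod b) (bsArgs e v) := by
    intro e
    have h1 : Q e = β (Fin.append (fun i => (0, -e i)) fun j => (v j, 0)) := by
      change β (fun i => Sum.elim (fun i => -((0 : Eu (2 * k + 1)), e i))
        (fun j => (v j, (0 : Eu (2 * k + 1))))
        (finSumFinEquiv.symm i)) = _
      congr 1
      funext s
      refine Fin.addCases (fun i => ?_) (fun i => ?_) s <;> simp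
    rw [h1]
    rfl
  have hQdet : ∀ e, Q e = fiberContract β v * volForm (2 * k + 1) e := by
    intro e
    have h1 := Q.eq_smul_basis_det (EuclideanSpace.basisFun (Fin (2 * k + 1)) ℝ).toBasis
    have h2 : Q (EuclideanSpace.basisFun (Fin (2 * k + 1)) ℝ).toBasis = fiberContract β v := by
      rw [fiberContract_apply, hQe]
      simp only [OrthonormalBasis.coe_toBasis]
      rfl
    rw [h1, h2]
    rfl
  by_cases hind : LinearIndependent ℝ u
  · -- a basis which starts with `w, v₁, …, v_k`
    obtain ⟨f, hf⟩ : ∃ f : Fin k → Eu (2 * k + 1), LinearIndependent ℝ (Sum.elim u f) := by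
      set B := Module.Basis.sumExtend hind with hB
      have hfin : Finite (Module.Basis.sumExtendIndex hind) := by
        have : Finite (Fin (k + 1) ⊕ Module.Basis.sumExtendIndex hind) :=
          Module.Finite.finite_basis B
        exact Finite.of_injective (Sum.inr : _ → Fin (k + 1) ⊕ _) Sum.inr_injective
      have hcard : Nat.card (Module.Basis.sumExtendIndex hind) = k := by
        have h1 := Module.finrank_eq_nat_card_basis B
        rw [finrank_euclideanSpace_fin, Nat.card_sum, Nat.card_eq_fintype_card,
          Fintype.card_fin] at h1
        omega
      let E := (Finite.equivFinOfCardEq hcard).symm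
      refine ⟨fun j => B (Sum.inr (E j)), ?_⟩
      have h2 := B.linearIndependent.comp (Sum.map id E)
        (Function.Injective.sumMap Function.injective_id E.injective)
      convert! h2 using 1
      funext s
      rcases s with s | s
      · simp only [hB, Module.Basis.sumExtend, Trans.trans, Module.Basis.reindex_apply,
          Module.Basis.coe_extend, Function.comp_apply, Sum.map_inl, id]
        exact (congrArg Subtype.val (Equiv.Set.sumDiffSubset_apply_inl
          (hind.linearIndepOn_id.subset_extend (Set.subset_univ _)) ⟨u s, s, rfl⟩)).symm
      · rfl
    set e : Fin (2 * k + 1) → Eu (2 * k + 1) := Sum.elim u f ∘ (splitFrame k).symm with he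
    have hdet : volForm (2 * k + 1) e ≠ 0 := by
      have h1 : LinearIndependent ℝ e := hf.comp _ (splitFrame k).symm.injective
      have hcard : Fintype.card (Fin (2 * k + 1)) = Module.finrank ℝ (Eu (2 * k + 1)) := by simp
      have h2 := (EuclideanSpace.basisFun (Fin (2 * k + 1)) ℝ).toBasis.isUnit_det
        (basisOfLinearIndependentOfCardEqFinrank h1 hcard)
      rw [coe_basisOfLinearIndependentOfCardEqFinrank] at h2
      exact h2.ne_zero
    have hl : ∀ i, bsArgs e v (Sum.inl i) = (0, -u i) := fun i => by
      rw [bsArgs_inl]; simp [he]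
    have hrl : ∀ j, bsArgs e v (Sum.inr (splitEven k (Sum.inl j))) = (0, -f j) := fun j => by
      rw [bsArgs_inr_inl]; simp [he]
    have hrr := bsArgs_inr_inr e v
    have h1 := domCoprod_eq_mul_of_forall a b (bsArgs e v) ?_
    · have h2 : a (fun i => bsArgs e v (Sum.inl i)) = (-1) ^ (k + 1) * A u := by
        rw [haA]
        simp only [hl]
        have := A.map_smul_univ (fun _ => (-1 : ℝ)) u
        simpa using this
      have h3 : b (fun j => bsArgs e v (Sum.inr j)) = c * ((-1) ^ k * volForm (2 * k + 1) e) := by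
        rw [hbc]
        congr 1
        set T : Eu (2 * k + 1) [⋀^Fin k ⊕ Fin k]→ₗ[ℝ] ℝ :=
          ((volForm (2 * k + 1)).curryLeft w).domDomCongr (splitEven k).symm with hT
        have hTa : ∀ s, T s = volForm (2 * k + 1) (Fin.cons w fun i => s ((splitEven k).symm i)) :=
          fun s => rfl
        have h4 := map_swap_blocks T f v
        rw [hTa, hTa, Fintype.card_fin] at h4
        convert! h4 using 2
        · congr 1
          funext i
          obtain ⟨s, rfl⟩ := (splitEven k).surjective i
          rcases s with j | j
          · rw [hrl]; simp
          · rw [hrr]; simp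
        · congr 1
          funext i
          refine Fin.cases ?_ (fun i => ?_) i
          · have : (splitFrame k).symm 0 = Sum.inl 0 := by
              rw [Equiv.symm_apply_eq]; ext; simp [splitFrame]
            simp only [he, Function.comp_apply]
            erw [this]
            rfl
          · obtain ⟨s, rfl⟩ := (splitEven k).surjective i
            rcases s with j | j
            · have : (splitFrame k).symm (splitEven k (Sum.inl j)).succ = Sum.inl j.succ := by
                rw [Equiv.symm_apply_eq]; ext; simp [splitFrame, splitEven]
              simp only [he, Function.comp_apply]
              erw [this]
              simp [hu]
            · have : (splitFrame k).symm (splitEven k (Sum.inr j)).succ = Sum.inr j := by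
                rw [Equiv.symm_apply_eq]; ext; simp [splitFrame, splitEven]; omega
              simp only [he, Function.comp_apply]
              erw [this]
              simp
      have h4 : fiberContract β v * volForm (2 * k + 1) e = -(c * A u) * volForm (2 * k + 1) e := by
        rw [← hQdet, hQe, h1, h2, h3]
        have : ((-1 : ℝ) ^ k) * (-1) ^ k = 1 := by rw [← mul_pow]; simp
        linear_combination (-(c * A u) * volForm (2 * k + 1) e) * this
      rw [mul_right_cancel₀ hdet h4, hc]
      change _ = _ * A u
      ring
    · rintro σ ⟨i₀, j₀, hσ⟩
      by_cases hAz : a (fun i => bsArgs e v (σ (Sum.inl i))) = 0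
      · rw [hAz, zero_mul]
      rw [haA] at hAz
      have hv := exists_inr_of_perm_ne e v A hAz
      -- some vector of the first block is an argument of the second factor
      obtain ⟨j₁, i₁, hj₁⟩ : ∃ j i, σ (Sum.inr j) = Sum.inl i := by
        by_contra hcon
        push Not at hcon
        have hm : Set.MapsTo σ (Set.range Sum.inr) (Set.range Sum.inr) := by
          rintro _ ⟨j, rfl⟩
          rcases hj : σ (Sum.inr j) with l | r
          · exact (hcon j l hj).elim
          · exact ⟨r, rfl⟩
        obtain ⟨l, hl⟩ := (Equiv.Perm.perm_mapsTo_inl_iff_mapsTo_inr σ).mpr hm ⟨i₀, rfl⟩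
        rw [hσ] at hl
        cases hl
      have hz : b (fun j => bsArgs e v (σ (Sum.inr j))) = 0 := by
        rw [hbc]
        refine mul_eq_zero_of_right _ ?_
        revert hj₁
        refine Fin.cases (fun hj₁ => ?_) (fun i₁ hj₁ => ?_) i₁
        · refine (volForm (2 * k + 1)).map_eq_zero_of_eq _ (i := 0) (j := j₁.succ) ?_
            (Fin.succ_ne_zero _).symm
          rw [Fin.cons_zero, Fin.cons_succ, hj₁, hl]
          simp [hu]
        · obtain ⟨l, hl'⟩ := hv i₁
          refine (volForm (2 * k + 1)).map_eq_zero_of_eq _ (i := l.succ) (j := j₁.succ) ?_ ?_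
          · rw [Fin.cons_succ, Fin.cons_succ, hl', hj₁, hl, hrr]
            simp [hu]
          · intro h
            rw [Fin.succ_inj] at h
            rw [h, hj₁] at hl'
            cases hl'
      rw [hz, mul_zero]
  · have h0 : fiberContract β v = 0 := by
      have h1 := hQdet (EuclideanSpace.basisFun (Fin (2 * k + 1)) ℝ).toBasis
      have h2 : volForm (2 * k + 1) (EuclideanSpace.basisFun (Fin (2 * k + 1)) ℝ).toBasis = 1 :=
        Module.Basis.det_self _
      rw [h2, mul_one] at h1
      rw [← h1, hQe]
      refine domCoprod_eq_zero_of_forall a b _ fun σ => ?_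
      by_cases hAz : a (fun i => bsArgs
          (⇑(EuclideanSpace.basisFun (Fin (2 * k + 1)) ℝ).toBasis) v (σ (Sum.inl i))) = 0
      · rw [hAz, zero_mul]
      rw [haA] at hAz
      choose l hl using exists_inr_of_perm_ne _ v A hAz
      refine mul_eq_zero_of_right _ ?_
      rw [hbc]
      refine mul_eq_zero_of_right _ ?_
      refine (volForm (2 * k + 1)).map_linearDependent _ fun hli => hind ?_
      have hlinj : Function.Injective l := by
        intro i j hij
        have := (hl i).symm.trans ((congrArg (fun t => σ (Sum.inr t)) hij).trans (hl j))
        simpa using this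
      have h3 := hli.comp (Fin.cons 0 fun i => (l i).succ) ?_
      · convert! h3 using 1
        funext i
        refine Fin.cases ?_ (fun i => ?_) i
        · simp [hu]
        · simp only [Function.comp_apply, Fin.cons_succ, hl, bsArgs_inr_inr, hu, sub_zero]
      · rw [Fin.cons_injective_iff]
        refine ⟨?_, fun i j hij => hlinj (Fin.succ_injective _ hij)⟩
        rintro ⟨i, hi⟩
        exact Fin.succ_ne_zero _ hi
    rw [h0]
    have : A u = 0 := A.map_linearDependent u hind
    change 0 = _ * A u
    rw [this, mul_zero]

open MeasureTheory Filter Set Metric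
open scoped Topology Pointwise Manifold

variable {n : ℕ}

/-! ### The Newtonian field and its regularisation -/

/-- The regularised distance `√(‖w‖² + ε²)`. -/
def regNorm (ε : ℝ) (w : Eu n) : ℝ := √(‖w‖ ^ 2 + ε ^ 2)

theorem regNorm_zero (w : Eu n) : regNorm 0 w = ‖w‖ := by
  simp [regNorm]

theorem norm_le_regNorm (ε : ℝ) (w : Eu n) : ‖w‖ ≤ regNorm ε w :=
  Real.le_sqrt_of_sq_le (by nlinarith [sq_nonneg ε])

theorem le_regNorm (ε : ℝ) (w : Eu n) : ε ≤ regNorm ε w :=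
  Real.le_sqrt_of_sq_le (by nlinarith [sq_nonneg ‖w‖])

theorem regNorm_sq (ε : ℝ) (w : Eu n) : regNorm ε w ^ 2 = ‖w‖ ^ 2 + ε ^ 2 :=
  Real.sq_sqrt (by positivity)

theorem regNorm_nonneg (ε : ℝ) (w : Eu n) : 0 ≤ regNorm ε w := Real.sqrt_nonneg _

theorem regNorm_pos {ε : ℝ} {w : Eu n} (h : 0 < ε ∨ w ≠ 0) : 0 < regNorm ε w := by
  rcases h with h | h
  · exact h.trans_le (le_regNorm ε w)
  · exact (norm_pos_iff.mpr h).trans_le (norm_le_regNorm ε w)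

theorem hasFDerivAt_regNorm {ε : ℝ} {w : Eu n} (h : 0 < ε ∨ w ≠ 0) :
    HasFDerivAt (regNorm ε) ((regNorm ε w)⁻¹ • innerSL ℝ w) w := by
  have hp := regNorm_pos h
  have h1 : HasFDerivAt (fun w : Eu n => ‖w‖ ^ 2 + ε ^ 2) (2 • innerSL ℝ w) w :=
    (hasStrictFDerivAt_norm_sq w).hasFDerivAt.add_const _
  have h2 : ‖w‖ ^ 2 + ε ^ 2 ≠ 0 := by rw [← regNorm_sq]; positivity
  convert! h1.sqrt h2 using 1
  ext v
  simp [regNorm]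
  ring

/-- The Newtonian field `w / ‖w‖ⁿ`, regularised to `w / (‖w‖² + ε²)^(n/2)`. -/
def newtonField (ε : ℝ) (w : Eu n) : Eu n := (regNorm ε w ^ n)⁻¹ • w

/-- The differential of `newtonField`. -/
def newtonFieldDeriv (ε : ℝ) (w : Eu n) : Eu n →L[ℝ] Eu n :=
  (regNorm ε w ^ n)⁻¹ • ContinuousLinearMap.id ℝ (Eu n)
    - (n * (regNorm ε w ^ (n + 2))⁻¹) • (innerSL ℝ w).smulRight w

theorem newtonFieldDeriv_apply (ε : ℝ) (w v : Eu n) :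
    newtonFieldDeriv ε w v = (regNorm ε w ^ n)⁻¹ • v
      - (n * (regNorm ε w ^ (n + 2))⁻¹ * inner ℝ w v) • w := by
  simp [newtonFieldDeriv, smul_smul]

theorem hasFDerivAt_newtonField {ε : ℝ} {w : Eu n} (h : 0 < ε ∨ w ≠ 0) :
    HasFDerivAt (newtonField ε) (newtonFieldDeriv ε w) w := by
  have hp := regNorm_pos h
  have h1 := ((hasDerivAt_inv (pow_pos hp n).ne').comp_hasFDerivAt w
    ((hasFDerivAt_regNorm h).pow n)).smul (hasFDerivAt_id w)
  refine h1.congr_fderiv ?_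
  ext1 v
  rw [newtonFieldDeriv_apply]
  simp only [id, _root_.add_apply, _root_.smul_apply, ContinuousLinearMap.smulRight_apply,
    ContinuousLinearMap.id_apply, innerSL_apply_apply, smul_eq_mul]
  rw [sub_eq_add_neg, ← neg_smul]
  congr 2
  rcases n with _ | m
  · simp
  · simp only [Nat.add_sub_cancel]
    field_simp
    simp
    ring

theorem norm_newtonField_le (ε : ℝ) (w : Eu n) : ‖newtonField ε w‖ ≤ ‖w‖ / ‖w‖ ^ n := by
  rw [newtonField, norm_smul, norm_inv, norm_pow, Real.norm_of_nonneg (regNorm_nonneg ε w)]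
  rcases eq_or_ne w 0 with rfl | hw
  · simp
  · rw [div_eq_inv_mul]
    have := norm_pos_iff.mpr hw
    gcongr
    exact norm_le_regNorm ε w

theorem norm_newtonFieldDeriv_apply_le {ε : ℝ} {w : Eu n} (h : 0 < ε ∨ w ≠ 0) (v : Eu n) :
    ‖newtonFieldDeriv ε w v‖ ≤ (n + 1) * (regNorm ε w ^ n)⁻¹ * ‖v‖ := by
  have hp := regNorm_pos h
  rw [newtonFieldDeriv_apply]
  refine (norm_sub_le _ _).trans ?_
  rw [norm_smul, norm_smul, norm_inv, norm_pow, Real.norm_of_nonneg hp.le]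
  have h1 : ‖(n : ℝ) * (regNorm ε w ^ (n + 2))⁻¹ * inner ℝ w v‖ * ‖w‖
      ≤ n * (regNorm ε w ^ n)⁻¹ * ‖v‖ := by
    rw [norm_mul, norm_mul, norm_inv, norm_pow, Real.norm_of_nonneg hp.le, Real.norm_natCast]
    have h2 : ‖inner ℝ w v‖ ≤ ‖w‖ * ‖v‖ := norm_inner_le_norm w v
    have h3 : ‖w‖ ^ 2 ≤ regNorm ε w ^ 2 := by gcongr; exact norm_le_regNorm ε w
    calc (n : ℝ) * (regNorm ε w ^ (n + 2))⁻¹ * ‖inner ℝ w v‖ * ‖w‖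
        ≤ n * (regNorm ε w ^ (n + 2))⁻¹ * (‖w‖ * ‖v‖) * ‖w‖ := by gcongr
      _ = n * (regNorm ε w ^ (n + 2))⁻¹ * ‖v‖ * ‖w‖ ^ 2 := by ring
      _ ≤ n * (regNorm ε w ^ (n + 2))⁻¹ * ‖v‖ * regNorm ε w ^ 2 := by gcongr
      _ = n * (regNorm ε w ^ n)⁻¹ * ‖v‖ := by rw [pow_add]; field_simp
  linarith

theorem norm_newtonFieldDeriv_apply_le' {ε : ℝ} {w : Eu n} (h : w ≠ 0) (v : Eu n) :
    ‖newtonFieldDeriv ε w v‖ ≤ (n + 1) * (‖w‖ ^ n)⁻¹ * ‖v‖ := by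
  have := norm_pos_iff.mpr h
  refine (norm_newtonFieldDeriv_apply_le (Or.inr h) v).trans ?_
  gcongr
  exact norm_le_regNorm ε w

theorem norm_newtonFieldDeriv_le {ε : ℝ} (h : 0 < ε) (w : Eu n) :
    ‖newtonFieldDeriv ε w‖ ≤ (n + 1) * (ε ^ n)⁻¹ := by
  refine ContinuousLinearMap.opNorm_le_bound _ (by positivity) fun v => ?_
  refine (norm_newtonFieldDeriv_apply_le (Or.inl h) v).trans ?_
  gcongr
  exact le_regNorm ε w

theorem continuous_regNorm (ε : ℝ) : Continuous (regNorm ε : Eu n → ℝ) := by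
  unfold regNorm; fun_prop

theorem continuousAt_newtonFieldDeriv {ε : ℝ} {w : Eu n} (h : 0 < ε ∨ w ≠ 0) :
    ContinuousAt (newtonFieldDeriv ε) w := by
  have hp := (regNorm_pos h).ne'
  have hc : ContinuousAt (regNorm ε) w := (continuous_regNorm ε).continuousAt
  have h1 : ContinuousAt (fun w : Eu n => (innerSL ℝ w).smulRight w) w := by
    have := ContinuousLinearMap.smulRightL ℝ (Eu n) (Eu n)
    have h2 : Continuous fun w : Eu n =>
      ContinuousLinearMap.smulRightL ℝ (Eu n) (Eu n) (innerSL ℝ w) w := by fun_prop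
    exact h2.continuousAt
  unfold newtonFieldDeriv
  exact (((hc.pow n).inv₀ (pow_ne_zero _ hp)).smul continuousAt_const).sub
    ((continuousAt_const.mul ((hc.pow (n + 2)).inv₀ (pow_ne_zero _ hp))).smul h1)

theorem continuous_newtonFieldDeriv {ε : ℝ} (h : 0 < ε) :
    Continuous (newtonFieldDeriv ε : Eu n → _) :=
  continuous_iff_continuousAt.mpr fun _ => continuousAt_newtonFieldDeriv (Or.inl h)

theorem measurable_newtonField (ε : ℝ) : Measurable (newtonField ε : Eu n → Eu n) := by
  unfold newtonField
  exact (((continuous_regNorm ε).measurable.pow_const n).inv).smul measurable_id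

theorem measurable_newtonFieldDeriv_apply (ε : ℝ) :
    Measurable fun p : Eu n × Eu n => newtonFieldDeriv ε p.1 p.2 := by
  simp only [newtonFieldDeriv_apply]
  have h : Measurable fun p : Eu n × Eu n => regNorm ε p.1 :=
    (continuous_regNorm ε).measurable.comp measurable_fst
  have h2 : Measurable fun p : Eu n × Eu n => inner ℝ p.1 p.2 :=
    (continuous_fst.inner continuous_snd).measurable
  exact ((h.pow_const n).inv.smul measurable_snd).sub
    (((measurable_const.mul (h.pow_const _).inv).mul h2).smul measurable_fst)

theorem contDiff_newtonField {ε : ℝ} (h : 0 < ε) :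
    ContDiff ℝ 1 (newtonField ε : Eu n → Eu n) := by
  rw [contDiff_one_iff_hasFDerivAt]
  exact ⟨newtonFieldDeriv ε, continuous_newtonFieldDeriv h,
    fun _ => hasFDerivAt_newtonField (Or.inl h)⟩

/-- The differential of the (regularised) Newtonian field is symmetric. -/
theorem inner_newtonFieldDeriv_comm (ε : ℝ) (w u v : Eu n) :
    inner ℝ (newtonFieldDeriv ε w u) v = inner ℝ (newtonFieldDeriv ε w v) u := by
  simp only [newtonFieldDeriv_apply, inner_sub_left, inner_smul_left, RCLike.conj_to_real]
  rw [real_inner_comm v u]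
  ring

/-- The divergence of the regularised Newtonian field, which concentrates at the origin. -/
theorem sum_newtonFieldDeriv {ε : ℝ} {w : Eu n} (h : 0 < ε ∨ w ≠ 0) :
    ∑ i, newtonFieldDeriv ε w (EuclideanSpace.single i 1) i
      = n * ε ^ 2 * (regNorm ε w ^ (n + 2))⁻¹ := by
  have hp := regNorm_pos h
  have h1 : ∀ i, newtonFieldDeriv ε w (EuclideanSpace.single i 1) i
      = (regNorm ε w ^ n)⁻¹ - (n * (regNorm ε w ^ (n + 2))⁻¹) * (w i) ^ 2 := by
    intro i
    rw [newtonFieldDeriv_apply]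
    simp [EuclideanSpace.inner_single_right]
    ring
  have h2 : ∑ i, (w i) ^ 2 = regNorm ε w ^ 2 - ε ^ 2 := by
    rw [regNorm_sq, EuclideanSpace.norm_sq_eq]
    simp
  simp only [h1, Finset.sum_sub_distrib, ← Finset.mul_sum, h2]
  simp
  field_simp
  ring

theorem tendsto_regNorm (w : Eu n) : Tendsto (fun ε => regNorm ε w) (𝓝[>] 0) (𝓝 (regNorm 0 w)) := by
  have : Continuous fun ε : ℝ => regNorm ε w := by unfold regNorm; fun_prop
  exact this.continuousAt.tendsto.mono_left nhdsWithin_le_nhds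

theorem tendsto_newtonField {w : Eu n} (hw : w ≠ 0) :
    Tendsto (fun ε => newtonField ε w) (𝓝[>] 0) (𝓝 (newtonField 0 w)) :=
  (((tendsto_regNorm w).pow n).inv₀ (pow_ne_zero _ (regNorm_pos (Or.inr hw)).ne')).smul_const w

theorem tendsto_newtonFieldDeriv {w : Eu n} (hw : w ≠ 0) :
    Tendsto (fun ε => newtonFieldDeriv ε w) (𝓝[>] 0) (𝓝 (newtonFieldDeriv 0 w)) := by
  have hp := (regNorm_pos (ε := 0) (Or.inr hw)).ne'
  exact ((((tendsto_regNorm w).pow n).inv₀ (pow_ne_zero _ hp)).smul_const _).sub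
    ((((tendsto_regNorm w).pow (n + 2)).inv₀ (pow_ne_zero _ hp)).const_mul _ |>.smul_const _)

theorem integrableOn_norm_div_norm_pow [NeZero n] (R : ℝ) :
    IntegrableOn (fun w : Eu n => ‖w‖ / ‖w‖ ^ n) (ball 0 R) := by
  have hn : n ≠ 0 := NeZero.ne n
  have : Nontrivial (Eu n) := by
    have : Nonempty (Fin n) := ⟨0⟩
    infer_instance
  rw [integrableOn_fun_norm_addHaar volume (f := fun r : ℝ => r / r ^ n), finrank_euclideanSpace_fin]
  refine (integrableOn_const (C := (1 : ℝ)) (by simp)).congr_fun ?_ measurableSet_Ioo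
  intro r hr
  have : r ≠ 0 := hr.1.ne'
  simp only [smul_eq_mul]
  obtain ⟨m, rfl⟩ := Nat.exists_eq_succ_of_ne_zero hn
  simp only [Nat.succ_sub_one, pow_succ]
  field_simp

theorem ae_ne_zero [NeZero n] : ∀ᵐ w : Eu n, w ≠ 0 := by
  have : Nontrivial (Eu n) := by
    have : Nonempty (Fin n) := ⟨0⟩
    infer_instance
  simp [ae_iff]

theorem measurable_newtonFieldDeriv (ε : ℝ) :
    Measurable (newtonFieldDeriv ε : Eu n → Eu n →L[ℝ] Eu n) := by
  unfold newtonFieldDeriv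
  have h2 : Continuous fun w : Eu n =>
    ContinuousLinearMap.smulRightL ℝ (Eu n) (Eu n) (innerSL ℝ w) w := by fun_prop
  have h := (continuous_regNorm (n := n) ε).measurable
  exact ((h.pow_const n).inv.smul measurable_const).sub
    ((measurable_const.mul (h.pow_const (n + 2)).inv).smul h2.measurable)

theorem measurable_newtonField_sub (ε : ℝ) :
    Measurable fun w : Eu n => ‖newtonField ε w - newtonField 0 w‖
      + ‖w‖ * ‖newtonFieldDeriv ε w - newtonFieldDeriv 0 w‖ :=
  ((measurable_newtonField ε).sub (measurable_newtonField 0)).norm.add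
    (measurable_norm.mul
      ((measurable_newtonFieldDeriv ε).sub (measurable_newtonFieldDeriv 0)).norm)

theorem newtonField_sub_le (ε : ℝ) {w : Eu n} (hw : w ≠ 0) :
    ‖newtonField ε w - newtonField 0 w‖ + ‖w‖ * ‖newtonFieldDeriv ε w - newtonFieldDeriv 0 w‖
      ≤ (2 + 2 * (n + 1)) * (‖w‖ / ‖w‖ ^ n) := by
  have hb : ∀ ε, ‖newtonFieldDeriv ε w‖ ≤ (n + 1) * (‖w‖ ^ n)⁻¹ := fun ε =>
    ContinuousLinearMap.opNorm_le_bound _ (by positivity)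
      fun v => norm_newtonFieldDeriv_apply_le' hw v
  calc ‖newtonField ε w - newtonField 0 w‖
        + ‖w‖ * ‖newtonFieldDeriv ε w - newtonFieldDeriv 0 w‖
      ≤ (‖w‖ / ‖w‖ ^ n + ‖w‖ / ‖w‖ ^ n)
        + ‖w‖ * ((n + 1) * (‖w‖ ^ n)⁻¹ + (n + 1) * (‖w‖ ^ n)⁻¹) := by
        gcongr
        · exact (norm_sub_le _ _).trans
            (add_le_add (norm_newtonField_le _ _) (norm_newtonField_le _ _))
        · exact (norm_sub_le _ _).trans (add_le_add (hb _) (hb _))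
    _ = (2 + 2 * (n + 1)) * (‖w‖ / ‖w‖ ^ n) := by ring

theorem integrableOn_newtonField_sub [NeZero n] (ε R : ℝ) :
    IntegrableOn (fun w : Eu n => ‖newtonField ε w - newtonField 0 w‖
      + ‖w‖ * ‖newtonFieldDeriv ε w - newtonFieldDeriv 0 w‖) (ball 0 R) := by
  refine Integrable.mono' ((integrableOn_norm_div_norm_pow R).const_mul (2 + 2 * (n + 1)))
    (measurable_newtonField_sub ε).aestronglyMeasurable ?_
  filter_upwards [ae_restrict_of_ae ae_ne_zero] with w hw
  rw [Real.norm_of_nonneg (by positivity)]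
  exact newtonField_sub_le ε hw

/-- The convergence of the regularised fields and of their differentials, in the weighted `L¹`
sense needed for weakly singular integrals. -/
theorem tendsto_integral_newtonField_sub [NeZero n] (R : ℝ) :
    Tendsto (fun ε => ∫ w in ball (0 : Eu n) R, (‖newtonField ε w - newtonField 0 w‖
      + ‖w‖ * ‖newtonFieldDeriv ε w - newtonFieldDeriv 0 w‖)) (𝓝[>] 0) (𝓝 0) := by
  have h0 : (∫ w in ball (0 : Eu n) R, (0 : ℝ)) = 0 := by simp
  suffices h : Tendsto (fun ε => ∫ w in ball (0 : Eu n) R, (‖newtonField ε w - newtonField 0 w‖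
      + ‖w‖ * ‖newtonFieldDeriv ε w - newtonFieldDeriv 0 w‖)) (𝓝[>] 0)
      (𝓝 (∫ w in ball (0 : Eu n) R, (0 : ℝ))) by rwa [h0] at h
  refine tendsto_integral_filter_of_dominated_convergence
    (fun w => (2 + 2 * (n + 1)) * (‖w‖ / ‖w‖ ^ n))
    (Eventually.of_forall fun ε => (measurable_newtonField_sub ε).aestronglyMeasurable)
    (Eventually.of_forall fun ε => ?_) ((integrableOn_norm_div_norm_pow R).const_mul _) ?_
  · filter_upwards [ae_restrict_of_ae ae_ne_zero] with w hw
    rw [Real.norm_of_nonneg (by positivity)]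
    exact newtonField_sub_le ε hw
  · filter_upwards [ae_restrict_of_ae ae_ne_zero] with w hw
    have h1 := ((tendsto_newtonField hw).sub_const (newtonField 0 w)).norm
    have h2 := ((tendsto_newtonFieldDeriv hw).sub_const (newtonFieldDeriv 0 w)).norm.const_mul ‖w‖
    simpa using h1.add h2

/-- The surface area of the unit sphere of `ℝⁿ`. -/
def sphereArea (n : ℕ) : ℝ := n * (volume : Measure (Eu n)).real (ball 0 1)

theorem sphereArea_pos [NeZero n] : 0 < sphereArea n := by
  have hn : (0 : ℝ) < n := by exact_mod_cast Nat.pos_of_ne_zero (NeZero.ne n)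
  refine mul_pos hn ?_
  rw [Measure.real, ENNReal.toReal_pos_iff]
  exact ⟨measure_ball_pos _ _ one_pos, measure_ball_lt_top⟩

theorem sphereVol_eq (m : ℕ) : sphereVol m = sphereArea (m + 1) := by
  rw [sphereVol, Measure.toSphere_real_apply_univ, sphereArea, finrank_euclideanSpace_fin]

/-- The divergence of `newtonField 1`, normalised to have total mass one. -/
def newtonPeak (w : Eu n) : ℝ := (sphereArea n)⁻¹ * (n * (regNorm 1 w ^ (n + 2))⁻¹)

/-- The primitive `r^n / (r² + 1)^{n/2}` of the radial density tends to one at infinity. -/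
theorem integral_newtonPeak [NeZero n] : ∫ w : Eu n, newtonPeak w = 1 := by
  have hn : n ≠ 0 := NeZero.ne n
  have : Nontrivial (Eu n) := by
    have : Nonempty (Fin n) := ⟨0⟩
    infer_instance
  have hA := (sphereArea_pos (n := n)).ne'
  have h := integral_fun_norm_addHaar (volume : Measure (Eu n))
    (fun r : ℝ => (sphereArea n)⁻¹ * (n * (√(r ^ 2 + 1 ^ 2) ^ (n + 2))⁻¹))
  have h1 : (∫ w : Eu n, newtonPeak w) = ∫ w : Eu n,
    (fun r : ℝ => (sphereArea n)⁻¹ * (n * (√(r ^ 2 + 1 ^ 2) ^ (n + 2))⁻¹)) ‖w‖ := rfl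
  rw [h1, h, finrank_euclideanSpace_fin]
  set s : ℝ → ℝ := fun r => √(r ^ 2 + 1 ^ 2) with hs
  have hsp : ∀ r, 0 < s r := fun r => Real.sqrt_pos.mpr (by positivity)
  have hs2 : ∀ r, s r ^ 2 = r ^ 2 + 1 := fun r => by
    rw [hs]; simp only; rw [Real.sq_sqrt (by positivity)]; ring
  have hd : ∀ r, HasDerivAt (fun r => (r / s r) ^ n)
      (r ^ (n - 1) * (n * (s r ^ (n + 2))⁻¹)) r := by
    intro r
    have h1 : HasDerivAt s (r / s r) r := by
      have h2 : HasDerivAt (fun r : ℝ => r ^ 2 + 1 ^ 2) (2 * r) r := by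
        simpa using (hasDerivAt_pow 2 r).add_const ((1 : ℝ) ^ 2)
      convert! h2.sqrt (by positivity) using 1
      rw [mul_div_mul_left _ _ two_ne_zero]
    have h3 := ((hasDerivAt_id r).div h1 (hsp r).ne').pow n
    refine h3.congr_deriv ?_
    obtain ⟨m, rfl⟩ := Nat.exists_eq_succ_of_ne_zero hn
    have := (hsp r).ne'
    have h4 : (1 * s r - r * (r / s r)) / s r ^ 2 = (s r ^ 3)⁻¹ := by
      field_simp
      rw [hs2]
      ring
    simp only [Nat.succ_sub_one, id, Nat.succ_eq_add_one, Pi.div_apply]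
    rw [h4, div_pow]
    field_simp
    ring
  have hlim : Tendsto (fun r => (r / s r) ^ n) atTop (𝓝 1) := by
    have h1 : Tendsto (fun r => r / s r) atTop (𝓝 1) := by
      have h2 : Tendsto (fun r : ℝ => √(1 + (r ^ 2)⁻¹)) atTop (𝓝 1) := by
        have := ((tendsto_pow_atTop (α := ℝ) two_ne_zero).inv_tendsto_atTop.const_add 1).sqrt
        simpa using this
      have h3 := h2.inv₀ one_ne_zero
      rw [inv_one] at h3
      refine h3.congr' ?_
      filter_upwards [eventually_gt_atTop 0] with r hr
      have h4 : s r = r * √(1 + (r ^ 2)⁻¹) := by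
        rw [hs]
        simp only
        rw [← Real.sqrt_sq hr.le, ← Real.sqrt_mul (by positivity), Real.sqrt_sq hr.le]
        congr 1
        field_simp
      rw [h4]
      field_simp
    simpa using h1.pow n
  have hint := integral_Ioi_of_hasDerivAt_of_nonneg' (a := 0) (fun r _ => hd r)
    (fun r hr => by
      have : (0 : ℝ) < r := hr
      have := hsp r
      positivity) hlim
  have h2 : (∫ r in Ioi (0 : ℝ), r ^ (n - 1) • ((sphereArea n)⁻¹ * (n * (s r ^ (n + 2))⁻¹)))
      = (sphereArea n)⁻¹ := by
    have h3 : ∀ r : ℝ, r ^ (n - 1) • ((sphereArea n)⁻¹ * (n * (s r ^ (n + 2))⁻¹))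
      = (sphereArea n)⁻¹ * (r ^ (n - 1) * (n * (s r ^ (n + 2))⁻¹)) := fun r => by
        simp only [smul_eq_mul]; ring
    simp only [h3]
    rw [integral_const_mul, hint]
    simp [hn]
  rw [h2]
  simp only [nsmul_eq_mul, smul_eq_mul]
  rw [← mul_assoc]
  exact mul_inv_cancel₀ hA

theorem tendsto_norm_pow_mul_newtonPeak :
    Tendsto (fun w : Eu n => ‖w‖ ^ n * newtonPeak w) (Bornology.cobounded (Eu n)) (𝓝 0) := by
  have h1 : Tendsto (fun w : Eu n => |(sphereArea n)⁻¹ * n| * (‖w‖ ^ 2)⁻¹)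
      (Bornology.cobounded (Eu n)) (𝓝 0) := by
    have := ((tendsto_pow_atTop (α := ℝ) two_ne_zero).comp
      (tendsto_norm_cobounded_atTop (E := Eu n))).inv_tendsto_atTop.const_mul
        |(sphereArea n)⁻¹ * n|
    simpa using this
  refine squeeze_zero_norm (fun w => ?_) h1
  rcases eq_or_ne w 0 with rfl | hw
  · rcases eq_or_ne n 0 with rfl | hn
    · simp [newtonPeak]
    · simp [hn]
  have hp := norm_pos_iff.mpr hw
  have hr := regNorm_pos (ε := 1) (Or.inr hw)
  rw [newtonPeak, ← mul_assoc (sphereArea n)⁻¹, norm_mul, norm_mul _ (regNorm 1 w ^ (n + 2))⁻¹,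
    norm_pow, norm_norm, norm_inv, norm_pow, Real.norm_of_nonneg hr.le, Real.norm_eq_abs]
  calc ‖w‖ ^ n * (|(sphereArea n)⁻¹ * n| * (regNorm 1 w ^ (n + 2))⁻¹)
      ≤ ‖w‖ ^ n * (|(sphereArea n)⁻¹ * n| * (‖w‖ ^ (n + 2))⁻¹) := by
        gcongr; exact norm_le_regNorm 1 w
    _ = |(sphereArea n)⁻¹ * n| * (‖w‖ ^ 2)⁻¹ := by rw [pow_add]; field_simp

theorem newtonPeak_nonneg (w : Eu n) : 0 ≤ newtonPeak w := by
  have := regNorm_nonneg 1 w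
  unfold newtonPeak sphereArea
  positivity

theorem sum_newtonFieldDeriv_eq_peak [NeZero n] {ε : ℝ} (hε : 0 < ε) (w : Eu n) :
    ∑ i, newtonFieldDeriv ε w (EuclideanSpace.single i 1) i
      = sphereArea n * (ε⁻¹ ^ n * newtonPeak (ε⁻¹ • w)) := by
  have hA := (sphereArea_pos (n := n)).ne'
  rw [sum_newtonFieldDeriv (Or.inl hε), newtonPeak]
  have h1 : regNorm 1 (ε⁻¹ • w) = ε⁻¹ * regNorm ε w := by
    rw [regNorm, regNorm, norm_smul, ← Real.sqrt_sq (inv_pos.mpr hε).le,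
      ← Real.sqrt_mul (by positivity), Real.sqrt_sq (inv_pos.mpr hε).le,
      Real.norm_of_nonneg (inv_pos.mpr hε).le]
    congr 1
    field_simp
  have hr := regNorm_pos (w := w) (Or.inl hε)
  rw [h1, mul_pow, inv_pow, inv_pow, pow_add ε]
  field_simp

/-- The divergence of the regularised Newtonian field is an approximation of `sphereArea n` times
the Dirac mass. -/
theorem tendsto_integral_sum_newtonFieldDeriv [NeZero n] {g : Eu n → ℝ} {x : Eu n}
    (hg : Integrable g) (hgx : ContinuousAt g x) :
    Tendsto (fun ε => ∫ y, g y *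
        ∑ i, newtonFieldDeriv ε (x - y) (EuclideanSpace.single i 1) i)
      (𝓝[>] 0) (𝓝 (sphereArea n * g x)) := by
  have h := tendsto_integral_comp_smul_smul_of_integrable' (μ := (volume : Measure (Eu n)))
    (φ := newtonPeak) newtonPeak_nonneg integral_newtonPeak
    (by simpa using tendsto_norm_pow_mul_newtonPeak) hg hgx
  have h2 := (h.comp tendsto_inv_nhdsGT_zero).const_mul (sphereArea n)
  refine h2.congr' ?_
  filter_upwards [self_mem_nhdsWithin] with ε (hε : 0 < ε)
  simp only [Function.comp_apply, finrank_euclideanSpace_fin]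
  rw [← integral_const_mul]
  refine integral_congr_ae (Eventually.of_forall fun y => ?_)
  simp only [sum_newtonFieldDeriv_eq_peak hε, smul_eq_mul]
  ring

theorem integrable_sum_newtonFieldDeriv [NeZero n] {ε : ℝ} (hε : 0 < ε) (x : Eu n) :
    Integrable (fun y : Eu n => ∑ i, newtonFieldDeriv ε (x - y) (EuclideanSpace.single i 1) i) ∧
    ∫ y : Eu n, ∑ i, newtonFieldDeriv ε (x - y) (EuclideanSpace.single i 1) i = sphereArea n := by
  have hI : Integrable (newtonPeak : Eu n → ℝ) :=
    integrable_of_integral_eq_one integral_newtonPeak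
  have hε' := (inv_pos.mpr hε)
  simp only [sum_newtonFieldDeriv_eq_peak hε]
  constructor
  · have := ((hI.comp_smul hε'.ne').comp_sub_left x).const_mul (sphereArea n * ε⁻¹ ^ n)
    simpa [mul_assoc] using this
  · rw [integral_const_mul, integral_const_mul,
      integral_sub_left_eq_self (fun w => newtonPeak (ε⁻¹ • w)) volume x,
      Measure.integral_comp_smul, integral_newtonPeak, finrank_euclideanSpace_fin]
    rw [abs_of_pos (by positivity)]
    rw [inv_pow, inv_inv, smul_eq_mul, mul_one]
    field_simp

/-! ### Charts adapted to the domain -/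

/-- On the open set `U` the set `Ω` is `{f ≤ 0}` for a smooth submersion `f`. Near a smooth boundary
point `f` is a defining function; charts around interior points (`f < 0`) and exterior points
(`f > 0`) are allowed as well, so that all three cases can be treated at once. -/
structure IsRegularChart (Ω U : Set (Eu n)) (f : Eu n → ℝ) : Prop where
  isOpen : IsOpen U
  smooth : ContDiffOn ℝ ∞ f U
  fderiv_ne_zero : ∀ q ∈ U, fderiv ℝ f q ≠ 0
  mem_iff : ∀ q ∈ U, q ∈ Ω ↔ f q ≤ 0

/-- The edges and corners of `Ω`. -/
def singularSet (Ω : Set (Eu n)) : Set (Eu n) := {p ∈ frontier Ω | ¬ IsSmoothBoundaryPoint Ω p}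

namespace IsRegularChart

variable {Ω U : Set (Eu n)} {f : Eu n → ℝ}

theorem contDiffAt (hc : IsRegularChart Ω U f) {q : Eu n} (hq : q ∈ U) : ContDiffAt ℝ ∞ f q :=
  hc.smooth.contDiffAt (hc.isOpen.mem_nhds hq)

theorem differentiableAt (hc : IsRegularChart Ω U f) {q : Eu n} (hq : q ∈ U) :
    DifferentiableAt ℝ f q :=
  (hc.contDiffAt hq).differentiableAt (by simp)

theorem continuousAt_fderiv (hc : IsRegularChart Ω U f) {q : Eu n} (hq : q ∈ U) :
    ContinuousAt (fderiv ℝ f) q :=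
  ((hc.contDiffAt hq).fderiv_right (m := 0) (by simp)).continuousAt

theorem mem_interior (hc : IsRegularChart Ω U f) {q : Eu n} (hq : q ∈ U) (hf : f q < 0) :
    q ∈ interior Ω := by
  rw [mem_interior_iff_mem_nhds]
  filter_upwards [hc.isOpen.mem_nhds hq,
    (hc.differentiableAt hq).continuousAt.eventually_lt_const hf] with y hy hy'
  exact (hc.mem_iff y hy).mpr hy'.le

theorem lt_zero (hc : IsRegularChart Ω U f) {q : Eu n} (hq : q ∈ U) (hi : q ∈ interior Ω) :
    f q < 0 := by
  refine lt_of_le_of_ne ((hc.mem_iff q hq).mp (interior_subset hi)) fun h0 => ?_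
  refine hc.fderiv_ne_zero q hq (IsLocalMax.fderiv_eq_zero ?_)
  filter_upwards [hc.isOpen.mem_nhds hq, mem_interior_iff_mem_nhds.mp hi] with y hy hy'
  rw [h0]
  exact (hc.mem_iff y hy).mp hy'

theorem eq_zero (hc : IsRegularChart Ω U f) (hΩ : IsClosed Ω) {q : Eu n} (hq : q ∈ U)
    (hi : q ∈ frontier Ω) : f q = 0 := by
  refine le_antisymm ((hc.mem_iff q hq).mp (hΩ.frontier_subset hi)) ?_
  by_contra h
  exact hi.2 (hc.mem_interior hq (not_le.mp h))

theorem isLocalDefiningFunction (hc : IsRegularChart Ω U f) {q : Eu n} (hq : q ∈ U)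
    (h0 : f q = 0) : IsLocalDefiningFunction Ω q U f :=
  ⟨hc.isOpen, hq, hc.smooth, h0, hc.fderiv_ne_zero q hq, hc.mem_iff⟩

/-- A direction, stable under perturbation, along which the defining function increases. -/
theorem exists_direction (hc : IsRegularChart Ω U f) {p : Eu n} (hp : p ∈ U) :
    ∃ v : Eu n, ∃ δ > 0, ball p δ ⊆ U ∧
      ∀ q ∈ ball p δ, ∀ u ∈ ball v δ, (1 / 2 : ℝ) < fderiv ℝ f q u := by
  obtain ⟨w, hw⟩ : ∃ w, fderiv ℝ f p w ≠ 0 := by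
    by_contra h
    push Not at h
    exact hc.fderiv_ne_zero p hp (ContinuousLinearMap.ext h)
  set v : Eu n := (fderiv ℝ f p w)⁻¹ • w with hv
  have hv1 : fderiv ℝ f p v = 1 := by simp [hv, hw]
  have hcont : ContinuousAt (fun z : Eu n × Eu n => fderiv ℝ f z.1 z.2) (p, v) :=
    ContinuousAt.clm_apply (ContinuousAt.comp (f := Prod.fst) (hc.continuousAt_fderiv hp)
      continuousAt_fst) continuousAt_snd
  have h1 : ∀ᶠ z : Eu n × Eu n in 𝓝 (p, v), (1 / 2 : ℝ) < fderiv ℝ f z.1 z.2 :=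
    hcont.eventually_const_lt (by simp only [hv1]; norm_num)
  rw [nhds_prod_eq, Filter.eventually_prod_iff] at h1
  obtain ⟨P, hP, Q, hQ, hPQ⟩ := h1
  obtain ⟨δ₁, hδ₁, h₁⟩ := Metric.eventually_nhds_iff_ball.mp hP
  obtain ⟨δ₂, hδ₂, h₂⟩ := Metric.eventually_nhds_iff_ball.mp hQ
  obtain ⟨δ₃, hδ₃, h₃⟩ := Metric.isOpen_iff.mp hc.isOpen p hp
  refine ⟨v, min δ₁ (min δ₂ δ₃), by positivity, ?_, fun q hq u hu => ?_⟩
  · exact (ball_subset_ball ((min_le_right _ _).trans (min_le_right _ _))).trans h₃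
  · exact hPQ (h₁ q (ball_subset_ball (min_le_left _ _) hq))
      (h₂ u (ball_subset_ball ((min_le_right _ _).trans (min_le_left _ _)) hu))

end IsRegularChart

/-- If the derivative of `f` along `u` is at least `1/2` on a ball, then `f` grows along segments
in the direction of `u`. -/
theorem add_half_le_of_fderiv {f : Eu n → ℝ} {p u q : Eu n} {δ t : ℝ}
    (hd : ∀ q ∈ ball p δ, DifferentiableAt ℝ f q)
    (hu : ∀ q ∈ ball p δ, (1 / 2 : ℝ) < fderiv ℝ f q u)
    (hq : q ∈ ball p δ) (ht : 0 ≤ t) (hqt : q + t • u ∈ ball p δ) :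
    f q + t / 2 ≤ f (q + t • u) := by
  have hseg : ∀ s ∈ Icc 0 t, q + s • u ∈ ball p δ := by
    intro s hs
    rcases ht.eq_or_lt with rfl | ht
    · have : s = 0 := le_antisymm hs.2 hs.1
      simpa [this] using hq
    · have := (convex_ball p δ).add_smul_sub_mem hq hqt (t := s / t)
        ⟨div_nonneg hs.1 ht.le, (div_le_one ht).mpr hs.2⟩
      convert! this using 2
      rw [add_sub_cancel_left, smul_smul, div_mul_cancel₀ _ ht.ne']
  have hder : ∀ s ∈ Icc 0 t, HasDerivAt (fun s : ℝ => f (q + s • u)) (fderiv ℝ f (q + s • u) u) s := by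
    intro s hs
    have h1 : HasDerivAt (fun s : ℝ => q + s • u) u s := by
      simpa using ((hasDerivAt_id s).smul_const u).const_add q
    exact (hd _ (hseg s hs)).hasFDerivAt.comp_hasDerivAt s h1
  have := (convex_Icc 0 t).mul_sub_le_image_sub_of_le_deriv (f := fun s : ℝ => f (q + s • u))
    (C := 1 / 2) (fun s hs => (hder s hs).continuousAt.continuousWithinAt)
    (fun s hs => ((hder s (interior_subset hs)).differentiableAt).differentiableWithinAt)
    (fun s hs => by
      rw [(hder s (interior_subset hs)).deriv]
      exact (hu _ (hseg s (interior_subset hs))).le)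
    0 (left_mem_Icc.mpr ht) t (right_mem_Icc.mpr ht) ht
  simp only [zero_smul, add_zero, sub_zero] at this
  linarith

/-- All points of `ℝⁿ` other than edges and corners lie in a chart; away from the boundary an affine
function of constant sign serves as `f`. -/
theorem exists_isRegularChart [NeZero n] {Ω : Set (Eu n)} (hΩ : IsClosed Ω) {p : Eu n}
    (hp : p ∉ singularSet Ω) : ∃ U f, IsRegularChart Ω U f ∧ p ∈ U := by
  have hlin : ∀ c : ℝ, ∀ q, fderiv ℝ (fun y : Eu n => y 0 + c) q ≠ 0 := by
    intro c q h
    have h1 : HasFDerivAt (fun y : Eu n => y 0 + c) (EuclideanSpace.proj (0 : Fin n) : Eu n →L[ℝ] ℝ) q :=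
      (EuclideanSpace.proj (0 : Fin n) : Eu n →L[ℝ] ℝ).hasFDerivAt.add_const c
    rw [h1.fderiv] at h
    have := DFunLike.congr_fun h (EuclideanSpace.single 0 1)
    simp at this
  have hsm : ∀ (c : ℝ) (s : Set (Eu n)), ContDiffOn ℝ ∞ (fun y : Eu n => y 0 + c) s := by
    intro c s
    exact ((EuclideanSpace.proj (0 : Fin n) : Eu n →L[ℝ] ℝ).contDiff.add contDiff_const).contDiffOn
  have hco : Continuous fun y : Eu n => y 0 := (EuclideanSpace.proj (0 : Fin n)).continuous
  by_cases hmem : p ∈ Ω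
  · by_cases hint : p ∈ interior Ω
    · refine ⟨interior Ω ∩ {y | y 0 < p 0 + 1}, fun y => y 0 + (-p 0 - 1), ⟨?_, hsm _ _,
        fun q _ => hlin _ q, ?_⟩, hint, by simp⟩
      · exact isOpen_interior.inter (isOpen_lt hco continuous_const)
      · rintro q ⟨hq, hq'⟩
        refine ⟨fun _ => ?_, fun _ => interior_subset hq⟩
        have : q 0 < p 0 + 1 := hq'
        linarith
    · have hfr : p ∈ frontier Ω := by rw [hΩ.frontier_eq]; exact ⟨hmem, hint⟩
      have hs : IsSmoothBoundaryPoint Ω p := by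
        by_contra h; exact hp ⟨hfr, h⟩
      obtain ⟨U, f, h⟩ := hs
      have hcd : ContinuousOn (fderiv ℝ f) U :=
        (h.smooth.fderiv_of_isOpen (m := 0) h.isOpen (by simp)).continuousOn
      refine ⟨U ∩ fderiv ℝ f ⁻¹' {0}ᶜ, f, ⟨hcd.isOpen_inter_preimage h.isOpen isOpen_compl_singleton,
        h.smooth.mono inter_subset_left, fun q hq => hq.2, fun q hq => h.mem_iff q hq.1⟩,
        h.mem, h.fderiv_ne_zero⟩
  · refine ⟨Ωᶜ ∩ {y | p 0 - 1 < y 0}, fun y => y 0 + (-p 0 + 1), ⟨?_, hsm _ _,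
        fun q _ => hlin _ q, ?_⟩, hmem, by simp⟩
    · exact hΩ.isOpen_compl.inter (isOpen_lt continuous_const hco)
    · rintro q ⟨hq, hq'⟩
      refine ⟨fun h => (hq h).elim, fun h => ?_⟩
      have : p 0 - 1 < q 0 := hq'
      linarith

theorem isClosed_singularSet {Ω : Set (Eu n)} (hΩ : IsClosed Ω) : IsClosed (singularSet Ω) := by
  rw [← isOpen_compl_iff, isOpen_iff_mem_nhds]
  intro p hp
  by_cases hfr : p ∈ frontier Ω
  · have hs : IsSmoothBoundaryPoint Ω p := by
      by_contra h; exact hp ⟨hfr, h⟩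
    obtain ⟨U, f, h⟩ := hs
    have hcd : ContinuousOn (fderiv ℝ f) U :=
      (h.smooth.fderiv_of_isOpen (m := 0) h.isOpen (by simp)).continuousOn
    have hc : IsRegularChart Ω (U ∩ fderiv ℝ f ⁻¹' {0}ᶜ) f :=
      ⟨hcd.isOpen_inter_preimage h.isOpen isOpen_compl_singleton,
        h.smooth.mono inter_subset_left, fun q hq => hq.2, fun q hq => h.mem_iff q hq.1⟩
    filter_upwards [hc.isOpen.mem_nhds ⟨h.mem, h.fderiv_ne_zero⟩] with q hq
    rintro ⟨hqf, hqs⟩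
    exact hqs ⟨_, f, hc.isLocalDefiningFunction hq (hc.eq_zero hΩ hq hqf)⟩
  · filter_upwards [isClosed_frontier.isOpen_compl.mem_nhds hfr] with q hq
    exact fun h => hq h.1

/-- The regular part of the boundary is a null set: small translates of it in a transversal
direction are disjoint. -/
theorem volume_frontier_eq_zero [NeZero n] {Ω : Set (Eu n)} (hΩ : IsClosed Ω)
    (hs : volume (singularSet Ω) = 0) : volume (frontier Ω) = 0 := by
  have h1 : volume (frontier Ω \ singularSet Ω) = 0 := by
    refine measure_null_of_locally_null _ fun p hp => ?_
    obtain ⟨U, f, hc, hpU⟩ := exists_isRegularChart hΩ hp.2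
    obtain ⟨v, δ, hδ, hball, hv⟩ := hc.exists_direction hpU
    refine ⟨frontier Ω ∩ ball p (δ / 2), ?_, ?_⟩
    · exact inter_mem (mem_nhdsWithin_of_mem_nhds (ball_mem_nhds p (half_pos hδ)) )
        (mem_of_superset self_mem_nhdsWithin sdiff_subset) |> fun h => by
          rwa [inter_comm] at h
    set c : ℝ := δ / (2 * (‖v‖ + 1)) with hcdef
    have hcpos : 0 < c := by positivity
    have hcv : c * ‖v‖ < δ / 2 := by
      rw [hcdef, div_mul_eq_mul_div, div_lt_div_iff₀ (by positivity) two_pos]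
      nlinarith [norm_nonneg v]
    set u : ℕ → Eu n := fun m => (c / (m + 1)) • v with hu
    have hmono : ∀ m l : ℕ, m < l → c / ((l : ℝ) + 1) < c / (m + 1) := by
      intro m l hml
      have : (m : ℝ) < l := by exact_mod_cast hml
      gcongr
    have hle : ∀ m : ℕ, c / ((m : ℝ) + 1) ≤ c := fun m => div_le_self hcpos.le (by simp)
    have hdis : ∀ m l : ℕ, m < l →
        Disjoint (({u m} : Set (Eu n)) + frontier Ω ∩ ball p (δ / 2))
          (({u l} : Set (Eu n)) + frontier Ω ∩ ball p (δ / 2)) := by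
      intro m l hml
      rw [Set.disjoint_left]
      rintro y hy hy'
      simp only [singleton_add, mem_image] at hy hy'
      obtain ⟨q, ⟨hqf, hqb⟩, rfl⟩ := hy
      obtain ⟨q', ⟨hqf', hqb'⟩, heq⟩ := hy'
      have hbb : ball p (δ / 2) ⊆ ball p δ := ball_subset_ball (by linarith)
      set t : ℝ := c / (m + 1) - c / (l + 1) with ht
      have htpos : 0 < t := sub_pos.mpr (hmono m l hml)
      have hqq : q' = q + t • v := by
        simp only [hu] at heq
        rw [ht, sub_smul, ← add_sub_assoc, add_comm q, ← heq]
        abel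
      have h2 := add_half_le_of_fderiv (fun q hq => hc.differentiableAt (hball hq))
        (fun q hq => hv q hq v (mem_ball_self hδ)) (hbb hqb) htpos.le (hqq ▸ hbb hqb')
      rw [← hqq, hc.eq_zero hΩ (hball (hbb hqb)) hqf, hc.eq_zero hΩ (hball (hbb hqb')) hqf'] at h2
      linarith
    refine Measure.addHaar_eq_zero_of_disjoint_translates volume u ?_ ?_ ?_
    · refine (Metric.isBounded_ball (x := (0 : Eu n)) (r := δ)).subset ?_
      rintro _ ⟨m, rfl⟩
      have hm0 : 0 < c / ((m : ℝ) + 1) := by positivity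
      rw [mem_ball_zero_iff, hu, norm_smul, Real.norm_of_nonneg hm0.le]
      have := mul_le_mul_of_nonneg_right (hle m) (norm_nonneg v)
      linarith
    · intro m l hml
      rcases lt_or_gt_of_ne hml with h | h
      · exact hdis m l h
      · exact (hdis l m h).symm
    · exact isClosed_frontier.measurableSet.inter isOpen_ball.measurableSet
  have h2 : frontier Ω ⊆ (frontier Ω \ singularSet Ω) ∪ singularSet Ω := by
    intro x hx
    by_cases h : x ∈ singularSet Ω
    · exact Or.inr h
    · exact Or.inl ⟨hx, h⟩
  exact measure_mono_null h2 (measure_union_null h1 hs)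

/-! ### The divergence theorem in a chart -/

/-- The divergence of a vector field on `ℝⁿ`. -/
def divergence (Y : Eu n → Eu n) (y : Eu n) : ℝ :=
  ∑ i, fderiv ℝ Y y (EuclideanSpace.single i 1) i

theorem sum_smul_single (v : Eu n) : ∑ i, v i • EuclideanSpace.single i (1 : ℝ) = v := by
  simpa using (EuclideanSpace.basisFun (Fin n) ℝ).sum_repr v

theorem divergence_smul {h : Eu n → ℝ} {Y : Eu n → Eu n} {y : Eu n}
    (hh : DifferentiableAt ℝ h y) (hY : DifferentiableAt ℝ Y y) :
    divergence (fun y => h y • Y y) y = fderiv ℝ h y (Y y) + h y * divergence Y y := by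
  unfold divergence
  have h1 : fderiv ℝ h y (Y y) = ∑ i, Y y i * fderiv ℝ h y (EuclideanSpace.single i 1) := by
    conv_lhs => rw [← sum_smul_single (Y y)]
    simp
  rw [h1, Finset.mul_sum, ← Finset.sum_add_distrib, fderiv_fun_smul hh hY]
  refine Finset.sum_congr rfl fun i _ => ?_
  simp
  ring

theorem divergence_eq_of_eventuallyEq {Y Z : Eu n → Eu n} {y : Eu n} (h : Y =ᶠ[𝓝 y] Z) :
    divergence Y y = divergence Z y := by
  unfold divergence
  rw [h.fderiv_eq]

theorem divergence_eq_zero_of_eventuallyEq {Y : Eu n → Eu n} {y : Eu n}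
    (h : ∀ᶠ z in 𝓝 y, Y z = 0) : divergence Y y = 0 := by
  have h1 : Y =ᶠ[𝓝 y] fun _ => 0 := h
  rw [divergence_eq_of_eventuallyEq h1]
  simp [divergence]

theorem integral_divergence_eq_zero {Y : Eu n → Eu n} (hY : ContDiff ℝ 1 Y)
    (hc : HasCompactSupport Y) : ∫ y, divergence Y y = 0 := by
  have hd : Continuous (fderiv ℝ Y) := hY.continuous_fderiv (by simp)
  have hcd : ∀ i : Fin n, Continuous fun y => fderiv ℝ Y y (EuclideanSpace.single i 1) i := fun i =>
    (EuclideanSpace.proj i : Eu n →L[ℝ] ℝ).continuous.comp (hd.clm_apply continuous_const)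
  have hsup : ∀ i : Fin n,
      HasCompactSupport fun y => fderiv ℝ Y y (EuclideanSpace.single i 1) i := by
    intro i
    refine (hc.fderiv ℝ).mono' ?_
    intro y hy
    refine subset_tsupport _ fun h => hy ?_
    simp [h]
  have hint : ∀ i : Fin n, Integrable fun y => fderiv ℝ Y y (EuclideanSpace.single i 1) i :=
    fun i => (hcd i).integrable_of_hasCompactSupport (hsup i)
  unfold divergence
  rw [integral_finsetSum _ fun i _ => hint i]
  refine Finset.sum_eq_zero fun i _ => ?_
  have hcY : Continuous fun y => Y y i :=
    (EuclideanSpace.proj i : Eu n →L[ℝ] ℝ).continuous.comp hY.continuous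
  have hY' : Integrable fun y => Y y i := by
    refine hcY.integrable_of_hasCompactSupport (hc.mono' ?_)
    intro y hy
    refine subset_tsupport _ fun h => hy ?_
    simp [h]
  have hdi : ∀ y, HasFDerivAt (fun y => Y y i)
      ((EuclideanSpace.proj i : Eu n →L[ℝ] ℝ).comp (fderiv ℝ Y y)) y := fun y =>
    (EuclideanSpace.proj i : Eu n →L[ℝ] ℝ).hasFDerivAt.comp y
      (hY.differentiable (by simp) y).hasFDerivAt
  have := integral_bilinear_hasFDerivAt_right_eq_neg_left_of_integrable (μ := (volume : Measure (Eu n)))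
    (f := fun _ : Eu n => (1 : ℝ)) (f' := fun _ => 0) (g := fun y => Y y i)
    (g' := fun y => (EuclideanSpace.proj i : Eu n →L[ℝ] ℝ).comp (fderiv ℝ Y y))
    (v := EuclideanSpace.single i 1) (B := ContinuousLinearMap.mul ℝ ℝ) (by simp)
    (by simpa using hint i) (by simpa using hY') (fun _ _ => hasFDerivAt_const _ _)
    (fun y _ => hdi y)
  simpa using this

theorem exists_bound_deriv_smoothTransition : ∃ K, 0 ≤ K ∧ ∀ s, |deriv Real.smoothTransition s| ≤ K := by
  have hc : Continuous (deriv Real.smoothTransition) :=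
    (Real.smoothTransition.contDiff (n := 1)).continuous_deriv (by simp)
  obtain ⟨K, hK⟩ := isCompact_Icc.exists_bound_of_continuousOn (s := Icc (0 : ℝ) 1) hc.continuousOn
  refine ⟨max K 0, le_max_right _ _, fun s => ?_⟩
  by_cases hs : s ∈ Icc (0 : ℝ) 1
  · exact (hK s hs).trans (le_max_left _ _)
  · have h0 : deriv Real.smoothTransition s = 0 := by
      rw [mem_Icc, not_and_or, not_le, not_le] at hs
      rcases hs with h | h
      · have : Real.smoothTransition =ᶠ[𝓝 s] fun _ => 0 := by
          filter_upwards [eventually_lt_nhds h] with t ht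
          exact Real.smoothTransition.zero_of_nonpos ht.le
        rw [this.deriv_eq, deriv_const]
      · have : Real.smoothTransition =ᶠ[𝓝 s] fun _ => 1 := by
          filter_upwards [eventually_gt_nhds h] with t ht
          exact Real.smoothTransition.one_of_one_le ht.le
        rw [this.deriv_eq, deriv_const]
    rw [h0, abs_zero]
    exact le_max_right _ _

theorem deriv_smoothTransition_of_one_lt {s : ℝ} (h : 1 < s) :
    deriv Real.smoothTransition s = 0 := by
  have : Real.smoothTransition =ᶠ[𝓝 s] fun _ => 1 := by
    filter_upwards [eventually_gt_nhds h] with t ht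
    exact Real.smoothTransition.one_of_one_le ht.le
  rw [this.deriv_eq, deriv_const]

/-- The divergence theorem for a field which is tangent to the boundary in a chart. The field is
cut off in the layer `{-2/m ≤ f ≤ -1/m}`; tangency makes the derivative of the cut-off
contribute a bounded function supported in that layer, so that neither surface measure nor a
parametrisation of the boundary is needed. -/
theorem integral_divergence_interior_eq_zero {Ω U T : Set (Eu n)} {f : Eu n → ℝ} {Y : Eu n → Eu n}
    {B C : ℝ} (hc : IsRegularChart Ω U f) (hT : IsCompact T) (hTU : T ⊆ U)
    (hYT : ∀ y ∉ T, Y y = 0) (hY : ContDiffOn ℝ 1 Y (interior Ω))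
    (hB : ∀ y ∈ interior Ω, |divergence Y y| ≤ B)
    (hC : ∀ y ∈ interior Ω ∩ U, |fderiv ℝ f y (Y y)| ≤ C * |f y|) :
    ∫ y in interior Ω, divergence Y y = 0 := by
  obtain ⟨K, hK0, hK⟩ := exists_bound_deriv_smoothTransition
  set χ : ℕ → Eu n → ℝ := fun m y => Real.smoothTransition (-(m : ℝ) * f y - 1) with hχ
  set Z : ℕ → Eu n → Eu n := fun m y => χ m y • Y y with hZ
  have hout : ∀ y ∉ T, ∀ᶠ z in 𝓝 y, Y z = 0 := fun y hy => by
    filter_upwards [hT.isClosed.isOpen_compl.mem_nhds hy] with z hz using hYT z hz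
  have hZout : ∀ m, ∀ y ∉ T, ∀ᶠ z in 𝓝 y, Z m z = 0 := fun m y hy => by
    filter_upwards [hout y hy] with z hz
    simp [hZ, hz]
  have hZpos : ∀ m, ∀ y ∈ T, 0 ≤ f y → ∀ᶠ z in 𝓝 y, Z m z = 0 := by
    intro m y hy hf
    have h1 : ContinuousAt (fun z => -(m : ℝ) * f z - 1) y :=
      ((hc.differentiableAt (hTU hy)).continuousAt.const_mul _).sub continuousAt_const
    have h2 : -(m : ℝ) * f y - 1 < 0 := by
      have : 0 ≤ (m : ℝ) * f y := by positivity
      linarith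
    filter_upwards [h1.eventually_lt_const h2] with z hz
    simp only [hZ, hχ, Real.smoothTransition.zero_of_nonpos hz.le, zero_smul]
  have hχd : ∀ m, ∀ y ∈ T, ContDiffAt ℝ 1 (χ m) y := fun m y hy =>
    Real.smoothTransition.contDiffAt.comp y
      ((contDiffAt_const.mul ((hc.contDiffAt (hTU hy)).of_le (by simp))).sub contDiffAt_const)
  have hYd : ∀ y ∈ interior Ω, ContDiffAt ℝ 1 Y y := fun y hy =>
    hY.contDiffAt (isOpen_interior.mem_nhds hy)
  have hZd : ∀ m, ContDiff ℝ 1 (Z m) := by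
    intro m
    rw [contDiff_iff_contDiffAt]
    intro y
    have hz : (∀ᶠ z in 𝓝 y, Z m z = 0) → ContDiffAt ℝ 1 (Z m) y := fun h =>
      (contDiffAt_const (c := (0 : Eu n))).congr_of_eventuallyEq h
    by_cases hy : y ∈ T
    · rcases le_or_gt 0 (f y) with hf | hf
      · exact hz (hZpos m y hy hf)
      · exact (hχd m y hy).smul (hYd y (hc.mem_interior (hTU hy) hf))
    · exact hz (hZout m y hy)
  have hZc : ∀ m, HasCompactSupport (Z m) := fun m =>
    HasCompactSupport.intro hT fun y hy => by simp [hZ, hYT y hy]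
  have hZ0 : ∀ m, ∫ y in interior Ω, divergence (Z m) y = 0 := by
    intro m
    rw [setIntegral_eq_integral_of_forall_compl_eq_zero, integral_divergence_eq_zero (hZd m) (hZc m)]
    intro y hy
    refine divergence_eq_zero_of_eventuallyEq ?_
    by_cases hyT : y ∈ T
    · refine hZpos m y hyT (le_of_not_gt fun hf => hy (hc.mem_interior (hTU hyT) hf))
    · exact hZout m y hyT
  have hlim : Tendsto (fun m => ∫ y in interior Ω, divergence (Z m) y) atTop
      (𝓝 (∫ y in interior Ω, divergence Y y)) := by
    have hC0 : ∀ y ∈ interior Ω, y ∈ T → 0 ≤ C * |f y| := fun y hy hyT =>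
      (abs_nonneg _).trans (hC y ⟨hy, hTU hyT⟩)
    refine tendsto_integral_of_dominated_convergence
      (T.indicator fun _ => K * (2 * |C|) + |B|) ?_ ?_ ?_ ?_
    · intro m
      have hd : Continuous (fderiv ℝ (Z m)) := (hZd m).continuous_fderiv (by simp)
      have : Continuous (divergence (Z m)) := continuous_finsetSum _ fun i _ =>
        (EuclideanSpace.proj i : Eu n →L[ℝ] ℝ).continuous.comp (hd.clm_apply continuous_const)
      exact this.aestronglyMeasurable
    · refine Integrable.restrict ?_
      rw [integrable_indicator_iff hT.isClosed.measurableSet]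
      exact integrableOn_const hT.measure_lt_top.ne
    · intro m
      refine (ae_restrict_iff' isOpen_interior.measurableSet).mpr (Eventually.of_forall fun y hy => ?_)
      by_cases hyT : y ∈ T
      · rw [indicator_of_mem hyT, hZ,
          divergence_smul ((hχd m y hyT).differentiableAt (by simp))
            ((hYd y hy).differentiableAt (by simp))]
        have hfneg := hc.lt_zero (hTU hyT) hy
        have hfd : fderiv ℝ (χ m) y (Y y)
            = deriv Real.smoothTransition (-(m : ℝ) * f y - 1) * (-m * fderiv ℝ f y (Y y)) := by
          have h1 : HasFDerivAt (fun y => -(m : ℝ) * f y - 1) (-(m : ℝ) • fderiv ℝ f y) y :=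
            ((hc.differentiableAt (hTU hyT)).hasFDerivAt.const_mul _).sub_const _
          have h2 := ((Real.smoothTransition.contDiffAt (n := 1)
            (x := -(m : ℝ) * f y - 1)).differentiableAt (by simp)).hasDerivAt.comp_hasFDerivAt y h1
          have h3 : fderiv ℝ (χ m) y = _ := h2.fderiv
          rw [h3]
          simp
        have h1 : |fderiv ℝ (χ m) y (Y y)| ≤ K * (2 * |C|) := by
          rw [hfd]
          by_cases hm : 1 < -(m : ℝ) * f y - 1
          · rw [deriv_smoothTransition_of_one_lt hm, zero_mul, abs_zero]
            positivity
          · rw [abs_mul, abs_mul, abs_neg, Nat.abs_cast]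
            have h2 : (m : ℝ) * |f y| ≤ 2 := by
              rw [abs_of_neg hfneg]; linarith
            have h3 := hC y ⟨hy, hTU hyT⟩
            have h4 : (m : ℝ) * |fderiv ℝ f y (Y y)| ≤ 2 * |C| :=
              calc (m : ℝ) * |fderiv ℝ f y (Y y)| ≤ m * (C * |f y|) := by gcongr
                _ ≤ m * (|C| * |f y|) := by gcongr; exact le_abs_self C
                _ = (m * |f y|) * |C| := by ring
                _ ≤ 2 * |C| := by gcongr
            exact mul_le_mul (hK _) h4 (by positivity) hK0
        have h2 : |χ m y * divergence Y y| ≤ |B| := by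
          rw [abs_mul, abs_of_nonneg (Real.smoothTransition.nonneg _)]
          calc χ m y * |divergence Y y| ≤ 1 * |B| :=
              mul_le_mul (Real.smoothTransition.le_one _) ((hB y hy).trans (le_abs_self B))
                (abs_nonneg _) zero_le_one
            _ = |B| := one_mul _
        exact (abs_add_le _ _).trans (add_le_add h1 h2)
      · rw [indicator_of_notMem hyT, divergence_eq_zero_of_eventuallyEq (hZout m y hyT), norm_zero]
    · refine (ae_restrict_iff' isOpen_interior.measurableSet).mpr (Eventually.of_forall fun y hy => ?_)
      by_cases hyT : y ∈ T
      · have hfneg := hc.lt_zero (hTU hyT) hy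
        refine tendsto_const_nhds.congr' ?_
        obtain ⟨m₀, hm₀⟩ := exists_nat_gt (2 / -f y)
        filter_upwards [eventually_ge_atTop m₀] with m hm
        refine (divergence_eq_of_eventuallyEq ?_).symm
        have h1 : ContinuousAt (fun z => -(m : ℝ) * f z - 1) y :=
          ((hc.differentiableAt (hTU hyT)).continuousAt.const_mul _).sub continuousAt_const
        have h2 : 1 < -(m : ℝ) * f y - 1 := by
          have h3 : (m₀ : ℝ) ≤ m := by exact_mod_cast hm
          rw [div_lt_iff₀ (by linarith)] at hm₀
          nlinarith
        filter_upwards [h1.eventually_const_lt h2] with z hz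
        simp only [hZ, hχ, Real.smoothTransition.one_of_one_le hz.le, one_smul]
      · rw [divergence_eq_zero_of_eventuallyEq (hout y hyT)]
        refine tendsto_const_nhds.congr fun m => ?_
        rw [divergence_eq_zero_of_eventuallyEq (hZout m y hyT)]
  simp only [hZ0] at hlim
  exact (tendsto_nhds_unique hlim tendsto_const_nhds)

/-! ### Cutting off a set of vanishing `(n-1)`-dimensional measure -/

/-- A compact set of vanishing `(n-1)`-dimensional Hausdorff measure is covered by finitely many
balls of arbitrarily small total area. -/
theorem exists_cover_of_hausdorffMeasure_eq_zero [NeZero n] {S : Set (Eu n)} (hS : IsCompact S)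
    (h0 : Measure.hausdorffMeasure ((n : ℝ) - 1) S = 0) {δ : ℝ} (hδ : 0 < δ) :
    ∃ (s : Finset ℕ) (x : ℕ → Eu n) (r : ℕ → ℝ), (∀ i ∈ s, 0 < r i ∧ r i ≤ 1) ∧
      S ⊆ ⋃ i ∈ s, ball (x i) (r i) ∧ ∑ i ∈ s, r i ^ (n - 1) ≤ δ := by
  have hd : (n : ℝ) - 1 = ((n - 1 : ℕ) : ℝ) := by
    rw [Nat.cast_sub (Nat.one_le_iff_ne_zero.mpr (NeZero.ne n)), Nat.cast_one]
  rw [hd, Measure.hausdorffMeasure_apply] at h0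
  have h1 : (⨅ (t : ℕ → Set (Eu n)) (_ : S ⊆ ⋃ n, t n) (_ : ∀ n, ediam (t n) ≤ 1 / 4),
      ∑' m, ⨆ _ : (t m).Nonempty, ediam (t m) ^ ((n - 1 : ℕ) : ℝ)) < ENNReal.ofReal (δ / 2) := by
    refine lt_of_le_of_lt ?_ (ENNReal.ofReal_pos.mpr (half_pos hδ))
    rw [← h0]
    exact le_iSup₂_of_le (1 / 4) (by simp) le_rfl
  simp only [iInf_lt_iff] at h1
  obtain ⟨t, hcov, hdiam, hsum⟩ := h1
  obtain ⟨e, he, c, hec, hcδ⟩ := posSumOfEncodable (half_pos hδ) ℕ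
  set D : ℕ → ℝ := fun m => (ediam (t m)).toReal with hD
  have hfin : ∀ m, ediam (t m) ≠ ⊤ := fun m => ne_top_of_le_ne_top (by simp) (hdiam m)
  have hD1 : ∀ m, D m < 1 := by
    intro m
    have := ENNReal.toReal_mono (by simp) (hdiam m)
    refine lt_of_le_of_lt this ?_
    norm_num
  have hr : ∀ m, ∃ r, D m < r ∧ r < 1 ∧ r ^ (n - 1) < D m ^ (n - 1) + e m := by
    intro m
    have hcont : ContinuousAt (fun z : ℝ => z ^ (n - 1)) (D m) := by fun_prop
    have h2 : ∀ᶠ z in 𝓝 (D m), z ^ (n - 1) < D m ^ (n - 1) + e m :=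
      hcont.eventually_lt_const (by simpa using he m)
    have h3 : ∀ᶠ z in 𝓝[>] (D m), D m < z ∧ z < 1 ∧ z ^ (n - 1) < D m ^ (n - 1) + e m :=
      eventually_mem_nhdsWithin.and
        (nhdsWithin_le_nhds ((eventually_lt_nhds (hD1 m)).and h2))
    exact h3.exists
  choose r hr₁ hr₂ hr₃ using hr
  have hDnn : ∀ m, 0 ≤ D m := fun m => ENNReal.toReal_nonneg
  have hx : ∀ m, ∃ x, (t m).Nonempty → x ∈ t m := by
    intro m
    by_cases h : (t m).Nonempty
    · exact ⟨h.some, fun _ => h.some_mem⟩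
    · exact ⟨0, fun h' => (h h').elim⟩
  choose x hx using hx
  have hsub : ∀ m, (t m).Nonempty → t m ⊆ ball (x m) (r m) := by
    intro m hm y hy
    rw [mem_ball, dist_edist]
    refine lt_of_le_of_lt (ENNReal.toReal_mono (hfin m) ?_) (hr₁ m)
    exact edist_le_ediam_of_mem hy (hx m hm)
  classical
  obtain ⟨s, hs⟩ := hS.elim_finite_subcover
    (fun m => if (t m).Nonempty then ball (x m) (r m) else ∅)
    (fun m => by split_ifs <;> simp)
    (by
      intro y hy
      obtain ⟨m, hm⟩ := mem_iUnion.mp (hcov hy)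
      refine mem_iUnion.mpr ⟨m, ?_⟩
      have hne : (t m).Nonempty := ⟨y, hm⟩
      rw [if_pos hne]
      exact hsub m hne hm)
  refine ⟨s.filter fun m => (t m).Nonempty, x, r, fun i _ => ⟨(hDnn i).trans_lt (hr₁ i), (hr₂ i).le⟩,
    ?_, ?_⟩
  · intro y hy
    obtain ⟨m, hm, hym⟩ := mem_iUnion₂.mp (hs hy)
    split_ifs at hym with hne
    · exact mem_iUnion₂.mpr ⟨m, Finset.mem_filter.mpr ⟨hm, hne⟩, hym⟩
    · exact hym.elim
  · set s' := s.filter fun m => (t m).Nonempty with hs'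
    have h4 : ∑ i ∈ s', D i ^ (n - 1) ≤ δ / 2 := by
      have h5 : ∑ i ∈ s', ENNReal.ofReal (D i ^ (n - 1)) ≤ ENNReal.ofReal (δ / 2) := by
        refine le_trans ?_ hsum.le
        refine le_trans ?_ (ENNReal.sum_le_tsum s')
        refine Finset.sum_le_sum fun i hi => ?_
        have hne : (t i).Nonempty := (Finset.mem_filter.mp hi).2
        rw [ciSup_pos hne, ENNReal.rpow_natCast, ENNReal.ofReal_pow (hDnn i), hD,
          ENNReal.ofReal_toReal (hfin i)]
      rw [← ENNReal.ofReal_sum_of_nonneg fun i _ => pow_nonneg (hDnn i) _] at h5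
      exact (ENNReal.ofReal_le_ofReal_iff (half_pos hδ).le).mp h5
    have h6 : ∑ i ∈ s', e i ≤ δ / 2 :=
      (sum_le_hasSum s' (fun i _ => (he i).le) hec).trans hcδ
    calc ∑ i ∈ s', r i ^ (n - 1) ≤ ∑ i ∈ s', (D i ^ (n - 1) + e i) :=
          Finset.sum_le_sum fun i _ => (hr₃ i).le
      _ ≤ δ := by rw [Finset.sum_add_distrib]; linarith

/-- A covering by balls of radius at most one and small total area has small total volume. -/
theorem volume_eq_zero_of_hausdorffMeasure_eq_zero [NeZero n] {S : Set (Eu n)} (hS : IsCompact S)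
    (h0 : Measure.hausdorffMeasure ((n : ℝ) - 1) S = 0) : volume S = 0 := by
  set τ := volume (ball (0 : Eu n) 1) with hτ
  have hτt : τ ≠ ⊤ := measure_ball_lt_top.ne
  have h1 : ∀ δ : ℝ, 0 < δ → volume S ≤ ENNReal.ofReal δ * τ := by
    intro δ hδ
    obtain ⟨s, x, r, hr, hcov, hsum⟩ := exists_cover_of_hausdorffMeasure_eq_zero hS h0 hδ
    calc volume S ≤ volume (⋃ i ∈ s, ball (x i) (r i)) := measure_mono hcov
      _ ≤ ∑ i ∈ s, volume (ball (x i) (r i)) := measure_biUnion_finset_le s _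
      _ ≤ ∑ i ∈ s, ENNReal.ofReal (r i ^ (n - 1)) * τ := by
        refine Finset.sum_le_sum fun i hi => ?_
        obtain ⟨h2, h3⟩ := hr i hi
        rw [Measure.addHaar_ball_of_pos _ _ h2, finrank_euclideanSpace_fin]
        gcongr ENNReal.ofReal ?_ * _
        exact pow_le_pow_of_le_one h2.le h3 (Nat.sub_le n 1)
      _ = ENNReal.ofReal (∑ i ∈ s, r i ^ (n - 1)) * τ := by
        rw [ENNReal.ofReal_sum_of_nonneg fun i hi => pow_nonneg (hr i hi).1.le _, Finset.sum_mul]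
      _ ≤ ENNReal.ofReal δ * τ := by gcongr
  refine le_antisymm ?_ zero_le
  have hlim : Tendsto (fun δ : ℝ => ENNReal.ofReal δ * τ) (𝓝[>] 0) (𝓝 0) := by
    have h2 : Tendsto (fun δ : ℝ => ENNReal.ofReal δ) (𝓝[>] 0) (𝓝 0) := by
      have := (ENNReal.continuous_ofReal.tendsto 0).mono_left (nhdsWithin_le_nhds (s := Ioi 0))
      simpa using this
    have := ENNReal.Tendsto.mul_const h2 (Or.inr hτt)
    simpa using this
  exact ge_of_tendsto hlim (by filter_upwards [self_mem_nhdsWithin] with δ hδ using h1 δ hδ)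

/-- A smooth bump which is `1` on the ball of radius `r` and vanishes outside the ball of
radius `√2 r`. -/
def ballBump (x : Eu n) (r : ℝ) (y : Eu n) : ℝ := Real.smoothTransition (2 - ‖y - x‖ ^ 2 / r ^ 2)

theorem contDiff_ballBump (x : Eu n) (r : ℝ) : ContDiff ℝ 1 (ballBump x r) :=
  Real.smoothTransition.contDiff.comp
    (contDiff_const.sub (((contDiff_id.sub contDiff_const).norm_sq ℝ).div_const _))

theorem ballBump_eq_one {x y : Eu n} {r : ℝ} (hr : 0 < r) (hy : y ∈ ball x r) :
    ballBump x r y = 1 := by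
  refine Real.smoothTransition.one_of_one_le ?_
  rw [mem_ball, dist_eq_norm] at hy
  have : ‖y - x‖ ^ 2 / r ^ 2 ≤ 1 := by
    rw [div_le_one (by positivity)]
    gcongr
  linarith

theorem ballBump_eq_zero {x y : Eu n} {r : ℝ} (hr : 0 < r) (hy : y ∉ ball x (2 * r)) :
    ballBump x r y = 0 := by
  refine Real.smoothTransition.zero_of_nonpos ?_
  rw [mem_ball, dist_eq_norm, not_lt] at hy
  have : 2 ≤ ‖y - x‖ ^ 2 / r ^ 2 := by
    rw [le_div_iff₀ (by positivity)]
    nlinarith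
  linarith

theorem norm_fderiv_ballBump_le {K : ℝ} (hK0 : 0 ≤ K)
    (hK : ∀ s, |deriv Real.smoothTransition s| ≤ K) {x y : Eu n} {r : ℝ} (hr : 0 < r) :
    ‖fderiv ℝ (ballBump x r) y‖ ≤ (ball x (2 * r)).indicator (fun _ => 4 * K / r) y := by
  have h1 : HasFDerivAt (fun y : Eu n => 2 - ‖y - x‖ ^ 2 / r ^ 2)
      (-((r ^ 2)⁻¹ • (2 • innerSL ℝ (y - x)))) y := by
    have h2 : HasFDerivAt (fun y : Eu n => ‖y - x‖ ^ 2) (2 • innerSL ℝ (y - x)) y := by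
      exact (hasStrictFDerivAt_norm_sq (y - x)).hasFDerivAt.comp y
        ((hasFDerivAt_id y).sub_const x)
    have := (h2.mul_const (r ^ 2)⁻¹).const_sub 2
    simpa [div_eq_mul_inv] using this
  have h2 := ((Real.smoothTransition.contDiffAt (n := 1)
    (x := 2 - ‖y - x‖ ^ 2 / r ^ 2)).differentiableAt (by simp)).hasDerivAt.comp_hasFDerivAt y h1
  have h3 : fderiv ℝ (ballBump x r) y = _ := h2.fderiv
  by_cases hy : y ∈ ball x (2 * r)
  · rw [indicator_of_mem hy, h3, norm_smul, norm_neg, norm_smul]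
    rw [mem_ball, dist_eq_norm] at hy
    have h4 : ‖(2 • innerSL ℝ (y - x) : Eu n →L[ℝ] ℝ)‖ ≤ 2 * (2 * r) := by
      rw [← Nat.cast_smul_eq_nsmul ℝ, norm_smul, innerSL_apply_norm]
      simp only [Nat.cast_ofNat, Real.norm_ofNat]
      gcongr
    calc _ ≤ K * (‖(r ^ 2)⁻¹‖ * (2 * (2 * r))) := by
          gcongr
          exact hK _
      _ = 4 * K / r := by
          rw [Real.norm_of_nonneg (by positivity)]
          field_simp
          ring
  · rw [indicator_of_notMem hy, h3]
    have h4 : deriv Real.smoothTransition (2 - ‖y - x‖ ^ 2 / r ^ 2) = 0 := by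
      have : Real.smoothTransition =ᶠ[𝓝 (2 - ‖y - x‖ ^ 2 / r ^ 2)] fun _ => 0 := by
        rw [mem_ball, dist_eq_norm, not_lt] at hy
        have h5 : 4 ≤ ‖y - x‖ ^ 2 / r ^ 2 := by
          rw [le_div_iff₀ (by positivity)]
          nlinarith
        have : 2 - ‖y - x‖ ^ 2 / r ^ 2 < 0 := by linarith
        filter_upwards [eventually_lt_nhds this] with t ht
        exact Real.smoothTransition.zero_of_nonpos ht.le
      rw [this.deriv_eq, deriv_const]
    rw [h4]
    simp

/-- Cut-off functions which vanish near a compact set of vanishing `(n-1)`-dimensional Hausdorff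
measure and tend to `1` in the Sobolev space `W^{1,1}`. -/
theorem exists_cutoff [NeZero n] {S : Set (Eu n)} (hS : IsCompact S)
    (h0 : Measure.hausdorffMeasure ((n : ℝ) - 1) S = 0) {δ : ℝ} (hδ : 0 < δ) :
    ∃ η : Eu n → ℝ, ContDiff ℝ 1 η ∧ (∃ W, IsOpen W ∧ S ⊆ W ∧ ∀ y ∈ W, η y = 0) ∧
      Integrable (fun y => ‖fderiv ℝ η y‖ + |1 - η y|) ∧
      ∫ y, (‖fderiv ℝ η y‖ + |1 - η y|) ≤ δ := by
  obtain ⟨K, hK0, hK⟩ := exists_bound_deriv_smoothTransition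
  set τ := (volume : Measure (Eu n)).real (ball 0 1) with hτ
  set A : ℝ := (4 * K + 1) * (2 ^ n * τ) with hA
  have hA0 : 0 ≤ A := by positivity
  obtain ⟨s, x, r, hr, hcov, hsum⟩ := exists_cover_of_hausdorffMeasure_eq_zero hS h0
    (show 0 < δ / (A + 1) by positivity)
  set b : ℕ → Eu n → ℝ := fun i => ballBump (x i) (r i) with hb
  have hbd : ∀ i, ContDiff ℝ 1 (b i) := fun i => contDiff_ballBump _ _
  have hb0 : ∀ i y, 0 ≤ b i y := fun i y => Real.smoothTransition.nonneg _
  have hb1 : ∀ i y, b i y ≤ 1 := fun i y => Real.smoothTransition.le_one _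
  have key : ∀ t : Finset ℕ, ContDiff ℝ 1 (fun y => ∏ i ∈ t, (1 - b i y)) ∧
      ∀ y, 0 ≤ ∏ i ∈ t, (1 - b i y) ∧ ∏ i ∈ t, (1 - b i y) ≤ 1 ∧
        ‖fderiv ℝ (fun y => ∏ i ∈ t, (1 - b i y)) y‖ ≤ ∑ i ∈ t, ‖fderiv ℝ (b i) y‖ ∧
        1 - ∏ i ∈ t, (1 - b i y) ≤ ∑ i ∈ t, b i y := by
    intro t
    induction t using Finset.induction_on with
    | empty => exact ⟨by simpa using contDiff_const, fun y => by simp⟩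
    | insert a t ha ih =>
      obtain ⟨ih1, ih2⟩ := ih
      simp only [Finset.prod_insert ha, Finset.sum_insert ha]
      have hda : ContDiff ℝ 1 fun y => 1 - b a y := contDiff_const.sub (hbd a)
      refine ⟨hda.mul ih1, fun y => ?_⟩
      obtain ⟨i1, i2, i3, i4⟩ := ih2 y
      have j0 := hb0 a y
      have j1 := hb1 a y
      refine ⟨mul_nonneg (by linarith) i1, by nlinarith, ?_, by nlinarith⟩
      rw [fderiv_fun_mul (hda.differentiable (by simp) y) (ih1.differentiable (by simp) y),
        fderiv_const_sub]
      refine (norm_add_le _ _).trans ?_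
      rw [norm_smul, norm_smul, norm_neg, Real.norm_of_nonneg (by linarith),
        Real.norm_of_nonneg i1]
      nlinarith [norm_nonneg (fderiv ℝ (b a) y),
        norm_nonneg (fderiv ℝ (fun y => ∏ i ∈ t, (1 - b i y)) y)]
  obtain ⟨hη, hη2⟩ := key s
  set η : Eu n → ℝ := fun y => ∏ i ∈ s, (1 - b i y) with hηdef
  set G : Eu n → ℝ := fun y => ∑ i ∈ s, (ball (x i) (2 * r i)).indicator (fun _ => (4 * K + 1) / r i) y
    with hG
  have hball : ∀ i ∈ s, (volume : Measure (Eu n)).real (ball (x i) (2 * r i)) = (2 * r i) ^ n * τ := by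
    intro i hi
    have h2 : 0 < 2 * r i := by linarith [(hr i hi).1]
    rw [Measure.real, Measure.addHaar_ball_of_pos _ _ h2, ENNReal.toReal_mul, finrank_euclideanSpace_fin,
      ENNReal.toReal_ofReal (by positivity)]
    rfl
  have hGi : ∀ i ∈ s, Integrable
      ((ball (x i) (2 * r i)).indicator fun _ : Eu n => (4 * K + 1) / r i) := fun i _ => by
    rw [integrable_indicator_iff isOpen_ball.measurableSet]
    exact integrableOn_const measure_ball_lt_top.ne
  have hGint : Integrable G := integrable_finsetSum _ hGi
  have hle : ∀ y, ‖fderiv ℝ η y‖ + |1 - η y| ≤ G y := by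
    intro y
    obtain ⟨i1, i2, i3, i4⟩ := hη2 y
    rw [abs_of_nonneg (by linarith)]
    refine (add_le_add i3 i4).trans ?_
    rw [← Finset.sum_add_distrib]
    refine Finset.sum_le_sum fun i hi => ?_
    obtain ⟨hr0, hr1⟩ := hr i hi
    have h1 := norm_fderiv_ballBump_le hK0 hK (x := x i) (y := y) hr0
    by_cases hy : y ∈ ball (x i) (2 * r i)
    · rw [indicator_of_mem hy] at h1 ⊢
      have h2 : (1 : ℝ) ≤ 1 / r i := by rwa [le_div_iff₀ hr0, one_mul]
      rw [add_div]
      exact add_le_add h1 ((hb1 i y).trans h2)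
    · rw [indicator_of_notMem hy] at h1 ⊢
      have h2 : b i y = 0 := ballBump_eq_zero hr0 hy
      rw [h2, add_zero]
      exact h1
  have hηc : Continuous fun y => ‖fderiv ℝ η y‖ + |1 - η y| :=
    ((hη.continuous_fderiv (by simp)).norm).add (continuous_const.sub hη.continuous).abs
  have hηint : Integrable fun y => ‖fderiv ℝ η y‖ + |1 - η y| :=
    hGint.mono' hηc.aestronglyMeasurable (Eventually.of_forall fun y => by
      rw [Real.norm_of_nonneg (by positivity)]; exact hle y)
  refine ⟨η, hη, ⟨⋃ i ∈ s, ball (x i) (r i), isOpen_biUnion fun i _ => isOpen_ball, hcov, ?_⟩,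
    hηint, ?_⟩
  · intro y hy
    obtain ⟨i, hi, hyi⟩ := mem_iUnion₂.mp hy
    refine Finset.prod_eq_zero hi ?_
    have : b i y = 1 := ballBump_eq_one (hr i hi).1 hyi
    rw [this, sub_self]
  · calc ∫ y, (‖fderiv ℝ η y‖ + |1 - η y|) ≤ ∫ y, G y := integral_mono hηint hGint hle
      _ = ∑ i ∈ s, ((2 * r i) ^ n * τ) * ((4 * K + 1) / r i) := by
        rw [hG, integral_finsetSum _ hGi]
        refine Finset.sum_congr rfl fun i hi => ?_
        rw [integral_indicator isOpen_ball.measurableSet, setIntegral_const, hball i hi, smul_eq_mul]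
      _ = A * ∑ i ∈ s, r i ^ (n - 1) := by
        rw [Finset.mul_sum]
        refine Finset.sum_congr rfl fun i hi => ?_
        have hr0 := (hr i hi).1
        obtain ⟨m, hm⟩ := Nat.exists_eq_succ_of_ne_zero (NeZero.ne n)
        have h1 : r i ^ n = r i ^ (n - 1) * r i := by
          rw [hm, Nat.succ_sub_one, pow_succ]
        rw [mul_pow, h1, hA]
        field_simp
      _ ≤ A * (δ / (A + 1)) := by gcongr
      _ ≤ δ := by
        rw [mul_div_assoc', div_le_iff₀ (by positivity)]
        nlinarith

/-! ### The divergence theorem for tangent fields -/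

/-- A function which is `C¹` up to the point `p` of `Ω` has bounded derivative in the interior near `p`. -/
theorem exists_bound_fderiv {F : Type*} [NormedAddCommGroup F] [NormedSpace ℝ F] {Ω : Set (Eu n)}
    {g : Eu n → F} {p : Eu n} (hp : p ∈ Ω) (hg : ContDiffWithinAt ℝ 1 g Ω p) :
    ∃ δ > 0, ∃ B, 0 ≤ B ∧ (∀ y ∈ ball p δ ∩ interior Ω, DifferentiableAt ℝ g y ∧
      ‖fderiv ℝ g y‖ ≤ B) ∧ ContinuousOn g (ball p δ ∩ Ω) := by
  have h1 : ContDiffWithinAt ℝ (0 + 1) g Ω p := by simpa using hg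
  rw [contDiffWithinAt_succ_iff_hasFDerivWithinAt (by simp)] at h1
  obtain ⟨u, hu, -, g', hg', hcont⟩ := h1
  rw [insert_eq_of_mem hp] at hu
  have hc : ContinuousWithinAt g' u p := hcont.continuousWithinAt
  have h2 : ∀ᶠ y in 𝓝[u] p, ‖g' y‖ < ‖g' p‖ + 1 := hc.norm.eventually_lt_const (by linarith)
  obtain ⟨δ₁, hδ₁, h₁⟩ := Metric.mem_nhdsWithin_iff.mp hu
  obtain ⟨δ₂, hδ₂, h₂⟩ := Metric.mem_nhdsWithin_iff.mp h2
  refine ⟨min δ₁ δ₂, lt_min hδ₁ hδ₂, ‖g' p‖ + 1, by positivity, ?_, ?_⟩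
  · rintro y ⟨hy, hyi⟩
    have hyu : u ∈ 𝓝 y := by
      filter_upwards [isOpen_ball.mem_nhds (ball_subset_ball (min_le_left _ _) hy),
        isOpen_interior.mem_nhds hyi] with z hz hz'
      exact h₁ ⟨hz, interior_subset hz'⟩
    have hd := (hg' y (mem_of_mem_nhds hyu)).hasFDerivAt hyu
    refine ⟨hd.differentiableAt, ?_⟩
    rw [hd.fderiv]
    exact le_of_lt (h₂ ⟨ball_subset_ball (min_le_right _ _) hy, mem_of_mem_nhds hyu⟩)
  · rintro y ⟨hy, hyΩ⟩
    have hyu : y ∈ u := h₁ ⟨ball_subset_ball (min_le_left _ _) hy, hyΩ⟩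
    refine (hg' y hyu).continuousWithinAt.mono ?_
    rintro z ⟨hz, hzΩ⟩
    exact h₁ ⟨ball_subset_ball (min_le_left _ _) hz, hzΩ⟩

/-- A `C¹` function which vanishes on the boundary is bounded by a multiple of the defining
function. -/
theorem exists_le_mul_abs {Ω U : Set (Eu n)} {f g : Eu n → ℝ} (hc : IsRegularChart Ω U f)
    (hΩ : IsClosed Ω) {p : Eu n} (hpU : p ∈ U)
    (hg : p ∈ Ω → ContDiffWithinAt ℝ 1 g Ω p) (hg0 : ∀ y ∈ U, f y = 0 → g y = 0) :
    ∃ V ∈ 𝓝 p, ∃ C, ∀ y ∈ V ∩ interior Ω, |g y| ≤ C * |f y| := by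
  by_cases hp : p ∈ Ω
  swap
  · exact ⟨Ωᶜ, hΩ.isOpen_compl.mem_nhds hp, 0, fun y hy => (hy.1 (interior_subset hy.2)).elim⟩
  have hgp := hg hp
  have hfc : ContinuousAt f p := (hc.differentiableAt hpU).continuousAt
  rcases ((hc.mem_iff p hpU).mp hp).lt_or_eq with hneg | hzero
  · have h1 : ∀ᶠ y in 𝓝 p, f y < f p / 2 := hfc.eventually_lt_const (by linarith)
    have h2 : ∀ᶠ y in 𝓝 p, y ∈ Ω → |g y| < |g p| + 1 :=
      eventually_nhdsWithin_iff.mp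
        (hgp.continuousWithinAt.abs.eventually_lt_const (by linarith))
    refine ⟨_, h1.and h2, (|g p| + 1) / |f p / 2|, ?_⟩
    rintro y ⟨⟨hy1, hy2⟩, hyi⟩
    have h3 : |f p / 2| ≤ |f y| := by
      rw [abs_of_neg (by linarith), abs_of_neg (by linarith)]; linarith
    have h4 : 0 < |f p / 2| := abs_pos.mpr (by linarith)
    calc |g y| ≤ |g p| + 1 := (hy2 (interior_subset hyi)).le
      _ = (|g p| + 1) / |f p / 2| * |f p / 2| := by field_simp
      _ ≤ _ := by gcongr
  · obtain ⟨δ₁, hδ₁, B, hB0, hB, hgc⟩ := exists_bound_fderiv hp hgp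
    obtain ⟨v, δ₂, hδ₂, hball, hv⟩ := hc.exists_direction hpU
    set δ := min δ₁ δ₂ with hδ
    have hδ0 : 0 < δ := lt_min hδ₁ hδ₂
    have hb1 : ball p δ ⊆ ball p δ₁ := ball_subset_ball (min_le_left _ _)
    have hb2 : ball p δ ⊆ ball p δ₂ := ball_subset_ball (min_le_right _ _)
    have h1 : ∀ᶠ y in 𝓝 p, dist y p + 2 * |f y| * ‖v‖ < δ := by
      have : ContinuousAt (fun y => dist y p + 2 * |f y| * ‖v‖) p :=
        (continuousAt_id.dist continuousAt_const).add
          ((continuousAt_const.mul hfc.abs).mul continuousAt_const)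
      exact this.eventually_lt_const (by simpa [hzero] using hδ0)
    refine ⟨_, h1, B * ‖v‖ * 2, ?_⟩
    rintro y ⟨hy, hyi⟩
    have hy' : dist y p + 2 * |f y| * ‖v‖ < δ := hy
    have hmem : ∀ s ∈ Icc 0 (2 * |f y|), y + s • v ∈ ball p δ := by
      intro s hs
      rw [mem_ball]
      calc dist (y + s • v) p ≤ dist (y + s • v) y + dist y p := dist_triangle _ _ _
        _ = s * ‖v‖ + dist y p := by
          rw [dist_eq_norm, add_sub_cancel_left, norm_smul, Real.norm_of_nonneg hs.1]
        _ ≤ 2 * |f y| * ‖v‖ + dist y p := by gcongr; exact hs.2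
        _ < δ := by linarith
    have ht0 : 0 ≤ 2 * |f y| := by positivity
    have hyb : y ∈ ball p δ := by simpa using hmem 0 ⟨le_rfl, ht0⟩
    have hyU := hball (hb2 hyb)
    have hfy := hc.lt_zero hyU hyi
    have hgrow : ∀ z ∈ ball p δ, ∀ t : ℝ, 0 ≤ t → z + t • v ∈ ball p δ →
        f z + t / 2 ≤ f (z + t • v) := fun z hz t ht hzt =>
      add_half_le_of_fderiv (fun q hq => hc.differentiableAt (hball hq))
        (fun q hq => hv q hq v (mem_ball_self hδ₂)) (hb2 hz) ht (hb2 hzt)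
    -- the first boundary point above `y` in the direction of `v`
    obtain ⟨s, hs, hfs⟩ : ∃ s ∈ Icc 0 (2 * |f y|), f (y + s • v) = 0 := by
      have hcont : ContinuousOn (fun s : ℝ => f (y + s • v)) (Icc 0 (2 * |f y|)) := by
        intro s hs
        have : ContinuousAt (fun s : ℝ => f (y + s • v)) s :=
          ContinuousAt.comp (f := fun s : ℝ => y + s • v)
            (hc.differentiableAt (hball (hb2 (hmem s hs)))).continuousAt (by fun_prop)
        exact this.continuousWithinAt
      have h2 := hgrow y hyb _ ht0 (hmem _ (right_mem_Icc.mpr ht0))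
      have h3 : |f y| = -f y := abs_of_neg hfy
      exact intermediate_value_Icc ht0 hcont ⟨by simpa using hfy.le, by linarith⟩
    have hlt : ∀ s' ∈ Ico 0 s, y + s' • v ∈ ball p δ₁ ∩ interior Ω := by
      intro s' hs'
      have hm := hmem s' ⟨hs'.1, hs'.2.le.trans hs.2⟩
      refine ⟨hb1 hm, hc.mem_interior (hball (hb2 hm)) ?_⟩
      have h2 := hgrow (y + s' • v) hm (s - s') (by linarith [hs'.2])
        (by rw [add_assoc, ← add_smul]; simpa using hmem s hs)
      rw [add_assoc, ← add_smul, add_sub_cancel, hfs] at h2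
      linarith [hs'.2]
    have hzΩ : y + s • v ∈ Ω := (hc.mem_iff _ (hball (hb2 (hmem s hs)))).mpr hfs.le
    have hbound := norm_image_sub_le_of_norm_deriv_right_le_segment
      (f := fun s' : ℝ => g (y + s' • v)) (f' := fun s' => fderiv ℝ g (y + s' • v) v)
      (C := B * ‖v‖) (a := 0) (b := s) ?_ ?_ ?_ s (right_mem_Icc.mpr hs.1)
    · have h4 := hg0 _ (hball (hb2 (hmem s hs))) hfs
      simp only [h4, zero_smul, add_zero, zero_sub, norm_neg, sub_zero, Real.norm_eq_abs] at hbound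
      calc |g y| ≤ B * ‖v‖ * s := hbound
        _ ≤ B * ‖v‖ * (2 * |f y|) := by gcongr; exact hs.2
        _ = B * ‖v‖ * 2 * |f y| := by ring
    · refine hgc.comp (by fun_prop) ?_
      intro s' hs'
      rcases hs'.2.lt_or_eq with h | h
      · exact ⟨(hlt s' ⟨hs'.1, h⟩).1, interior_subset (hlt s' ⟨hs'.1, h⟩).2⟩
      · rw [h]; exact ⟨hb1 (hmem s hs), hzΩ⟩
    · intro s' hs'
      have h5 : HasDerivAt (fun s : ℝ => y + s • v) v s' := by
        simpa using ((hasDerivAt_id s').smul_const v).const_add y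
      exact ((hB _ (hlt s' hs')).1.hasFDerivAt.comp_hasDerivAt s' h5).hasDerivWithinAt
    · intro s' hs'
      exact (ContinuousLinearMap.le_opNorm _ _).trans
        (mul_le_mul_of_nonneg_right (hB _ (hlt s' hs')).2 (norm_nonneg v))

/-- Tangency of a vector field to the smooth part of the boundary. -/
def IsTangent (Ω : Set (Eu n)) (Y : Eu n → Eu n) : Prop :=
  ∀ x U f, IsLocalDefiningFunction Ω x U f → fderiv ℝ f x (Y x) = 0

/-- The divergence theorem for `ψ Y`, with `ψ` supported in a chart. -/
theorem exists_nhds_integral_fderiv_eq_zero [NeZero n] {Ω : Set (Eu n)} (hΩ : IsCompact Ω)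
    {Y : Eu n → Eu n} (hY : ContDiffOn ℝ 1 Y Ω) (hdiv : ∀ y ∈ interior Ω, divergence Y y = 0)
    (htan : IsTangent Ω Y) {p : Eu n} (hp : p ∉ singularSet Ω) :
    ∃ V, IsOpen V ∧ p ∈ V ∧ ∀ ψ : Eu n → ℝ, ContDiff ℝ 1 ψ → HasCompactSupport ψ →
      tsupport ψ ⊆ V → ∫ y in interior Ω, fderiv ℝ ψ y (Y y) = 0 := by
  obtain ⟨U, f, hc, hpU⟩ := exists_isRegularChart hΩ.isClosed hp
  obtain ⟨V, hV, C, hC⟩ := exists_le_mul_abs (g := fun y => fderiv ℝ f y (Y y)) hc hΩ.isClosed hpU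
    (fun hpΩ => by
      have h1 : ContDiffAt ℝ 1 (fderiv ℝ f) p := (hc.contDiffAt hpU).fderiv_right (by
        rw [one_add_one_eq_two]; exact WithTop.coe_le_coe.mpr le_top)
      exact h1.contDiffWithinAt.clm_apply (hY p hpΩ))
    (fun y hy h0 => htan y U f (hc.isLocalDefiningFunction hy h0))
  refine ⟨interior V ∩ U, isOpen_interior.inter hc.isOpen, ⟨mem_interior_iff_mem_nhds.mpr hV, hpU⟩,
    fun ψ hψ hψc hψV => ?_⟩
  obtain ⟨M, hM⟩ := hψc.exists_bound_of_continuous hψ.continuous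
  obtain ⟨M', hM'⟩ := (hψc.fderiv ℝ).exists_bound_of_continuous (hψ.continuous_fderiv (by simp))
  obtain ⟨N, hN⟩ := hΩ.exists_bound_of_continuousOn hY.continuousOn
  have hYd : ∀ y ∈ interior Ω, DifferentiableAt ℝ Y y := fun y hy =>
    ((hY y (interior_subset hy)).contDiffAt (mem_interior_iff_mem_nhds.mp hy)).differentiableAt
      (by simp)
  have hdψ : ∀ y ∈ interior Ω, divergence (fun y => ψ y • Y y) y = fderiv ℝ ψ y (Y y) := by
    intro y hy
    rw [divergence_smul (hψ.differentiable (by simp) y) (hYd y hy), hdiv y hy, mul_zero, add_zero]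
  have h := integral_divergence_interior_eq_zero (Y := fun y => ψ y • Y y) (B := M' * N)
    (C := |M| * |C|) hc hψc (hψV.trans inter_subset_right)
    (fun y hy => by rw [image_eq_zero_of_notMem_tsupport hy, zero_smul])
    ((hψ.contDiffOn).smul (hY.mono interior_subset)) ?_ ?_
  · rwa [setIntegral_congr_fun isOpen_interior.measurableSet hdψ] at h
  · intro y hy
    rw [hdψ y hy]
    exact (ContinuousLinearMap.le_opNorm _ _).trans (mul_le_mul (hM' y) (hN y (interior_subset hy))
      (norm_nonneg _) ((norm_nonneg _).trans (hM' y)))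
  · rintro y ⟨hy, hyU⟩
    rw [map_smul, smul_eq_mul, abs_mul]
    by_cases hyV : y ∈ tsupport ψ
    · have h1 := hC y ⟨interior_subset (hψV hyV).1, hy⟩
      calc |ψ y| * |fderiv ℝ f y (Y y)| ≤ |M| * (C * |f y|) :=
            mul_le_mul ((hM y).trans (le_abs_self M)) h1 (abs_nonneg _) (abs_nonneg _)
        _ ≤ |M| * (|C| * |f y|) := by gcongr; exact le_abs_self C
        _ = _ := by ring
    · rw [image_eq_zero_of_notMem_tsupport hyV, abs_zero, zero_mul]
      positivity

/-- A divergence-free field which is `C¹` up to the boundary and tangent to the smooth part of the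
boundary is weakly divergence-free on `ℝⁿ` when extended by zero. -/
theorem integral_fderiv_apply_eq_zero [NeZero n] {Ω : Set (Eu n)} (hΩ : IsCompactDomain Ω)
    {Y : Eu n → Eu n} (hY : ContDiffOn ℝ 1 Y Ω) (hdiv : ∀ y ∈ interior Ω, divergence Y y = 0)
    (htan : IsTangent Ω Y) {ψ : Eu n → ℝ} (hψ : ContDiff ℝ 1 ψ) :
    ∫ y in interior Ω, fderiv ℝ ψ y (Y y) = 0 := by
  have hK := hΩ.isCompact
  have hSc : IsCompact (singularSet Ω) :=
    hK.of_isClosed_subset (isClosed_singularSet hK.isClosed)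
      fun x hx => hK.isClosed.frontier_subset hx.1
  have hmeas : MeasurableSet (interior Ω) := isOpen_interior.measurableSet
  have hfin : volume (interior Ω) < ⊤ :=
    (measure_mono interior_subset).trans_lt hK.measure_lt_top
  have hYc : ContinuousOn Y (interior Ω) := hY.continuousOn.mono interior_subset
  obtain ⟨N, hN⟩ := hK.exists_bound_of_continuousOn hY.continuousOn
  have hint : ∀ φ : Eu n → ℝ, ContDiff ℝ 1 φ → HasCompactSupport φ →
      IntegrableOn (fun y => fderiv ℝ φ y (Y y)) (interior Ω) := by
    intro φ hφ hφc
    obtain ⟨M', hM'⟩ := (hφc.fderiv ℝ).exists_bound_of_continuous (hφ.continuous_fderiv (by simp))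
    have : IsFiniteMeasure (volume.restrict (interior Ω)) := ⟨by simpa using hfin⟩
    refine Integrable.of_bound (C := M' * N) ?_ ?_
    · exact ((hφ.continuous_fderiv (by simp)).continuousOn.clm_apply hYc).aestronglyMeasurable hmeas
    · refine (ae_restrict_iff' hmeas).mpr (Eventually.of_forall fun y hy => ?_)
      exact (ContinuousLinearMap.le_opNorm _ _).trans (mul_le_mul (hM' y)
        (hN y (interior_subset hy)) (norm_nonneg _) ((norm_nonneg _).trans (hM' y)))
  -- test functions supported away from the edges and corners
  have hreg : ∀ φ : Eu n → ℝ, ContDiff ℝ 1 φ → HasCompactSupport φ →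
      Disjoint (tsupport φ) (singularSet Ω) → ∫ y in interior Ω, fderiv ℝ φ y (Y y) = 0 := by
    intro φ hφ hφc hdis
    choose! V hVo hpV hV using fun p (hp : p ∉ singularSet Ω) =>
      exists_nhds_integral_fderiv_eq_zero hK hY hdiv htan hp
    have hT : ∀ p ∈ tsupport φ, p ∉ singularSet Ω := fun p hp h =>
      Set.disjoint_left.mp hdis hp h
    obtain ⟨t, ht, hcov⟩ := hφc.isCompact.elim_nhds_subcover V fun p hp =>
      (hVo p (hT p hp)).mem_nhds (hpV p (hT p hp))
    obtain ⟨ρ, hρ⟩ := SmoothPartitionOfUnity.exists_isSubordinate 𝓘(ℝ, Eu n)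
      (isClosed_tsupport φ) (fun p : t => V p) (fun p => hVo p (hT p (ht p p.2))) (by
        intro x hx
        obtain ⟨p, hp, hxp⟩ := mem_iUnion₂.mp (hcov hx)
        exact mem_iUnion.mpr ⟨⟨p, hp⟩, hxp⟩)
    have hρd : ∀ i, ContDiff ℝ 1 fun y => ρ i y * φ y := fun i =>
      ((ρ i).contMDiff.contDiff.of_le (by simp)).mul hφ
    have hρc : ∀ i, HasCompactSupport fun y => ρ i y * φ y := fun i => hφc.mul_left
    have hsum : φ = fun y => ∑ i, ρ i y * φ y := by
      funext y
      rw [← Finset.sum_mul]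
      by_cases hy : y ∈ tsupport φ
      · have := ρ.sum_eq_one hy
        rw [finsum_eq_sum_of_fintype] at this
        rw [this, one_mul]
      · rw [image_eq_zero_of_notMem_tsupport hy, mul_zero]
    have hD : ∀ y, fderiv ℝ φ y (Y y) = ∑ i, fderiv ℝ (fun y => ρ i y * φ y) y (Y y) := by
      intro y
      conv_lhs => rw [hsum]
      rw [fderiv_fun_sum fun i _ => (hρd i).differentiable (by simp) y]
      simp
    simp only [hD]
    rw [integral_finsetSum _ fun i _ => hint _ (hρd i) (hρc i)]
    refine Finset.sum_eq_zero fun i _ => hV i (hT i (ht i i.2)) _ (hρd i) (hρc i) ?_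
    exact (tsupport_mul_subset_left (f := ρ i) (g := φ)).trans (hρ i)
  -- reduction to a compactly supported test function
  obtain ⟨R, hR⟩ := hK.isBounded.subset_ball (0 : Eu n)
  set R' := max R 1 with hR'
  have hR'0 : 0 < R' := lt_max_of_lt_right one_pos
  set φ : Eu n → ℝ := fun y => ballBump 0 R' y * ψ y with hφdef
  have hφ : ContDiff ℝ 1 φ := (contDiff_ballBump 0 R').mul hψ
  have hφc : HasCompactSupport φ := by
    refine HasCompactSupport.intro (isCompact_closedBall 0 (2 * R')) fun y hy => ?_
    simp only [hφdef, ballBump_eq_zero hR'0 fun h => hy (ball_subset_closedBall h), zero_mul]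
  have hφψ : ∀ y ∈ interior Ω, fderiv ℝ ψ y (Y y) = fderiv ℝ φ y (Y y) := by
    intro y hy
    have : φ =ᶠ[𝓝 y] ψ := by
      filter_upwards [isOpen_interior.mem_nhds hy] with z hz
      simp only [hφdef, ballBump_eq_one hR'0
        (ball_subset_ball (le_max_left _ _) (hR (interior_subset hz))), one_mul]
    rw [this.fderiv_eq]
  rw [setIntegral_congr_fun hmeas hφψ]
  obtain ⟨M, hM⟩ := hφc.exists_bound_of_continuous hφ.continuous
  obtain ⟨M', hM'⟩ := (hφc.fderiv ℝ).exists_bound_of_continuous (hφ.continuous_fderiv (by simp))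
  set A : ℝ := (|M| + |M'|) * |N| with hA
  have hsmall : ∀ δ : ℝ, 0 < δ → |∫ y in interior Ω, fderiv ℝ φ y (Y y)| ≤ A * δ := by
    intro δ hδ
    obtain ⟨η, hη, ⟨W, hWo, hSW, hW⟩, hηi, hηδ⟩ := exists_cutoff hSc hΩ.singular_null hδ
    have hηφ : ContDiff ℝ 1 fun y => η y * φ y := hη.mul hφ
    have hηφc : HasCompactSupport fun y => η y * φ y := hφc.mul_left
    have h0 := hreg _ hηφ hηφc (by
      rw [Set.disjoint_right]
      intro x hx hx'
      refine notMem_tsupport_iff_eventuallyEq.mpr ?_ hx'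
      filter_upwards [hWo.mem_nhds (hSW hx)] with z hz
      simp [hW z hz])
    have h1 : ∫ y in interior Ω, fderiv ℝ φ y (Y y)
        = ∫ y in interior Ω, (fderiv ℝ φ y (Y y) - fderiv ℝ (fun y => η y * φ y) y (Y y)) := by
      rw [integral_sub (hint _ hφ hφc) (hint _ hηφ hηφc), h0, sub_zero]
    rw [h1, ← Real.norm_eq_abs]
    calc _ ≤ ∫ y in interior Ω, A * (‖fderiv ℝ η y‖ + |1 - η y|) := by
          refine norm_integral_le_of_norm_le (hηi.const_mul A).integrableOn ?_
          refine (ae_restrict_iff' hmeas).mpr (Eventually.of_forall fun y hy => ?_)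
          rw [fderiv_fun_mul (hη.differentiable (by simp) y) (hφ.differentiable (by simp) y)]
          have h2 : fderiv ℝ φ y (Y y) - (η y • fderiv ℝ φ y + φ y • fderiv ℝ η y) (Y y)
              = (1 - η y) * fderiv ℝ φ y (Y y) - φ y * fderiv ℝ η y (Y y) := by
            simp; ring
          have h3 : ‖Y y‖ ≤ |N| := (hN y (interior_subset hy)).trans (le_abs_self N)
          have h4 : ‖fderiv ℝ φ y (Y y)‖ ≤ |M'| * |N| :=
            (ContinuousLinearMap.le_opNorm _ _).trans (mul_le_mul ((hM' y).trans (le_abs_self _)) h3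
              (norm_nonneg _) (abs_nonneg _))
          have h5 : ‖fderiv ℝ η y (Y y)‖ ≤ ‖fderiv ℝ η y‖ * |N| :=
            (ContinuousLinearMap.le_opNorm _ _).trans (by gcongr)
          have h6 : ‖φ y‖ ≤ |M| := (hM y).trans (le_abs_self M)
          rw [h2]
          refine (norm_sub_le _ _).trans ?_
          rw [norm_mul, norm_mul, Real.norm_eq_abs (1 - η y)]
          calc |1 - η y| * ‖fderiv ℝ φ y (Y y)‖ + ‖φ y‖ * ‖fderiv ℝ η y (Y y)‖
              ≤ |1 - η y| * (|M'| * |N|) + |M| * (‖fderiv ℝ η y‖ * |N|) := by gcongr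
            _ ≤ A * (‖fderiv ℝ η y‖ + |1 - η y|) := by
              rw [hA]
              have i1 : 0 ≤ |1 - η y| * (|M| * |N|) := by positivity
              have i2 : 0 ≤ ‖fderiv ℝ η y‖ * (|M'| * |N|) := by positivity
              nlinarith
      _ ≤ ∫ y, A * (‖fderiv ℝ η y‖ + |1 - η y|) :=
          setIntegral_le_integral (hηi.const_mul A) (Eventually.of_forall fun y => by
            simp only [Pi.zero_apply]; positivity)
      _ ≤ A * δ := by
          rw [integral_const_mul]
          gcongr
  have hlim : Tendsto (fun δ : ℝ => A * δ) (𝓝[>] 0) (𝓝 0) := by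
    have : Tendsto (fun δ : ℝ => A * δ) (𝓝 0) (𝓝 (A * 0)) := tendsto_id.const_mul A
    rw [mul_zero] at this
    exact this.mono_left nhdsWithin_le_nhds
  have := ge_of_tendsto hlim (by filter_upwards [self_mem_nhdsWithin] with δ hδ using hsmall δ hδ)
  exact abs_nonpos_iff.mp this

/-! ### Weakly singular integrals -/

theorem integrableOn_norm_sub_div [NeZero n] {s : Set (Eu n)} (hs : Bornology.IsBounded s) (x : Eu n) :
    IntegrableOn (fun y => ‖x - y‖ / ‖x - y‖ ^ n) s := by
  obtain ⟨R, hR⟩ := hs.subset_ball x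
  have h1 : Integrable ((ball (0 : Eu n) R).indicator fun w => ‖w‖ / ‖w‖ ^ n) := by
    rw [integrable_indicator_iff isOpen_ball.measurableSet]
    exact integrableOn_norm_div_norm_pow R
  have h2 := (h1.comp_sub_left x).integrableOn (s := ball x R)
  refine (h2.congr_fun ?_ isOpen_ball.measurableSet).mono_set hR
  intro y hy
  have : x - y ∈ ball (0 : Eu n) R := by
    rw [mem_ball_zero_iff, ← dist_eq_norm, dist_comm]; exact hy
  simp only [indicator_of_mem this]

theorem setIntegral_sub_left_le {H : Eu n → ℝ} (hH : ∀ w, 0 ≤ H w) {R R' : ℝ} {s : Set (Eu n)}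
    (hs : MeasurableSet s) (hsR : s ⊆ ball 0 R') {x : Eu n} (hx : x ∈ ball (0 : Eu n) R)
    (hi : IntegrableOn H (ball 0 (R + R'))) :
    IntegrableOn (fun y => H (x - y)) s ∧
      ∫ y in s, H (x - y) ≤ ∫ w in ball 0 (R + R'), H w := by
  have h1 : Integrable ((ball (0 : Eu n) (R + R')).indicator H) := by
    rwa [integrable_indicator_iff isOpen_ball.measurableSet]
  have h2 := h1.comp_sub_left x
  have h3 : ∀ y ∈ s, H (x - y) = (ball (0 : Eu n) (R + R')).indicator H (x - y) := by
    intro y hy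
    have : x - y ∈ ball (0 : Eu n) (R + R') := by
      rw [mem_ball_zero_iff] at hx ⊢
      have h4 := mem_ball_zero_iff.mp (hsR hy)
      exact (norm_sub_le _ _).trans_lt (by linarith)
    rw [indicator_of_mem this]
  refine ⟨(h2.integrableOn (s := s)).congr_fun (fun y hy => (h3 y hy).symm) hs, ?_⟩
  rw [setIntegral_congr_fun hs h3, ← integral_indicator isOpen_ball.measurableSet,
    ← integral_sub_left_eq_self _ volume x]
  exact setIntegral_le_integral h2 (Eventually.of_forall fun y => indicator_nonneg (fun w _ => hH w) _)

/-- The vector potential `∫ a(y) (x - y) / ‖x - y‖ⁿ dy` of a density on `Ω`, regularised. -/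
def potential (Ω : Set (Eu n)) (a : Eu n → ℝ) (ε : ℝ) (x : Eu n) : Eu n :=
  ∫ y in interior Ω, a y • newtonField ε (x - y)

/-- The differential of the regularised vector potential. -/
def potentialDeriv (Ω : Set (Eu n)) (a : Eu n → ℝ) (ε : ℝ) (x : Eu n) : Eu n →L[ℝ] Eu n :=
  ∫ y in interior Ω, a y • newtonFieldDeriv ε (x - y)

/-- The derivative of the potential in the direction of a tangent field `X`, after an integration by
parts; `b` is the divergence of `a X`. The kernel of the first term is only weakly singular. -/
def tangentialPotential (Ω : Set (Eu n)) (a b : Eu n → ℝ) (X : Eu n → Eu n) (ε : ℝ) (x : Eu n) :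
    Eu n :=
  ∫ y in interior Ω, (a y • newtonFieldDeriv ε (x - y) (X x - X y) + b y • newtonField ε (x - y))

theorem norm_tangential_integrand_le {a b A B L : ℝ} {X : Eu n → Eu n} {x y : Eu n}
    (ha : |a| ≤ A) (hb : |b| ≤ B) (hX : ‖X x - X y‖ ≤ L * ‖x - y‖) (ε : ℝ) :
    ‖a • newtonFieldDeriv ε (x - y) (X x - X y) + b • newtonField ε (x - y)‖
      ≤ ((n + 1) * (A * L) + B) * (‖x - y‖ / ‖x - y‖ ^ n) := by
  have hA0 := (abs_nonneg a).trans ha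
  have hB0 := (abs_nonneg b).trans hb
  rcases eq_or_ne (x - y) 0 with h | h
  · have : X x - X y = 0 := by
      rw [h, norm_zero, mul_zero] at hX
      exact norm_le_zero_iff.mp hX
    rw [this, h]
    simp [newtonField]
  · refine (norm_add_le _ _).trans ?_
    rw [norm_smul, norm_smul, Real.norm_eq_abs, Real.norm_eq_abs]
    have h1 := norm_newtonFieldDeriv_apply_le' (ε := ε) h (X x - X y)
    have h2 := norm_newtonField_le ε (x - y)
    calc |a| * ‖newtonFieldDeriv ε (x - y) (X x - X y)‖ + |b| * ‖newtonField ε (x - y)‖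
        ≤ A * ((n + 1) * (‖x - y‖ ^ n)⁻¹ * (L * ‖x - y‖)) + B * (‖x - y‖ / ‖x - y‖ ^ n) := by
          gcongr
          exact h1.trans (by gcongr)
      _ = _ := by ring

section
variable {Ω : Set (Eu n)} {a b : Eu n → ℝ} {A B : ℝ}

theorem aestronglyMeasurable_tangential (hac : ContinuousOn a (interior Ω))
    (hbc : ContinuousOn b (interior Ω)) {X : Eu n → Eu n} (hXc : Continuous X) (ε : ℝ) (x : Eu n) :
    AEStronglyMeasurable (fun y => a y • newtonFieldDeriv ε (x - y) (X x - X y)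
      + b y • newtonField ε (x - y)) (volume.restrict (interior Ω)) := by
  have hm : MeasurableSet (interior Ω) := isOpen_interior.measurableSet
  have h1 : Measurable fun y : Eu n => x - y := measurable_const.sub measurable_id
  refine ((hac.aestronglyMeasurable hm).smul ?_).add ((hbc.aestronglyMeasurable hm).smul ?_)
  · exact ((measurable_newtonFieldDeriv_apply ε).comp
      (h1.prodMk (measurable_const.sub hXc.measurable))).aestronglyMeasurable
  · exact ((measurable_newtonField ε).comp h1).aestronglyMeasurable

theorem integrableOn_tangential [NeZero n] (hΩ : IsCompact Ω) (hac : ContinuousOn a (interior Ω))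
    (hA : ∀ y ∈ interior Ω, |a y| ≤ A) (hbc : ContinuousOn b (interior Ω))
    (hB : ∀ y ∈ interior Ω, |b y| ≤ B) {X : Eu n → Eu n} {L : ℝ} (hXc : Continuous X)
    (hX : ∀ x y, ‖X x - X y‖ ≤ L * ‖x - y‖) (ε : ℝ) (x : Eu n) :
    IntegrableOn (fun y => a y • newtonFieldDeriv ε (x - y) (X x - X y)
      + b y • newtonField ε (x - y)) (interior Ω) := by
  refine Integrable.mono' (((integrableOn_norm_sub_div hΩ.isBounded x).mono_set
    interior_subset).const_mul ((n + 1) * (A * L) + B))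
    (aestronglyMeasurable_tangential hac hbc hXc ε x) ?_
  exact (ae_restrict_iff' isOpen_interior.measurableSet).mpr (Eventually.of_forall fun y hy =>
    norm_tangential_integrand_le (hA y hy) (hB y hy) (hX x y) ε)

theorem exists_bound_tangentialPotential [NeZero n] (hΩ : IsCompact Ω)
    (hA : ∀ y ∈ interior Ω, |a y| ≤ A) (hB : ∀ y ∈ interior Ω, |b y| ≤ B) {X : Eu n → Eu n} {L : ℝ}
    (hX : ∀ x y, ‖X x - X y‖ ≤ L * ‖x - y‖) (R : ℝ) :
    ∃ C, ∀ ε, ∀ x ∈ ball (0 : Eu n) R, ‖tangentialPotential Ω a b X ε x‖ ≤ C := by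
  obtain ⟨R', hR'⟩ := hΩ.isBounded.subset_ball (0 : Eu n)
  refine ⟨|(n + 1) * (A * L) + B| * ∫ w in ball (0 : Eu n) (R + R'), ‖w‖ / ‖w‖ ^ n,
    fun ε x hx => ?_⟩
  obtain ⟨h1, h2⟩ := setIntegral_sub_left_le (H := fun w : Eu n => ‖w‖ / ‖w‖ ^ n)
    (fun w => by positivity) isOpen_interior.measurableSet (interior_subset.trans hR') hx
    (integrableOn_norm_div_norm_pow _)
  calc ‖tangentialPotential Ω a b X ε x‖
      ≤ ∫ y in interior Ω, |(n + 1) * (A * L) + B| * (‖x - y‖ / ‖x - y‖ ^ n) := by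
        refine norm_integral_le_of_norm_le (h1.const_mul _) ?_
        refine (ae_restrict_iff' isOpen_interior.measurableSet).mpr
          (Eventually.of_forall fun y hy => ?_)
        refine (norm_tangential_integrand_le (hA y hy) (hB y hy) (hX x y) ε).trans ?_
        gcongr
        exact le_abs_self _
    _ ≤ _ := by
        rw [integral_const_mul]
        gcongr

/-- The error is dominated by a translate of a fixed kernel whose integral tends to zero, which makes
the convergence locally uniform up to the boundary. -/
theorem tendstoUniformlyOn_tangentialPotential [NeZero n] (hΩ : IsCompact Ω)
    (hac : ContinuousOn a (interior Ω))
    (hA : ∀ y ∈ interior Ω, |a y| ≤ A) (hbc : ContinuousOn b (interior Ω))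
    (hB : ∀ y ∈ interior Ω, |b y| ≤ B) {X : Eu n → Eu n} {L : ℝ} (hL0 : 0 ≤ L) (hXc : Continuous X)
    (hX : ∀ x y, ‖X x - X y‖ ≤ L * ‖x - y‖) (R : ℝ) :
    TendstoUniformlyOn (tangentialPotential Ω a b X) (tangentialPotential Ω a b X 0) (𝓝[>] 0)
      (ball 0 R) := by
  obtain ⟨R', hR'⟩ := hΩ.isBounded.subset_ball (0 : Eu n)
  set H : ℝ → Eu n → ℝ := fun ε w => ‖newtonField ε w - newtonField 0 w‖
      + ‖w‖ * ‖newtonFieldDeriv ε w - newtonFieldDeriv 0 w‖ with hH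
  have hint : ∀ ε, IntegrableOn (H ε) (ball 0 (R + R')) := fun ε => integrableOn_newtonField_sub ε _
  have hlim := (tendsto_integral_newtonField_sub (n := n) (R + R')).const_mul |A * L + B|
  rw [mul_zero] at hlim
  rw [Metric.tendstoUniformlyOn_iff]
  intro η hη
  filter_upwards [hlim.eventually_lt_const hη] with ε hε x hx
  refine lt_of_le_of_lt ?_ hε
  obtain ⟨h1, h2⟩ := setIntegral_sub_left_le (H := H ε) (fun w => by positivity)
    isOpen_interior.measurableSet (interior_subset.trans hR') hx (hint ε)
  rw [dist_comm, dist_eq_norm, tangentialPotential, tangentialPotential,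
    ← integral_sub (integrableOn_tangential hΩ hac hA hbc hB hXc hX ε x)
      (integrableOn_tangential hΩ hac hA hbc hB hXc hX 0 x)]
  calc _ ≤ ∫ y in interior Ω, |A * L + B| * H ε (x - y) := by
        refine norm_integral_le_of_norm_le (h1.const_mul _) ?_
        refine (ae_restrict_iff' isOpen_interior.measurableSet).mpr
          (Eventually.of_forall fun y hy => ?_)
        have e1 : a y • newtonFieldDeriv ε (x - y) (X x - X y) + b y • newtonField ε (x - y)
            - (a y • newtonFieldDeriv 0 (x - y) (X x - X y) + b y • newtonField 0 (x - y))
            = a y • (newtonFieldDeriv ε (x - y) - newtonFieldDeriv 0 (x - y)) (X x - X y)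
              + b y • (newtonField ε (x - y) - newtonField 0 (x - y)) := by
          simp only [_root_.sub_apply, smul_sub]; abel
        rw [e1]
        refine (norm_add_le _ _).trans ?_
        rw [norm_smul, norm_smul, Real.norm_eq_abs, Real.norm_eq_abs]
        have hA0 := (abs_nonneg _).trans (hA y hy)
        have hB0 := (abs_nonneg _).trans (hB y hy)
        calc |a y| * ‖(newtonFieldDeriv ε (x - y) - newtonFieldDeriv 0 (x - y)) (X x - X y)‖
              + |b y| * ‖newtonField ε (x - y) - newtonField 0 (x - y)‖
            ≤ A * (‖newtonFieldDeriv ε (x - y) - newtonFieldDeriv 0 (x - y)‖ * (L * ‖x - y‖))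
              + B * ‖newtonField ε (x - y) - newtonField 0 (x - y)‖ := by
              gcongr
              · exact hA y hy
              · exact (ContinuousLinearMap.le_opNorm _ _).trans (by gcongr; exact hX x y)
              · exact hB y hy
          _ ≤ (A * L + B) * H ε (x - y) := by
              simp only [hH]
              have i1 : 0 ≤ A * L * ‖newtonField ε (x - y) - newtonField 0 (x - y)‖ := by positivity
              have i2 : 0 ≤ B * (‖x - y‖ *
                ‖newtonFieldDeriv ε (x - y) - newtonFieldDeriv 0 (x - y)‖) := by positivity
              nlinarith
          _ ≤ |A * L + B| * H ε (x - y) := by gcongr; exact le_abs_self _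
    _ ≤ _ := by
        rw [integral_const_mul]
        gcongr

theorem integrableOn_potential [NeZero n] (hΩ : IsCompact Ω) (hac : ContinuousOn a (interior Ω))
    (hA : ∀ y ∈ interior Ω, |a y| ≤ A) (ε : ℝ) (x : Eu n) :
    IntegrableOn (fun y => a y • newtonField ε (x - y)) (interior Ω) := by
  have := integrableOn_tangential (a := 0) (A := 0) (X := 0) (L := 0) hΩ continuousOn_const
    (by simp) hac hA continuous_const (by simp) ε x
  simpa using this

theorem tendsto_potential [NeZero n] (hΩ : IsCompact Ω) (hac : ContinuousOn a (interior Ω))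
    (hA : ∀ y ∈ interior Ω, |a y| ≤ A) (x : Eu n) :
    Tendsto (fun ε => potential Ω a ε x) (𝓝[>] 0) (𝓝 (potential Ω a 0 x)) := by
  have h := tendstoUniformlyOn_tangentialPotential (a := 0) (A := 0) (X := 0) (L := 0) hΩ
    continuousOn_const (by simp) hac hA le_rfl continuous_const (by simp) (‖x‖ + 1)
  have h2 := h.tendsto_at (x := x) (by simp)
  simpa [tangentialPotential, potential] using h2

theorem integrableOn_potentialDeriv (hΩ : IsCompact Ω) (hac : ContinuousOn a (interior Ω))
    (hA : ∀ y ∈ interior Ω, |a y| ≤ A) {ε : ℝ} (hε : 0 < ε) (x : Eu n) :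
    IntegrableOn (fun y => a y • newtonFieldDeriv ε (x - y)) (interior Ω) := by
  have hm : MeasurableSet (interior Ω) := isOpen_interior.measurableSet
  have : IsFiniteMeasure (volume.restrict (interior Ω)) :=
    ⟨by simpa using (measure_mono interior_subset).trans_lt hΩ.measure_lt_top⟩
  refine Integrable.of_bound (C := A * ((n + 1) * (ε ^ n)⁻¹)) ?_ ?_
  · exact ((hac.aestronglyMeasurable hm).smul
      ((continuous_newtonFieldDeriv hε).comp (continuous_const.sub continuous_id)).aestronglyMeasurable)
  · refine (ae_restrict_iff' hm).mpr (Eventually.of_forall fun y hy => ?_)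
    rw [norm_smul]
    exact mul_le_mul (hA y hy) (norm_newtonFieldDeriv_le hε _) (norm_nonneg _)
      ((abs_nonneg _).trans (hA y hy))

theorem hasFDerivAt_potential [NeZero n] (hΩ : IsCompact Ω) (hac : ContinuousOn a (interior Ω))
    (hA : ∀ y ∈ interior Ω, |a y| ≤ A) {ε : ℝ} (hε : 0 < ε) (x : Eu n) :
    HasFDerivAt (potential Ω a ε) (potentialDeriv Ω a ε x) x := by
  have hm : MeasurableSet (interior Ω) := isOpen_interior.measurableSet
  have : IsFiniteMeasure (volume.restrict (interior Ω)) :=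
    ⟨by simpa using (measure_mono interior_subset).trans_lt hΩ.measure_lt_top⟩
  refine hasFDerivAt_integral_of_dominated_of_fderiv_le (s := univ)
    (bound := fun _ => A * ((n + 1) * (ε ^ n)⁻¹)) (F' := fun x y => a y • newtonFieldDeriv ε (x - y))
    univ_mem ?_ (integrableOn_potential hΩ hac hA ε x)
    (integrableOn_potentialDeriv hΩ hac hA hε x).aestronglyMeasurable ?_ (integrable_const _) ?_
  · exact Eventually.of_forall fun x => (integrableOn_potential hΩ hac hA ε x).aestronglyMeasurable
  · refine (ae_restrict_iff' hm).mpr (Eventually.of_forall fun y hy x _ => ?_)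
    rw [norm_smul]
    exact mul_le_mul (hA y hy) (norm_newtonFieldDeriv_le hε _) (norm_nonneg _)
      ((abs_nonneg _).trans (hA y hy))
  · refine Eventually.of_forall fun y x _ => ?_
    have h1 : HasFDerivAt (fun x : Eu n => newtonField ε (x - y)) (newtonFieldDeriv ε (x - y)) x := by
      exact ((hasFDerivAt_newtonField (w := x - y) (Or.inl hε)).comp x
        ((hasFDerivAt_id x).sub_const y)).congr_fderiv (ContinuousLinearMap.comp_id _)
    exact h1.const_smul (a y)

theorem continuous_potentialDeriv (hΩ : IsCompact Ω) (hac : ContinuousOn a (interior Ω))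
    (hA : ∀ y ∈ interior Ω, |a y| ≤ A) {ε : ℝ} (hε : 0 < ε) :
    Continuous (potentialDeriv Ω a ε) := by
  have hm : MeasurableSet (interior Ω) := isOpen_interior.measurableSet
  have : IsFiniteMeasure (volume.restrict (interior Ω)) :=
    ⟨by simpa using (measure_mono interior_subset).trans_lt hΩ.measure_lt_top⟩
  refine continuous_of_dominated (bound := fun _ => A * ((n + 1) * (ε ^ n)⁻¹))
    (fun x => (integrableOn_potentialDeriv hΩ hac hA hε x).aestronglyMeasurable) ?_
    (integrable_const _) ?_
  · intro x
    refine (ae_restrict_iff' hm).mpr (Eventually.of_forall fun y hy => ?_)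
    rw [norm_smul]
    exact mul_le_mul (hA y hy) (norm_newtonFieldDeriv_le hε _) (norm_nonneg _)
      ((abs_nonneg _).trans (hA y hy))
  · exact Eventually.of_forall fun y => ((continuous_newtonFieldDeriv hε).comp
      (continuous_id.sub continuous_const)).const_smul (a y)

theorem potentialDeriv_apply (hΩ : IsCompact Ω) (hac : ContinuousOn a (interior Ω))
    (hA : ∀ y ∈ interior Ω, |a y| ≤ A) {ε : ℝ} (hε : 0 < ε) (x v : Eu n) :
    potentialDeriv Ω a ε x v = ∫ y in interior Ω, a y • newtonFieldDeriv ε (x - y) v := by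
  rw [potentialDeriv, ContinuousLinearMap.integral_apply (integrableOn_potentialDeriv hΩ hac hA hε x)]
  rfl

theorem integrableOn_potentialDeriv_apply (hΩ : IsCompact Ω) (hac : ContinuousOn a (interior Ω))
    (hA : ∀ y ∈ interior Ω, |a y| ≤ A) {ε : ℝ} (hε : 0 < ε) (x v : Eu n) :
    IntegrableOn (fun y => a y • newtonFieldDeriv ε (x - y) v) (interior Ω) :=
  (integrableOn_potentialDeriv hΩ hac hA hε x).apply_continuousLinearMap v

theorem potentialDeriv_apply_apply (hΩ : IsCompact Ω) (hac : ContinuousOn a (interior Ω))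
    (hA : ∀ y ∈ interior Ω, |a y| ≤ A) {ε : ℝ} (hε : 0 < ε) (x v : Eu n) (i : Fin n) :
    potentialDeriv Ω a ε x v i = ∫ y in interior Ω, a y * newtonFieldDeriv ε (x - y) v i := by
  rw [potentialDeriv_apply hΩ hac hA hε]
  exact ((EuclideanSpace.proj i : Eu n →L[ℝ] ℝ).integral_comp_comm
    (integrableOn_potentialDeriv_apply hΩ hac hA hε x v)).symm

theorem integrableOn_potentialDeriv_apply_apply (hΩ : IsCompact Ω) (hac : ContinuousOn a (interior Ω))
    (hA : ∀ y ∈ interior Ω, |a y| ≤ A) {ε : ℝ} (hε : 0 < ε) (x v : Eu n) (i : Fin n) :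
    IntegrableOn (fun y => a y * newtonFieldDeriv ε (x - y) v i) (interior Ω) :=
  (EuclideanSpace.proj i : Eu n →L[ℝ] ℝ).integrable_comp
    (integrableOn_potentialDeriv_apply hΩ hac hA hε x v)

theorem inner_potentialDeriv_comm (hΩ : IsCompact Ω) (hac : ContinuousOn a (interior Ω))
    (hA : ∀ y ∈ interior Ω, |a y| ≤ A) {ε : ℝ} (hε : 0 < ε) (x : Eu n) (i j : Fin n) :
    potentialDeriv Ω a ε x (EuclideanSpace.single i 1) j
      = potentialDeriv Ω a ε x (EuclideanSpace.single j 1) i := by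
  rw [potentialDeriv_apply_apply hΩ hac hA hε, potentialDeriv_apply_apply hΩ hac hA hε]
  congr 1
  funext y
  have := inner_newtonFieldDeriv_comm ε (x - y) (EuclideanSpace.single i 1)
    (EuclideanSpace.single j (1 : ℝ))
  simp only [EuclideanSpace.inner_single_right, conj_trivial, one_mul] at this
  rw [this]

theorem sum_potentialDeriv (hΩ : IsCompact Ω) (hac : ContinuousOn a (interior Ω))
    (hA : ∀ y ∈ interior Ω, |a y| ≤ A) {ε : ℝ} (hε : 0 < ε) (x : Eu n) :
    ∑ i, potentialDeriv Ω a ε x (EuclideanSpace.single i 1) i = ∫ y in interior Ω,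
      a y * ∑ i, newtonFieldDeriv ε (x - y) (EuclideanSpace.single i 1) i := by
  simp only [Finset.mul_sum]
  rw [integral_finsetSum _ fun i _ => integrableOn_potentialDeriv_apply_apply hΩ hac hA hε x _ i]
  exact Finset.sum_congr rfl fun i _ => potentialDeriv_apply_apply hΩ hac hA hε x _ i

theorem abs_sum_potentialDeriv_le [NeZero n] (hΩ : IsCompact Ω) (hac : ContinuousOn a (interior Ω))
    (hA : ∀ y ∈ interior Ω, |a y| ≤ A) (hA0 : 0 ≤ A) {ε : ℝ} (hε : 0 < ε) (x : Eu n) :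
    |∑ i, potentialDeriv Ω a ε x (EuclideanSpace.single i 1) i| ≤ A * sphereArea n := by
  rw [sum_potentialDeriv hΩ hac hA hε]
  obtain ⟨h1, h2⟩ := integrable_sum_newtonFieldDeriv hε x
  have hnn : ∀ y, 0 ≤ ∑ i, newtonFieldDeriv ε (x - y) (EuclideanSpace.single i 1) i := fun y => by
    rw [sum_newtonFieldDeriv (Or.inl hε)]
    have := regNorm_pos (w := x - y) (Or.inl hε)
    positivity
  rw [← h2, ← integral_const_mul, ← Real.norm_eq_abs]
  refine (norm_integral_le_of_norm_le (h1.const_mul A).integrableOn ?_).trans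
    (setIntegral_le_integral (h1.const_mul A)
      (Eventually.of_forall fun y => mul_nonneg hA0 (hnn y)))
  refine (ae_restrict_iff' isOpen_interior.measurableSet).mpr (Eventually.of_forall fun y hy => ?_)
  rw [norm_mul, Real.norm_of_nonneg (hnn y)]
  exact mul_le_mul_of_nonneg_right (hA y hy) (hnn y)

theorem tendsto_sum_potentialDeriv [NeZero n] (hΩ : IsCompact Ω) (hac : ContinuousOn a (interior Ω))
    (hA : ∀ y ∈ interior Ω, |a y| ≤ A) {x : Eu n} (hx : x ∈ interior Ω) :
    Tendsto (fun ε => ∑ i, potentialDeriv Ω a ε x (EuclideanSpace.single i 1) i) (𝓝[>] 0)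
      (𝓝 (sphereArea n * a x)) := by
  have hm : MeasurableSet (interior Ω) := isOpen_interior.measurableSet
  have hg : Integrable ((interior Ω).indicator a) := by
    rw [integrable_indicator_iff hm]
    have : IsFiniteMeasure (volume.restrict (interior Ω)) :=
      ⟨by simpa using (measure_mono interior_subset).trans_lt hΩ.measure_lt_top⟩
    exact Integrable.of_bound (hac.aestronglyMeasurable hm) A
      ((ae_restrict_iff' hm).mpr (Eventually.of_forall hA))
  have heq : (interior Ω).indicator a =ᶠ[𝓝 x] a := by
    filter_upwards [isOpen_interior.mem_nhds hx] with y hy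
    rw [indicator_of_mem hy]
  have hc : ContinuousAt ((interior Ω).indicator a) x :=
    (hac.continuousAt (isOpen_interior.mem_nhds hx)).congr heq.symm
  have h := tendsto_integral_sum_newtonFieldDeriv hg hc
  rw [indicator_of_mem hx] at h
  refine h.congr' ?_
  filter_upwards [self_mem_nhdsWithin] with ε hε
  rw [sum_potentialDeriv hΩ hac hA hε, ← integral_indicator hm]
  congr 1
  funext y
  by_cases hy : y ∈ interior Ω
  · simp [hy]
  · simp [hy]

end

/-! ### Tangential derivatives of the potential -/

theorem hasFDerivAt_newtonField_sub_apply {ε : ℝ} (hε : 0 < ε) (x y : Eu n) (i : Fin n) :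
    HasFDerivAt (fun y => newtonField ε (x - y) i)
      (-((EuclideanSpace.proj i : Eu n →L[ℝ] ℝ).comp (newtonFieldDeriv ε (x - y)))) y := by
  have h1 := (hasFDerivAt_newtonField (w := x - y) (Or.inl hε)).comp y
    ((hasFDerivAt_id y).const_sub x)
  refine ((EuclideanSpace.proj i : Eu n →L[ℝ] ℝ).hasFDerivAt.comp y h1).congr_fderiv ?_
  ext v
  simp

/-- Integration by parts turns the derivative of the potential along a field tangent to the
boundary into a weakly singular integral, uniformly in the regularisation. -/
theorem potentialDeriv_apply_eq_tangentialPotential [NeZero n] {Ω U T : Set (Eu n)} {f a : Eu n → ℝ}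
    {X : Eu n → Eu n} {A B : ℝ} (hΩ : IsCompact Ω) (hc : IsRegularChart Ω U f) (hT : IsCompact T)
    (hTU : T ⊆ U) (hXT : ∀ y ∉ T, X y = 0) (hX : ContDiff ℝ 1 X)
    (htan : ∀ y ∈ U, fderiv ℝ f y (X y) = 0) (ha : ContDiffOn ℝ 1 a (interior Ω))
    (hA : ∀ y ∈ interior Ω, |a y| ≤ A)
    (hB : ∀ y ∈ interior Ω, |divergence (fun y => a y • X y) y| ≤ B) {ε L : ℝ} (hε : 0 < ε)
    (hL : ∀ x y, ‖X x - X y‖ ≤ L * ‖x - y‖)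
    (hbc : ContinuousOn (divergence fun y => a y • X y) (interior Ω)) (x : Eu n) :
    potentialDeriv Ω a ε x (X x)
      = tangentialPotential Ω a (divergence fun y => a y • X y) X ε x := by
  set b := divergence fun y => a y • X y with hb
  have hac := ha.continuousOn
  ext i
  have hY := (contDiff_newtonField (n := n) hε)
  have hK : ContDiff ℝ 1 fun y => newtonField ε (x - y) i :=
    (EuclideanSpace.proj i : Eu n →L[ℝ] ℝ).contDiff.comp (hY.comp (contDiff_const.sub contDiff_id))
  have haX : ContDiffOn ℝ 1 (fun y => a y • X y) (interior Ω) := ha.smul hX.contDiffOn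
  have hdiv : ∀ y ∈ interior Ω, divergence (fun y => newtonField ε (x - y) i • (a y • X y)) y
      = -(a y * newtonFieldDeriv ε (x - y) (X y) i) + b y * newtonField ε (x - y) i := by
    intro y hy
    have h1 := hasFDerivAt_newtonField_sub_apply hε x y i
    rw [divergence_smul h1.differentiableAt
      ((haX.contDiffAt (isOpen_interior.mem_nhds hy)).differentiableAt (by simp)), h1.fderiv]
    simp [hb, mul_comm]
  obtain ⟨CX, hCX⟩ := hT.exists_bound_of_continuousOn hX.continuous.continuousOn
  have hCX' : ∀ y, ‖X y‖ ≤ max CX 0 := by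
    intro y
    by_cases hy : y ∈ T
    · exact (hCX y hy).trans (le_max_left _ _)
    · rw [hXT y hy, norm_zero]; exact le_max_right _ _
  obtain ⟨CK, hCK⟩ := hΩ.exists_bound_of_continuousOn hK.continuous.continuousOn
  have h0 : ∫ y in interior Ω, divergence (fun y => newtonField ε (x - y) i • (a y • X y)) y = 0 := by
    refine integral_divergence_interior_eq_zero (C := 0)
      (B := A * ((n + 1) * (ε ^ n)⁻¹ * max CX 0) + B * CK) hc hT hTU ?_ (hK.contDiffOn.smul haX) ?_ ?_
    · intro y hy
      simp [hXT y hy]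
    · intro y hy
      rw [hdiv y hy]
      have hA0 := (abs_nonneg _).trans (hA y hy)
      have hB0 := (abs_nonneg _).trans (hB y hy)
      refine (abs_add_le _ _).trans ?_
      rw [abs_neg, abs_mul, abs_mul]
      have h2 : |newtonFieldDeriv ε (x - y) (X y) i| ≤ (n + 1) * (ε ^ n)⁻¹ * max CX 0 := by
        refine (PiLp.norm_apply_le (newtonFieldDeriv ε (x - y) (X y)) i).trans
          ((ContinuousLinearMap.le_opNorm _ _).trans ?_)
        gcongr
        · exact norm_newtonFieldDeriv_le hε _
        · exact hCX' y
      gcongr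
      · exact hA y hy
      · exact hB y hy
      · exact hCK y (interior_subset hy)
    · intro y hy
      simp [htan y hy.2]
  have h3 := (EuclideanSpace.proj i : Eu n →L[ℝ] ℝ).integral_comp_comm
    (integrableOn_tangential hΩ hac hA hbc hB hX.continuous hL ε x)
  have h3i := (EuclideanSpace.proj i : Eu n →L[ℝ] ℝ).integrable_comp
    (integrableOn_tangential hΩ hac hA hbc hB hX.continuous hL ε x)
  have h4 := integrableOn_potentialDeriv_apply_apply hΩ hac hA hε x (X x) i
  change _ = (EuclideanSpace.proj i : Eu n →L[ℝ] ℝ) _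
  rw [potentialDeriv_apply_apply hΩ hac hA hε, tangentialPotential, ← h3, ← sub_eq_zero,
    ← integral_sub h4 h3i, ← neg_eq_zero, ← integral_neg, ← h0]
  refine setIntegral_congr_fun isOpen_interior.measurableSet fun y hy => ?_
  simp only [hdiv y hy]
  simp
  ring

/-! ### Recovering a symmetric matrix from its tangential part and its trace -/

/-- The endomorphism with given values `G j k` on the vectors `ν_k e_j - ν_j e_k` and given trace
`t`, if it is symmetric. -/
def recoverMap (q : Eu n × (Fin n → Fin n → Eu n) × ℝ) : Eu n →L[ℝ] Eu n :=
  ∑ j, ∑ i, ((∑ k, q.1 k ^ 2)⁻¹ * (∑ k, q.1 k * q.2.1 j k i + q.1 j * ∑ k, q.2.1 i k k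
    + q.1 i * q.1 j * q.2.2)) •
      (EuclideanSpace.proj j : Eu n →L[ℝ] ℝ).smulRight (EuclideanSpace.single i (1 : ℝ))

theorem continuousAt_recoverMap {q : Eu n × (Fin n → Fin n → Eu n) × ℝ} (hq : q.1 ≠ 0) :
    ContinuousAt recoverMap q := by
  have h : ∑ k, q.1 k ^ 2 ≠ 0 := by
    rw [← EuclideanSpace.real_norm_sq_eq]
    exact pow_ne_zero _ (norm_ne_zero_iff.mpr hq)
  unfold recoverMap
  fun_prop (disch := exact h)

/-- A symmetric endomorphism is determined by its values on the hyperplane orthogonal to `ν`, which is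
spanned by the vectors `ν_k e_j - ν_j e_k`, and its trace. -/
theorem recoverMap_eq {M : Eu n →L[ℝ] Eu n} (hM : ∀ i j, M (EuclideanSpace.single i 1) j
    = M (EuclideanSpace.single j 1) i) {ν : Eu n} (hν : ν ≠ 0) :
    recoverMap (ν, (fun j k => M (ν k • EuclideanSpace.single j 1 - ν j • EuclideanSpace.single k 1)),
      ∑ k, M (EuclideanSpace.single k 1) k) = M := by
  have h : ∑ k, ν k ^ 2 ≠ 0 := by
    rw [← EuclideanSpace.real_norm_sq_eq]
    exact pow_ne_zero _ (norm_ne_zero_iff.mpr hν)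
  have key : ∀ i j, (∑ k, ν k ^ 2)⁻¹ * (∑ k, ν k * M (ν k • EuclideanSpace.single j 1
      - ν j • EuclideanSpace.single k 1) i + ν j * ∑ k, M (ν k • EuclideanSpace.single i 1
      - ν i • EuclideanSpace.single k 1) k + ν i * ν j * ∑ k, M (EuclideanSpace.single k 1) k)
      = M (EuclideanSpace.single j 1) i := by
    intro i j
    rw [inv_mul_eq_iff_eq_mul₀ h]
    simp only [map_sub, map_smul, PiLp.sub_apply, PiLp.smul_apply, smul_eq_mul, mul_sub,
      Finset.sum_sub_distrib, Finset.sum_mul]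
    have e1 : ∑ k, ν k * (ν j * M (EuclideanSpace.single k 1) i)
        = ν j * ∑ k, ν k * M (EuclideanSpace.single i 1) k := by
      rw [Finset.mul_sum]
      exact Finset.sum_congr rfl fun k _ => by rw [hM k i]; ring
    have e2 : ∑ k, ν i * M (EuclideanSpace.single k 1) k
        = ν i * ∑ k, M (EuclideanSpace.single k 1) k := by rw [Finset.mul_sum]
    rw [e1, e2]
    have e3 : ∀ k, ν k * (ν k * M (EuclideanSpace.single j 1) i)
      = ν k ^ 2 * M (EuclideanSpace.single j 1) i := fun k => by ring
    simp only [e3]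
    ring
  ext v l
  simp only [recoverMap, key]
  conv_rhs => rw [← sum_smul_single v]
  simp [Finset.sum_apply, Pi.single_apply, mul_comm]

/-! ### Differentiability up to the boundary -/

theorem IsRegularChart.sub_smul_mem_interior {Ω U : Set (Eu n)} {f : Eu n → ℝ}
    (hc : IsRegularChart Ω U f) {p u q : Eu n} {δ t : ℝ} (hU : ball p δ ⊆ U)
    (hu : ∀ q ∈ ball p δ, (1 / 2 : ℝ) < fderiv ℝ f q u) (hq : q ∈ ball p δ) (hqΩ : q ∈ Ω)
    (ht : 0 < t) (hqt : q - t • u ∈ ball p δ) : q - t • u ∈ interior Ω := by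
  refine hc.mem_interior (hU hqt) ?_
  have h1 := add_half_le_of_fderiv (fun q hq => hc.differentiableAt (hU hq)) hu hqt ht.le
    (by simpa using hq)
  have h2 := (hc.mem_iff q (hU hq)).mp hqΩ
  simp only [sub_add_cancel] at h1
  linarith

/-- The tangent cone at a point of the chart contains an open set of directions into `Ω`. -/
theorem IsRegularChart.uniqueDiffWithinAt {Ω U : Set (Eu n)} {f : Eu n → ℝ}
    (hc : IsRegularChart Ω U f) {p : Eu n} (hpU : p ∈ U) (hpΩ : p ∈ Ω) :
    UniqueDiffWithinAt ℝ Ω p := by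
  obtain ⟨v, δ, hδ, hU, hv⟩ := hc.exists_direction hpU
  refine ⟨?_, subset_closure hpΩ⟩
  have hsub : ball (-v) δ ⊆ (Submodule.span ℝ (tangentConeAt ℝ Ω p) : Set (Eu n)) := by
    intro w hw
    have hu : -w ∈ ball v δ := by
      rw [mem_ball, dist_eq_norm] at hw ⊢
      rwa [← norm_neg, show -(-w - v) = w - -v by abel]
    set t : ℝ := δ / (2 * (‖w‖ + 1)) with ht
    have ht0 : 0 < t := by positivity
    have htw : ‖t • w‖ < δ := by
      rw [norm_smul, Real.norm_of_nonneg ht0.le, ht, div_mul_eq_mul_div, div_lt_iff₀ (by positivity)]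
      nlinarith [norm_nonneg w]
    have hmem : t • w ∈ tangentConeAt ℝ Ω p := by
      have h1 : segment ℝ p (p + t • w) ⊆ Ω := by
        rintro z ⟨c, d, hc0, hd0, hcd, rfl⟩
        have e1 : c • p + d • (p + t • w) = p - (d * t) • (-w) := by
          rw [smul_add, ← add_assoc, ← add_smul, hcd, one_smul, smul_neg, sub_neg_eq_add, mul_smul]
        rcases hd0.eq_or_lt with h | h
        · rw [e1, ← h]; simpa using hpΩ
        · rw [e1]
          refine interior_subset (hc.sub_smul_mem_interior hU (fun q hq => hv q hq _ hu)
            (mem_ball_self hδ) hpΩ (by positivity) ?_)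
          rw [mem_ball, dist_eq_norm, smul_neg, sub_neg_eq_add, add_sub_cancel_left, mul_smul,
            norm_smul, Real.norm_of_nonneg hd0]
          have hd1 : d ≤ 1 := by linarith
          nlinarith [norm_nonneg (t • w)]
      simpa using mem_tangentConeAt_of_segment_subset h1
    have h2 := Submodule.smul_mem _ t⁻¹ (Submodule.subset_span (R := ℝ) hmem)
    rwa [smul_smul, inv_mul_cancel₀ ht0.ne', one_smul] at h2
  have htop : Submodule.span ℝ (tangentConeAt ℝ Ω p) = ⊤ := by
    refine Submodule.eq_top_of_nonempty_interior' _ ⟨-v, ?_⟩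
    exact _root_.mem_interior.mpr ⟨_, hsub, isOpen_ball, mem_ball_self hδ⟩
  rw [htop]
  simp

section
variable {Ω : Set (Eu n)} {F : ℝ → Eu n → Eu n} {M : ℝ → Eu n → Eu n →L[ℝ] Eu n}
  {F₀ : Eu n → Eu n} {M₀ : Eu n → Eu n →L[ℝ] Eu n} {C : ℝ}

/-- If the derivatives converge boundedly along an open segment to maps close to a fixed `N`, then
the increment of the limit function over the segment is close to that of `N`. -/
theorem norm_sub_sub_le_of_tendsto {V : Set (Eu n)}
    (hF : ∀ ε > 0, ∀ x, HasFDerivAt (F ε) (M ε x) x) (hM : ∀ ε > 0, Continuous (M ε))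
    (hF₀ : ∀ x, Tendsto (fun ε => F ε x) (𝓝[>] 0) (𝓝 (F₀ x)))
    (hC : ∀ ε > 0, ∀ x ∈ V, ‖M ε x‖ ≤ C)
    (hM₀ : ∀ x ∈ V, Tendsto (fun ε => M ε x) (𝓝[>] 0) (𝓝 (M₀ x)))
    {N : Eu n →L[ℝ] Eu n} {η : ℝ} (hη : ∀ x ∈ V, ‖M₀ x - N‖ ≤ η) {q w : Eu n}
    (hV : ∀ t ∈ Ioc (0 : ℝ) 1, q + t • w ∈ V) :
    ‖F₀ (q + w) - F₀ q - N w‖ ≤ η * ‖w‖ := by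
  have h1 : ∀ ε > 0, ∫ t in (0 : ℝ)..1, (M ε (q + t • w) w - N w) = F ε (q + w) - F ε q - N w := by
    intro ε hε
    have hd : ∀ t : ℝ, HasDerivAt (fun t : ℝ => F ε (q + t • w) - t • N w)
        (M ε (q + t • w) w - N w) t := by
      intro t
      have hl : HasDerivAt (fun t : ℝ => q + t • w) w t := by
        simpa using ((hasDerivAt_id t).smul_const w).const_add q
      have hl2 : HasDerivAt (fun t : ℝ => t • N w) (N w) t := by
        simpa using (hasDerivAt_id t).smul_const (N w)
      exact ((hF ε hε _).comp_hasDerivAt t hl).sub hl2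
    have hcont : Continuous fun t : ℝ => M ε (q + t • w) w - N w :=
      (((hM ε hε).comp (by fun_prop)).clm_apply continuous_const).sub continuous_const
    rw [intervalIntegral.integral_eq_sub_of_hasDerivAt (fun t _ => hd t)
      (hcont.intervalIntegrable _ _)]
    simp only [one_smul, zero_smul, add_zero, sub_zero]
    abel
  have h2 : Tendsto (fun ε => ∫ t in (0 : ℝ)..1, (M ε (q + t • w) w - N w)) (𝓝[>] 0)
      (𝓝 (∫ t in (0 : ℝ)..1, (M₀ (q + t • w) w - N w))) := by
    refine intervalIntegral.tendsto_integral_filter_of_dominated_convergence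
      (fun _ => C * ‖w‖ + ‖N w‖) ?_ ?_ (by simp) ?_
    · filter_upwards [self_mem_nhdsWithin] with ε hε
      exact ((((hM ε hε).comp (by fun_prop : Continuous fun t : ℝ => q + t • w)).clm_apply
        continuous_const).sub continuous_const).aestronglyMeasurable
    · filter_upwards [self_mem_nhdsWithin] with ε hε
      refine Eventually.of_forall fun t ht => ?_
      rw [uIoc_of_le zero_le_one] at ht
      refine (norm_sub_le _ _).trans ?_
      gcongr
      exact (ContinuousLinearMap.le_opNorm _ _).trans (by gcongr; exact hC ε hε _ (hV t ht))
    · refine Eventually.of_forall fun t ht => ?_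
      rw [uIoc_of_le zero_le_one] at ht
      have := (hM₀ _ (hV t ht))
      exact ((ContinuousLinearMap.apply ℝ (Eu n) w).continuous.continuousAt.tendsto.comp
        this).sub_const _
  have h3 : Tendsto (fun ε => F ε (q + w) - F ε q - N w) (𝓝[>] 0)
      (𝓝 (F₀ (q + w) - F₀ q - N w)) := ((hF₀ _).sub (hF₀ _)).sub_const _
  have h4 : F₀ (q + w) - F₀ q - N w = ∫ t in (0 : ℝ)..1, (M₀ (q + t • w) w - N w) := by
    refine tendsto_nhds_unique h3 (h2.congr' ?_)
    filter_upwards [self_mem_nhdsWithin] with ε hε using h1 ε hε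
  rw [h4]
  have h5 := intervalIntegral.norm_integral_le_of_norm_le_const (a := (0 : ℝ)) (b := 1)
    (f := fun t => M₀ (q + t • w) w - N w) (C := η * ‖w‖) (fun t ht => by
      rw [uIoc_of_le zero_le_one] at ht
      exact (ContinuousLinearMap.le_opNorm (M₀ (q + t • w) - N) w).trans
        (by gcongr; exact hη _ (hV t ht)))
  simpa using h5

/-- A bounded limit of derivatives which extends continuously to a boundary point is the derivative
of the limit function there: the increment between the boundary point and a nearby point of `Ω` is
computed along a broken line which, except for its ends, stays in the interior. -/
theorem hasFDerivWithinAt_of_tendsto {U V : Set (Eu n)} {f : Eu n → ℝ} (hc : IsRegularChart Ω U f)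
    {p : Eu n} (hpU : p ∈ U) (hpΩ : p ∈ Ω) (hVp : V ∈ 𝓝 p)
    (hF : ∀ ε > 0, ∀ x, HasFDerivAt (F ε) (M ε x) x) (hM : ∀ ε > 0, Continuous (M ε))
    (hF₀ : ∀ x, Tendsto (fun ε => F ε x) (𝓝[>] 0) (𝓝 (F₀ x)))
    (hC : ∀ ε > 0, ∀ x ∈ V ∩ interior Ω, ‖M ε x‖ ≤ C)
    (hM₀ : ∀ x ∈ V ∩ interior Ω, Tendsto (fun ε => M ε x) (𝓝[>] 0) (𝓝 (M₀ x)))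
    (hcont : ContinuousWithinAt M₀ Ω p) : HasFDerivWithinAt F₀ (M₀ p) Ω p := by
  obtain ⟨v, δ, hδ, hU, hv⟩ := hc.exists_direction hpU
  set K : ℝ := 2 * ‖v‖ / δ with hK
  have hK0 : 0 ≤ K := by positivity
  rw [hasFDerivWithinAt_iff_isLittleO, Asymptotics.isLittleO_iff]
  intro c hc0
  set η : ℝ := c / (1 + 2 * K) with hη
  have hη0 : 0 < η := by positivity
  obtain ⟨ρ₁, hρ₁, hρ₁'⟩ := Metric.continuousWithinAt_iff.mp hcont η hη0
  obtain ⟨ρ₂, hρ₂, hρ₂'⟩ := Metric.mem_nhds_iff.mp hVp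
  set ρ := min (min ρ₁ ρ₂) δ with hρ
  have hρ0 : 0 < ρ := by positivity
  have hball : ball p ρ ⊆ ball p δ := ball_subset_ball (min_le_right _ _)
  have hest : ∀ x ∈ ball p ρ ∩ interior Ω, ‖M₀ x - M₀ p‖ ≤ η := by
    intro x hx
    rw [← dist_eq_norm]
    refine (hρ₁' (interior_subset hx.2) ?_).le
    exact (mem_ball.mp hx.1).trans_le ((min_le_left _ _).trans (min_le_left _ _))
  have hVsub : ball p ρ ∩ interior Ω ⊆ V ∩ interior Ω := fun x hx =>
    ⟨hρ₂' (ball_subset_ball ((min_le_left _ _).trans (min_le_right _ _)) hx.1), hx.2⟩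
  have hseg : ∀ q ∈ ball p ρ ∩ Ω, ∀ u ∈ ball v δ, ∀ l > (0 : ℝ), q - l • u ∈ ball p ρ →
      ‖F₀ (q - l • u) - F₀ q - M₀ p (-(l • u))‖ ≤ η * ‖l • u‖ := by
    intro q hq u hu l hl hql
    have := norm_sub_sub_le_of_tendsto (V := ball p ρ ∩ interior Ω) (q := q) (w := -(l • u)) hF hM hF₀
      (fun ε hε x hx => hC ε hε x (hVsub hx)) (fun x hx => hM₀ x (hVsub hx)) hest (fun t ht => by
        have hm : q + t • -(l • u) ∈ ball p ρ := by
          have := (convex_ball p ρ) hq.1 hql (sub_nonneg.mpr ht.2) ht.1.le (by ring)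
          convert this using 1
          module
        have e : q + t • -(l • u) = q - (t * l) • u := by module
        refine ⟨hm, ?_⟩
        rw [e] at hm ⊢
        exact hc.sub_smul_mem_interior hU (fun q hq => hv q hq _ hu) (hball hq.1) hq.2
          (mul_pos ht.1 hl) (hball hm))
    rwa [← sub_eq_add_neg, norm_neg] at this
  have hr : 0 < ρ / (1 + K) := by positivity
  filter_upwards [self_mem_nhdsWithin, mem_nhdsWithin_of_mem_nhds (ball_mem_nhds p hr)] with x hx hxr
  rcases eq_or_ne x p with rfl | hxp
  · simp
  have hxp0 : 0 < ‖x - p‖ := norm_pos_iff.mpr (sub_ne_zero.mpr hxp)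
  rw [mem_ball, dist_eq_norm, lt_div_iff₀ (by positivity)] at hxr
  set l : ℝ := 2 * ‖x - p‖ / δ with hl
  have hl0 : 0 < l := by positivity
  have hlv : ‖l • v‖ = K * ‖x - p‖ := by
    rw [norm_smul, Real.norm_of_nonneg hl0.le, hl, hK]; ring
  have hz : p - l • v ∈ ball p ρ := by
    rw [mem_ball, dist_eq_norm, sub_sub_cancel_left, norm_neg, hlv]
    nlinarith
  have hxb : x ∈ ball p ρ := by
    rw [mem_ball, dist_eq_norm]; nlinarith
  -- the two legs of the broken line meet at `p - l v`
  set u : Eu n := v + l⁻¹ • (x - p) with hu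
  have hlu : l • u = l • v + (x - p) := by
    rw [hu, smul_add, smul_smul, mul_inv_cancel₀ hl0.ne', one_smul]
  have hub : u ∈ ball v δ := by
    rw [mem_ball, dist_eq_norm, hu, add_sub_cancel_left, norm_smul, norm_inv,
      Real.norm_of_nonneg hl0.le, hl]
    rw [inv_div, div_mul_eq_mul_div, div_lt_iff₀ (by positivity)]
    nlinarith
  have hxz : x - l • u = p - l • v := by rw [hlu]; abel
  have h1 := hseg p ⟨mem_ball_self hρ0, hpΩ⟩ v (mem_ball_self hδ) l hl0 hz
  have h2 := hseg x ⟨hxb, hx⟩ u hub l hl0 (by rwa [hxz])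
  rw [hxz] at h2
  have h3 : F₀ x - F₀ p - M₀ p (x - p) = (F₀ (p - l • v) - F₀ p - M₀ p (-(l • v)))
      - (F₀ (p - l • v) - F₀ x - M₀ p (-(l • u))) := by
    rw [hlu]
    simp only [map_neg, map_add]
    abel
  rw [h3]
  refine (norm_sub_le _ _).trans ((add_le_add h1 h2).trans ?_)
  have h4 : ‖l • u‖ ≤ K * ‖x - p‖ + ‖x - p‖ := by
    rw [hlu, ← hlv]; exact norm_add_le _ _
  rw [hlv]
  calc η * (K * ‖x - p‖) + η * ‖l • u‖
      ≤ η * (K * ‖x - p‖) + η * (K * ‖x - p‖ + ‖x - p‖) := by gcongr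
    _ = η * (1 + 2 * K) * ‖x - p‖ := by ring
    _ = c * ‖x - p‖ := by rw [hη]; field_simp

end

/-! ### The potential of a differentiable density is differentiable up to the boundary -/

/-- The field `ν_k e_j - ν_j e_k`, with `ν` the gradient of `f`, cut off near `p`. It is tangent to
the level sets of `f`. -/
def tangentField (f : Eu n → ℝ) (p : Eu n) (r : ℝ) (j k : Fin n) (y : Eu n) : Eu n :=
  ballBump p r y • (fderiv ℝ f y (EuclideanSpace.single k 1) • EuclideanSpace.single j 1
    - fderiv ℝ f y (EuclideanSpace.single j 1) • EuclideanSpace.single k 1)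

section
variable {Ω U : Set (Eu n)} {f : Eu n → ℝ} {p : Eu n} {r : ℝ}

theorem tangentField_eq_zero (hr : 0 < r) (j k : Fin n) {y : Eu n} (hy : y ∉ closedBall p (2 * r)) :
    tangentField f p r j k y = 0 := by
  rw [tangentField, ballBump_eq_zero hr fun h => hy (ball_subset_closedBall h), zero_smul]

theorem fderiv_tangentField (j k : Fin n) (y : Eu n) :
    fderiv ℝ f y (tangentField f p r j k y) = 0 := by
  simp [tangentField, mul_comm]

theorem contDiff_tangentField (hc : IsRegularChart Ω U f) (hr : 0 < r)
    (hU : closedBall p (2 * r) ⊆ U) (j k : Fin n) : ContDiff ℝ 1 (tangentField f p r j k) := by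
  rw [contDiff_iff_contDiffAt]
  intro y
  by_cases hy : y ∈ U
  · have h1 : ContDiffAt ℝ 1 (fderiv ℝ f) y := (hc.contDiffAt hy).fderiv_right (by
      rw [one_add_one_eq_two]; exact WithTop.coe_le_coe.mpr le_top)
    exact (contDiff_ballBump p r).contDiffAt.smul
      (((h1.clm_apply contDiffAt_const).smul contDiffAt_const).sub
        ((h1.clm_apply contDiffAt_const).smul contDiffAt_const))
  · have : tangentField f p r j k =ᶠ[𝓝 y] fun _ => 0 := by
      filter_upwards [isClosed_closedBall.isOpen_compl.mem_nhds fun h => hy (hU h)] with z hz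
      exact tangentField_eq_zero hr j k hz
    exact contDiffAt_const.congr_of_eventuallyEq this

theorem exists_lipschitz_tangentField (hc : IsRegularChart Ω U f) (hr : 0 < r)
    (hU : closedBall p (2 * r) ⊆ U) (j k : Fin n) :
    ∃ L, 0 ≤ L ∧ ∀ x y, ‖tangentField f p r j k x - tangentField f p r j k y‖ ≤ L * ‖x - y‖ := by
  obtain ⟨L, hL⟩ := (contDiff_tangentField hc hr hU j k).lipschitzWith_of_hasCompactSupport
    (HasCompactSupport.intro (isCompact_closedBall p (2 * r))
      fun y hy => tangentField_eq_zero hr j k hy) (by simp)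
  refine ⟨L, L.2, fun x y => ?_⟩
  simpa [dist_eq_norm] using hL.dist_le_mul x y

theorem continuousOn_divergence {s : Set (Eu n)} (hs : IsOpen s) {Y : Eu n → Eu n}
    (hY : ContDiffOn ℝ 1 Y s) : ContinuousOn (divergence Y) s := by
  have h := hY.continuousOn_fderiv_of_isOpen hs (by simp)
  unfold divergence
  refine continuousOn_finsetSum _ fun i _ => ?_
  exact (EuclideanSpace.proj i : Eu n →L[ℝ] ℝ).continuous.comp_continuousOn
    (h.clm_apply continuousOn_const)

/-- The divergence of `a X` is bounded as soon as the derivative of `a` is bounded near the support of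
`X`. -/
theorem exists_bound_divergence_smul {a : Eu n → ℝ} {X : Eu n → Eu n} {T W : Set (Eu n)} {A B : ℝ}
    (hT : IsCompact T) (hTW : T ⊆ W) (hX : ContDiff ℝ 1 X) (hXT : ∀ y ∉ T, X y = 0)
    (hA : ∀ y ∈ interior Ω, |a y| ≤ A)
    (hB : ∀ y ∈ W ∩ interior Ω, DifferentiableAt ℝ a y ∧ ‖fderiv ℝ a y‖ ≤ B) :
    ∃ D, ∀ y ∈ interior Ω, |divergence (fun y => a y • X y) y| ≤ D := by
  obtain ⟨C, hC⟩ := hT.exists_bound_of_continuousOn hX.continuous.continuousOn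
  obtain ⟨C', hC'⟩ := hT.exists_bound_of_continuousOn
    (continuousOn_divergence isOpen_univ hX.contDiffOn |>.mono (subset_univ T))
  refine ⟨max (B * C + A * C') 0, fun y hy => ?_⟩
  by_cases hyT : y ∈ T
  · obtain ⟨h1, h2⟩ := hB y ⟨hTW hyT, hy⟩
    rw [divergence_smul h1 (hX.differentiable (by simp) y)]
    refine le_trans ?_ (le_max_left _ _)
    refine (abs_add_le _ _).trans ?_
    rw [abs_mul]
    have hA0 := (abs_nonneg _).trans (hA y hy)
    have hB0 := (norm_nonneg _).trans h2
    gcongr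
    · exact ((fderiv ℝ a y).le_opNorm (X y)).trans
        (mul_le_mul h2 (hC y hyT) (norm_nonneg _) hB0)
    · exact hA y hy
    · exact hC' y hyT
  · rw [divergence_eq_zero_of_eventuallyEq, abs_zero]
    · exact le_max_right _ _
    · filter_upwards [hT.isClosed.isOpen_compl.mem_nhds hyT] with z hz
      rw [hXT z hz, smul_zero]

/-- Near a boundary point at which the boundary is smooth, the derivatives of the regularised
potentials converge boundedly to a map which is continuous up to the boundary. The tangential
derivatives converge by integration by parts, and the trace is the convolution with an approximate
identity; since the derivatives are symmetric, this determines them. -/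
theorem exists_hasFDerivWithinAt_potential [NeZero n] {a : Eu n → ℝ} (hΩ : IsCompact Ω)
    (hc : IsRegularChart Ω U f) (hpU : p ∈ U) (hpΩ : p ∈ Ω) (ha : ContDiffOn ℝ 1 a Ω) :
    ∃ M₀ : Eu n → Eu n →L[ℝ] Eu n, ∃ V ∈ 𝓝 p,
      (∀ x ∈ V ∩ interior Ω, Tendsto (fun ε => potentialDeriv Ω a ε x) (𝓝[>] 0) (𝓝 (M₀ x))) ∧
      ContinuousWithinAt M₀ Ω p ∧ HasFDerivWithinAt (potential Ω a 0) (M₀ p) Ω p := by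
  obtain ⟨δ₁, hδ₁, B, hB0, hB, -⟩ := exists_bound_fderiv hpΩ (ha p hpΩ)
  obtain ⟨δ₂, hδ₂, hδ₂U⟩ := Metric.isOpen_iff.mp hc.isOpen p hpU
  obtain ⟨A, hA⟩ := hΩ.exists_bound_of_continuousOn ha.continuousOn
  have hA' : ∀ y ∈ interior Ω, |a y| ≤ A := fun y hy => hA y (interior_subset hy)
  have hA0 : 0 ≤ A := (norm_nonneg _).trans (hA p hpΩ)
  have hai : ContDiffOn ℝ 1 a (interior Ω) := ha.mono interior_subset
  have hac := hai.continuousOn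
  set r := min δ₁ δ₂ / 4 with hr
  have hr0 : 0 < r := by positivity
  have hr1 : closedBall p (2 * r) ⊆ ball p δ₁ := closedBall_subset_ball (by
    have := min_le_left δ₁ δ₂; linarith)
  have hr2 : closedBall p (2 * r) ⊆ U := (closedBall_subset_ball (by
    have := min_le_right δ₁ δ₂; linarith)).trans hδ₂U
  set X := tangentField f p r with hXdef
  have hT : IsCompact (closedBall p (2 * r)) := isCompact_closedBall _ _
  have hX : ∀ j k, ContDiff ℝ 1 (X j k) := contDiff_tangentField hc hr0 hr2
  have hXT : ∀ j k, ∀ y ∉ closedBall p (2 * r), X j k y = 0 := fun j k y =>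
    tangentField_eq_zero hr0 j k
  choose L hL0 hL using exists_lipschitz_tangentField hc hr0 hr2
  set b : Fin n → Fin n → Eu n → ℝ := fun j k => divergence fun y => a y • X j k y with hbdef
  have hbc : ∀ j k, ContinuousOn (b j k) (interior Ω) := fun j k =>
    continuousOn_divergence isOpen_interior (hai.smul (hX j k).contDiffOn)
  have hbB : ∀ j k, ∃ D, ∀ y ∈ interior Ω, |b j k y| ≤ D := fun j k =>
    exists_bound_divergence_smul hT hr1 (hX j k) (hXT j k) hA' hB
  choose D hD using hbB
  have htp : ∀ j k, ∀ ε > 0, ∀ x, potentialDeriv Ω a ε x (X j k x)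
      = tangentialPotential Ω a (b j k) (X j k) ε x := fun j k ε hε x =>
    potentialDeriv_apply_eq_tangentialPotential hΩ hc hT hr2 (hXT j k) (hX j k)
      (fun y _ => fderiv_tangentField j k y) hai hA' (hD j k) hε (hL j k) (hbc j k) x
  set R := ‖p‖ + 2 * r with hR
  have hpR : ball p r ⊆ ball 0 R := ball_subset_ball' (by rw [dist_zero_right]; linarith)
  have hlim : ∀ j k, TendstoUniformlyOn (tangentialPotential Ω a (b j k) (X j k))
      (tangentialPotential Ω a (b j k) (X j k) 0) (𝓝[>] 0) (ball 0 R) := fun j k =>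
    tendstoUniformlyOn_tangentialPotential hΩ hac hA' (hbc j k) (hD j k) (hL0 j k)
      (hX j k).continuous (hL j k) R
  have hbdd : ∀ j k, ∃ C, ∀ ε, ∀ x ∈ ball (0 : Eu n) R,
      ‖tangentialPotential Ω a (b j k) (X j k) ε x‖ ≤ C := fun j k =>
    exists_bound_tangentialPotential hΩ hA' (hD j k) (hL j k) R
  choose C hC using hbdd
  have hG : ∀ j k, ContinuousOn (tangentialPotential Ω a (b j k) (X j k) 0) (ball 0 R) := by
    intro j k
    refine (hlim j k).continuousOn (Eventually.frequently ?_)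
    filter_upwards [self_mem_nhdsWithin] with ε hε
    refine Continuous.continuousOn ?_
    rw [← funext (htp j k ε hε)]
    exact (continuous_potentialDeriv hΩ hac hA' hε).clm_apply (hX j k).continuous
  -- the gradient of `f`
  set ν : Eu n → Eu n := fun y =>
    WithLp.toLp 2 fun k => fderiv ℝ f y (EuclideanSpace.single k 1) with hν
  have hνc : ∀ y ∈ U, ContinuousAt ν y := by
    intro y hy
    refine (PiLp.continuous_toLp 2 _).continuousAt.comp (continuousAt_pi.mpr fun k => ?_)
    exact (hc.continuousAt_fderiv hy).clm_apply continuousAt_const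
  have hν0 : ∀ y ∈ U, ν y ≠ 0 := by
    intro y hy h
    refine hc.fderiv_ne_zero y hy (ContinuousLinearMap.ext fun v => ?_)
    rw [← sum_smul_single v]
    have : ∀ k, fderiv ℝ f y (EuclideanSpace.single k 1) = 0 := fun k => congrArg (fun w : Eu n => w k) h
    simp [this]
  have hXν : ∀ y ∈ ball p r, ∀ j k, X j k y
      = ν y k • EuclideanSpace.single j 1 - ν y j • EuclideanSpace.single k 1 := by
    intro y hy j k
    rw [hXdef, tangentField, ballBump_eq_one hr0 hy, one_smul]
  have hballU : ball p r ⊆ U := (ball_subset_closedBall.trans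
    (closedBall_subset_closedBall (by linarith))).trans hr2
  have hrec : ∀ ε > 0, ∀ x ∈ ball p r, potentialDeriv Ω a ε x = recoverMap (ν x,
      (fun j k => tangentialPotential Ω a (b j k) (X j k) ε x),
      ∑ i, potentialDeriv Ω a ε x (EuclideanSpace.single i 1) i) := by
    intro ε hε x hx
    have h1 := recoverMap_eq (M := potentialDeriv Ω a ε x)
      (fun i j => inner_potentialDeriv_comm hΩ hac hA' hε x i j) (hν0 x (hballU hx))
    rw [← h1]
    congr 2
    · simp only [h1]
      congr 1
      funext j k
      rw [← htp j k ε hε, hXν x hx]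
  set M₀ : Eu n → Eu n →L[ℝ] Eu n := fun x => recoverMap (ν x,
      (fun j k => tangentialPotential Ω a (b j k) (X j k) 0 x), sphereArea n * a x) with hM₀
  have htend : ∀ x ∈ ball p r ∩ interior Ω,
      Tendsto (fun ε => potentialDeriv Ω a ε x) (𝓝[>] 0) (𝓝 (M₀ x)) := by
    intro x hx
    have h1 := (continuousAt_recoverMap (q := (ν x,
      (fun j k => tangentialPotential Ω a (b j k) (X j k) 0 x), sphereArea n * a x))
      (hν0 x (hballU hx.1))).tendsto.comp (f := fun ε => (ν x,
      (fun j k => tangentialPotential Ω a (b j k) (X j k) ε x),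
      ∑ i, potentialDeriv Ω a ε x (EuclideanSpace.single i 1) i)) (x := 𝓝[>] 0)
      (tendsto_const_nhds.prodMk_nhds (Tendsto.prodMk_nhds
        (tendsto_pi_nhds.mpr fun j => tendsto_pi_nhds.mpr fun k => (hlim j k).tendsto_at (hpR hx.1))
        (tendsto_sum_potentialDeriv hΩ hac hA' hx.2)))
    refine h1.congr' ?_
    filter_upwards [self_mem_nhdsWithin] with ε hε
    exact (hrec ε hε x hx.1).symm
  have hcont : ContinuousWithinAt M₀ Ω p := by
    refine (continuousAt_recoverMap (hν0 p hpU)).comp_continuousWithinAt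
      (f := fun x => (ν x, (fun j k => tangentialPotential Ω a (b j k) (X j k) 0 x),
        sphereArea n * a x)) ?_
    refine (hνc p hpU).continuousWithinAt.prodMk (ContinuousWithinAt.prodMk ?_ ?_)
    · refine continuousWithinAt_pi.mpr fun j => continuousWithinAt_pi.mpr fun k => ?_
      exact ((hG j k).continuousAt
        (isOpen_ball.mem_nhds (hpR (mem_ball_self hr0)))).continuousWithinAt
    · exact continuousWithinAt_const.mul (ha.continuousOn p hpΩ)
  -- the arguments of `recoverMap` stay in a compact set
  obtain ⟨C₀, hC₀⟩ : ∃ C₀, ∀ ε > 0, ∀ x ∈ ball p r ∩ interior Ω, ‖potentialDeriv Ω a ε x‖ ≤ C₀ := by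
    have hK1 : IsCompact (ν '' closedBall p (2 * r)) :=
      hT.image_of_continuousOn fun y hy => (hνc y (hr2 hy)).continuousWithinAt
    have hK2 : IsCompact (Set.pi univ fun j => Set.pi univ fun k =>
        closedBall (0 : Eu n) (C j k)) :=
      isCompact_univ_pi fun j => isCompact_univ_pi fun k => isCompact_closedBall _ _
    have hK := hK1.prod (hK2.prod (isCompact_Icc (a := -(A * sphereArea n)) (b := A * sphereArea n)))
    obtain ⟨C₀, hC₀⟩ := hK.exists_bound_of_continuousOn (f := recoverMap) (by
      rintro ⟨w, G, t⟩ ⟨⟨y, hy, rfl⟩, -⟩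
      exact (continuousAt_recoverMap (hν0 y (hr2 hy))).continuousWithinAt)
    refine ⟨C₀, fun ε hε x hx => ?_⟩
    rw [hrec ε hε x hx.1]
    refine hC₀ _ ⟨⟨x, closedBall_subset_closedBall (by linarith) (ball_subset_closedBall hx.1), rfl⟩,
      fun j _ k _ => ?_, abs_le.mp (abs_sum_potentialDeriv_le hΩ hac hA' hA0 hε x)⟩
    rw [mem_closedBall_zero_iff]
    exact hC j k ε x (hpR hx.1)
  refine ⟨M₀, ball p r, ball_mem_nhds p hr0, htend, hcont, ?_⟩
  exact hasFDerivWithinAt_of_tendsto hc hpU hpΩ (ball_mem_nhds p hr0)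
    (fun ε hε x => hasFDerivAt_potential hΩ hac hA' hε x)
    (fun ε hε => continuous_potentialDeriv hΩ hac hA' hε)
    (fun x => tendsto_potential hΩ hac hA' x) hC₀ htend hcont

end

/-! ### Alternating forms through their components -/

/-- Alternating forms are recovered, by a continuous linear map, from their components. This reduces
differentiability and integrability of forms to those of their values on fixed vectors. -/
theorem exists_reconstruct_form (n k : ℕ) :
    ∃ g : ((Fin k → Fin n) → ℝ) →L[ℝ] (Eu n [⋀^Fin k]→L[ℝ] ℝ), ∀ φ : Eu n [⋀^Fin k]→L[ℝ] ℝ,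
      g (fun r => φ fun i => EuclideanSpace.single (r i) 1) = φ := by
  let ev : (Eu n [⋀^Fin k]→L[ℝ] ℝ) →ₗ[ℝ] ((Fin k → Fin n) → ℝ) :=
    LinearMap.pi fun r => (ContinuousAlternatingMap.apply ℝ (Eu n) ℝ
      fun i => EuclideanSpace.single (r i) 1).toLinearMap
  have hinj : LinearMap.ker ev = ⊥ := by
    rw [LinearMap.ker_eq_bot]
    intro φ ψ h
    refine ContinuousAlternatingMap.toAlternatingMap_injective
      ((EuclideanSpace.basisFun (Fin n) ℝ).toBasis.ext_alternating fun r _ => ?_)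
    have := congrFun h r
    simpa [ev] using this
  obtain ⟨g, hg⟩ := ev.exists_leftInverse_of_injective hinj
  exact ⟨LinearMap.toContinuousLinearMap g, fun φ => LinearMap.congr_fun hg φ⟩

theorem differentiableWithinAt_form {k : ℕ} {φ : Eu n → Eu n [⋀^Fin k]→L[ℝ] ℝ} {s : Set (Eu n)}
    {p : Eu n} (h : ∀ w, DifferentiableWithinAt ℝ (fun x => φ x w) s p) :
    DifferentiableWithinAt ℝ φ s p := by
  obtain ⟨g, hg⟩ := exists_reconstruct_form n k
  have h1 := g.differentiableAt.comp_differentiableWithinAt p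
    (differentiableWithinAt_pi.mpr fun r : Fin k → Fin n =>
      h fun i => EuclideanSpace.single (r i) 1)
  exact h1.congr (fun x _ => (hg (φ x)).symm) (hg (φ p)).symm

theorem integrable_form {k : ℕ} {μ : Measure (Eu n)} {φ : Eu n → Eu n [⋀^Fin k]→L[ℝ] ℝ}
    (h : ∀ w, Integrable (fun x => φ x w) μ) : Integrable φ μ := by
  obtain ⟨g, hg⟩ := exists_reconstruct_form n k
  have h1 := g.integrable_comp (Integrable.of_eval fun r : Fin k → Fin n =>
      h fun i => EuclideanSpace.single (r i) 1)
  exact h1.congr (Eventually.of_forall fun x => hg (φ x))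

/-! ### Forms with vanishing tangential part -/

/-- The exterior product of a linear form `l` with a form which vanishes on the kernel of `l` is
zero. -/
theorem sum_mul_apply_removeNth_eq_zero {k : ℕ} (l : Eu n →L[ℝ] ℝ) (A : Eu n [⋀^Fin (k + 1)]→L[ℝ] ℝ)
    (hA : ∀ V : Fin (k + 1) → Eu n, (∀ i, l (V i) = 0) → A V = 0) (u : Fin (k + 2) → Eu n) :
    ∑ j : Fin (k + 2), (-1 : ℝ) ^ (j : ℕ) * A (j.removeNth u) * l (u j) = 0 := by
  have hval : ∀ v : Fin (k + 2) → Eu n, ContinuousAlternatingMap.alternatizeUncurryFin (l.smulRight A) v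
      = ∑ j : Fin (k + 2), (-1 : ℝ) ^ (j : ℕ) * A (j.removeNth v) * l (v j) := by
    intro v
    rw [ContinuousAlternatingMap.alternatizeUncurryFin_apply]
    refine Finset.sum_congr rfl fun j _ => ?_
    simp; ring
  by_cases h : ∀ j, l (u j) = 0
  · simp [h]
  push Not at h
  obtain ⟨j₀, hj₀⟩ := h
  have h1 := map_add_smul_of_ne
    (ContinuousAlternatingMap.alternatizeUncurryFin (l.smulRight A)).toAlternatingMap u j₀
    (fun i => -(l (u i) / l (u j₀)))
  rw [← hval]
  refine h1.symm.trans ((hval _).trans (Finset.sum_eq_zero fun j _ => ?_))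
  have hl : ∀ i, i ≠ j₀ → l (u i + -(l (u i) / l (u j₀)) • u j₀) = 0 := by
    intro i _
    simp only [map_add, map_smul, smul_eq_mul]
    field_simp
    ring
  by_cases hj : j = j₀
  · rw [hA _ fun i => ?_, mul_zero, zero_mul]
    have hne : j.succAbove i ≠ j₀ := hj ▸ Fin.succAbove_ne j i
    simp only [Fin.removeNth_apply, hne, if_false]
    exact hl _ hne
  · simp only [hj, if_false]
    rw [hl j hj, mul_zero]

/-! ### The field of a closed Dirichlet form -/

/-- The vector field whose pairing with `dψ` is `(dψ ∧ α)(u)`. -/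
def formField {k : ℕ} (α : Eu n → Eu n [⋀^Fin (k + 1)]→L[ℝ] ℝ) (u : Fin (k + 2) → Eu n) (y : Eu n) :
    Eu n :=
  ∑ j : Fin (k + 2), ((-1 : ℝ) ^ (j : ℕ) * α y (j.removeNth u)) • u j

section
variable {k : ℕ} {Ω : Set (Eu n)} {α : Eu n → Eu n [⋀^Fin (k + 1)]→L[ℝ] ℝ}

theorem contDiffOn_apply_form {s : Set (Eu n)} (hα : ContDiffOn ℝ 1 α s) (w : Fin (k + 1) → Eu n) :
    ContDiffOn ℝ 1 (fun y => α y w) s :=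
  (ContinuousAlternatingMap.apply ℝ (Eu n) ℝ w).contDiff.comp_contDiffOn hα

theorem isTangent_formField (hdir : IsDirichletForm Ω α) (u : Fin (k + 2) → Eu n) :
    IsTangent Ω (formField α u) := by
  intro x U f hf
  rw [← sum_mul_apply_removeNth_eq_zero (fderiv ℝ f x) (α x) (hdir x U f hf) u]
  simp [formField]

theorem divergence_formField (hα : ContDiffOn ℝ 1 α Ω) (hclosed : IsClosedForm Ω α)
    (u : Fin (k + 2) → Eu n) {y : Eu n} (hy : y ∈ interior Ω) : divergence (formField α u) y = 0 := by
  have hd : DifferentiableAt ℝ α y :=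
    (hα.contDiffAt (mem_interior_iff_mem_nhds.mp hy)).differentiableAt (by simp)
  have h1 : ∀ j : Fin (k + 2), HasFDerivAt
      (fun y => ((-1 : ℝ) ^ (j : ℕ) * α y (j.removeNth u)) • u j)
      ((((-1 : ℝ) ^ (j : ℕ)) • (ContinuousAlternatingMap.apply ℝ (Eu n) ℝ (j.removeNth u)).comp
        (fderiv ℝ α y)).smulRight (u j)) y := fun j =>
    ((((ContinuousAlternatingMap.apply ℝ (Eu n) ℝ (j.removeNth u)).hasFDerivAt.comp y
      hd.hasFDerivAt).const_mul _).smul_const (u j))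
  have h2 : HasFDerivAt (formField α u) _ y := HasFDerivAt.fun_sum fun j _ => h1 j
  have h3 := congrArg (fun φ : Eu n [⋀^Fin (k + 2)]→L[ℝ] ℝ => φ u) (hclosed y hy)
  simp only [extDeriv, ContinuousAlternatingMap.alternatizeUncurryFin_apply,
    ContinuousAlternatingMap.coe_zero, Pi.zero_apply] at h3
  rw [divergence, h2.fderiv, ← h3]
  simp only [sum_apply, ContinuousLinearMap.smulRight_apply, WithLp.ofLp_sum,
    Finset.sum_apply, PiLp.smul_apply]
  rw [Finset.sum_comm]
  refine Finset.sum_congr rfl fun j _ => ?_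
  conv_rhs => rw [← sum_smul_single (u j)]
  simp only [map_sum, map_smul, ContinuousAlternatingMap.sum_apply, Finset.smul_sum]
  refine Finset.sum_congr rfl fun i _ => ?_
  simp
  ring

/-- Weak closedness, tested on a `C¹` function on `ℝⁿ`: no boundary term appears, since the form is
Dirichlet. -/
theorem integral_formField_eq_zero [NeZero n] (hΩ : IsCompactDomain Ω) (hα : ContDiffOn ℝ 1 α Ω)
    (hclosed : IsClosedForm Ω α) (hdir : IsDirichletForm Ω α) (u : Fin (k + 2) → Eu n) {ψ : Eu n → ℝ}
    (hψ : ContDiff ℝ 1 ψ) : ∫ y in interior Ω, fderiv ℝ ψ y (formField α u y) = 0 := by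
  refine integral_fderiv_apply_eq_zero hΩ ?_ (fun y hy => divergence_formField hα hclosed u hy)
    (isTangent_formField hdir u) hψ
  exact ContDiffOn.sum fun j _ =>
    ((contDiffOn_const.mul (contDiffOn_apply_form hα _)).smul contDiffOn_const)

/-- Before the regularisation is removed, the trace of the derivative of the potential of the
coefficients of `α` is the exterior derivative of the regularised primitive. -/
theorem sum_potentialDeriv_eq [NeZero n] (hΩ : IsCompactDomain Ω) (hα : ContDiffOn ℝ 1 α Ω)
    (hclosed : IsClosedForm Ω α) (hdir : IsDirichletForm Ω α) (v : Fin (k + 1) → Eu n) {ε : ℝ}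
    (hε : 0 < ε) (x : Eu n) :
    ∑ i, potentialDeriv Ω (fun y => α y v) ε x (EuclideanSpace.single i 1) i
      = ∑ i, ∑ j : Fin (k + 1), (-1 : ℝ) ^ (j : ℕ) * potentialDeriv Ω
        (fun y => α y (Fin.cons (EuclideanSpace.single i 1) (j.removeNth v))) ε x (v j) i := by
  have hK := hΩ.isCompact
  have hbd : ∀ w : Fin (k + 1) → Eu n, ∃ A, ∀ y ∈ interior Ω, |α y w| ≤ A := by
    intro w
    obtain ⟨A, hA⟩ := hK.exists_bound_of_continuousOn (contDiffOn_apply_form hα w).continuousOn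
    exact ⟨A, fun y hy => hA y (interior_subset hy)⟩
  choose A hA using hbd
  have hc : ∀ w, ContinuousOn (fun y => α y w) (interior Ω) := fun w =>
    (contDiffOn_apply_form hα w).continuousOn.mono interior_subset
  refine Finset.sum_congr rfl fun i _ => ?_
  have hψ : ContDiff ℝ 1 fun y => newtonField ε (x - y) i :=
    (EuclideanSpace.proj i : Eu n →L[ℝ] ℝ).contDiff.comp
      ((contDiff_newtonField hε).comp (contDiff_const.sub contDiff_id))
  have h1 := integral_formField_eq_zero hΩ hα hclosed hdir
    (Fin.cons (EuclideanSpace.single i 1) v) hψ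
  simp only [(hasFDerivAt_newtonField_sub_apply hε x _ i).fderiv] at h1
  have h2 : ∀ j : Fin (k + 1), j.succ.removeNth (Fin.cons (EuclideanSpace.single i (1 : ℝ)) v :
      Fin (k + 2) → Eu n) = Fin.cons (EuclideanSpace.single i 1) (j.removeNth v) := by
    intro j
    funext l
    refine Fin.cases ?_ (fun l => ?_) l <;> simp [Fin.removeNth_apply]
  have h3 : (0 : Fin (k + 2)).removeNth (Fin.cons (EuclideanSpace.single i (1 : ℝ)) v :
      Fin (k + 2) → Eu n) = v := by
    funext l; simp [Fin.removeNth_apply]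
  have hform : ∀ y, formField α (Fin.cons (EuclideanSpace.single i 1) v) y
      = α y v • EuclideanSpace.single i 1 + ∑ j : Fin (k + 1), (-((-1 : ℝ) ^ (j : ℕ)
        * α y (Fin.cons (EuclideanSpace.single i 1) (j.removeNth v)))) • v j := by
    intro y
    rw [formField, Fin.sum_univ_succ]
    simp only [h2, h3, Fin.val_zero, pow_zero, one_mul, Fin.cons_zero, Fin.cons_succ, Fin.val_succ,
      pow_succ, mul_neg_one, neg_mul]
  rw [potentialDeriv_apply_apply hK (hc _) (hA _) hε]
  simp only [potentialDeriv_apply_apply hK (hc _) (hA _) hε, ← integral_const_mul]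
  have hi := fun w u => integrableOn_potentialDeriv_apply_apply hK (hc w) (hA w) hε x u i
  rw [← integral_finsetSum _ fun j _ => (hi _ _).const_mul _, ← sub_eq_zero,
    ← integral_sub (hi _ _) (integrable_finsetSum _ fun j _ => (hi _ _).const_mul _),
    ← neg_eq_zero, ← integral_neg, ← h1]
  congr 1
  funext y
  rw [hform]
  simp [Finset.sum_apply, mul_assoc, sub_eq_add_neg, add_comm]

end

/-! ### The Biot-Savart operator -/

section
variable {k : ℕ} {Ω : Set (Eu (2 * k + 1))}
  {α : Eu (2 * k + 1) → Eu (2 * k + 1) [⋀^Fin (k + 1)]→L[ℝ] ℝ}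

theorem fiberContract_bsForm_eq_sum {x y : Eu (2 * k + 1)} (hxy : y ≠ x)
    (w : Fin k → Eu (2 * k + 1)) :
    fiberContract (bsForm α (x, y)) w
      = ∑ i, (α y (Fin.cons (EuclideanSpace.single i 1) w) • newtonField 0 (x - y)) i := by
  rw [fiberContract_bsForm α hxy]
  have h1 : ∀ z, α y (Fin.cons z w) = (α y).curryLeft z w := fun z => rfl
  rw [h1]
  have hN : newtonField 0 (x - y) = (‖x - y‖ ^ (2 * k + 1))⁻¹ • (x - y) := by
    rw [newtonField, regNorm_zero]
  rw [hN]
  generalize (‖x - y‖ ^ (2 * k + 1))⁻¹ = c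
  conv_lhs => rw [← sum_smul_single (x - y)]
  simp only [map_sum, map_smul, ContinuousAlternatingMap.sum_apply, Finset.mul_sum]
  refine Finset.sum_congr rfl fun i _ => ?_
  rw [h1]
  simp
  ring

/-- The boundary is a null set, so that the fibre may be replaced by the interior of `Ω`. -/
theorem configFiber_ae_eq (hΩ : IsCompactDomain Ω) (x : Eu (2 * k + 1)) :
    configFiber Ω x =ᵐ[volume] interior Ω := by
  have hcl := hΩ.isCompact.isClosed
  have hS : IsCompact (singularSet Ω) := hΩ.isCompact.of_isClosed_subset (isClosed_singularSet hcl)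
    fun y hy => hcl.frontier_subset hy.1
  have h1 : ∀ᵐ y, y ∉ frontier Ω := measure_eq_zero_iff_ae_notMem.mp
    (volume_frontier_eq_zero hcl (volume_eq_zero_of_hausdorffMeasure_eq_zero hS hΩ.singular_null))
  have h2 : ∀ᵐ y, y ≠ x := by
    have := ae_ne_zero (n := 2 * k + 1)
    filter_upwards [(measurePreserving_sub_right volume x).quasiMeasurePreserving.ae this] with y hy
    exact sub_ne_zero.mp hy
  filter_upwards [h1, h2] with y hy hyx
  refine propext ⟨fun h => ?_, fun h => ⟨interior_subset h, hyx⟩⟩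
  by_contra hi
  exact hy ⟨subset_closure h.1, hi⟩

theorem exists_bound_apply_form (hΩ : IsCompact Ω) (hα : ContDiffOn ℝ 1 α Ω)
    (w : Fin (k + 1) → Eu (2 * k + 1)) : ∃ A, ∀ y ∈ interior Ω, |α y w| ≤ A := by
  obtain ⟨A, hA⟩ := hΩ.exists_bound_of_continuousOn (contDiffOn_apply_form hα w).continuousOn
  exact ⟨A, fun y hy => hA y (interior_subset hy)⟩

theorem integrableOn_smul_newtonField_apply (hΩ : IsCompact Ω) (hα : ContDiffOn ℝ 1 α Ω)
    (w : Fin (k + 1) → Eu (2 * k + 1)) (x : Eu (2 * k + 1)) (i : Fin (2 * k + 1)) :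
    IntegrableOn (fun y => (α y w • newtonField 0 (x - y)) i) (interior Ω) := by
  obtain ⟨A, hA⟩ := exists_bound_apply_form hΩ hα w
  exact (EuclideanSpace.proj i : Eu (2 * k + 1) →L[ℝ] ℝ).integrable_comp (integrableOn_potential hΩ
    ((contDiffOn_apply_form hα w).continuousOn.mono interior_subset) hA 0 x)

theorem measurableSet_configFiber (hΩ : IsCompact Ω) (x : Eu (2 * k + 1)) :
    MeasurableSet (configFiber Ω x) :=
  hΩ.measurableSet.inter (measurableSet_singleton x).compl

theorem integrableOn_fiberContract (hΩ : IsCompactDomain Ω) (hα : ContDiffOn ℝ 1 α Ω)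
    (x : Eu (2 * k + 1)) :
    IntegrableOn (fun y => fiberContract (bsForm α (x, y))) (configFiber Ω x) := by
  refine integrable_form fun w => ?_
  have h1 : IntegrableOn (fun y => ∑ i, (α y (Fin.cons (EuclideanSpace.single i 1) w)
      • newtonField 0 (x - y)) i) (configFiber Ω x) :=
    IntegrableOn.congr_set_ae (integrable_finsetSum _ fun i _ =>
      integrableOn_smul_newtonField_apply hΩ.isCompact hα _ x i) (configFiber_ae_eq hΩ x)
  exact h1.congr_fun (fun y hy => (fiberContract_bsForm_eq_sum hy.2 w).symm)
    (measurableSet_configFiber hΩ.isCompact x)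

/-- The components of the Biot-Savart form are sums of components of vector potentials of
coefficients of `α`. -/
theorem BS_apply (hΩ : IsCompactDomain Ω) (hα : ContDiffOn ℝ 1 α Ω) (x : Eu (2 * k + 1))
    (w : Fin k → Eu (2 * k + 1)) :
    BS Ω α x w = (sphereArea (2 * k + 1))⁻¹ *
      ∑ i, potential Ω (fun y => α y (Fin.cons (EuclideanSpace.single i 1) w)) 0 x i := by
  have h1 : fiberIntegral (configFiber Ω x) (bsForm α) x w
      = ∫ y in configFiber Ω x, fiberContract (bsForm α (x, y)) w :=
    ((ContinuousAlternatingMap.apply ℝ (Eu (2 * k + 1)) ℝ w).integral_comp_comm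
      (integrableOn_fiberContract hΩ hα x)).symm
  have h2 : ∀ i, ∫ y in interior Ω, (α y (Fin.cons (EuclideanSpace.single i 1) w)
      • newtonField 0 (x - y)) i
      = potential Ω (fun y => α y (Fin.cons (EuclideanSpace.single i 1) w)) 0 x i := fun i => by
    obtain ⟨A, hA⟩ := exists_bound_apply_form hΩ.isCompact hα (Fin.cons (EuclideanSpace.single i 1) w)
    exact (EuclideanSpace.proj i : Eu (2 * k + 1) →L[ℝ] ℝ).integral_comp_comm
      (integrableOn_potential hΩ.isCompact
        ((contDiffOn_apply_form hα _).continuousOn.mono interior_subset) hA 0 x)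
  rw [BS, ContinuousAlternatingMap.smul_apply, h1, smul_eq_mul, one_div, sphereVol_eq,
    setIntegral_congr_fun (measurableSet_configFiber hΩ.isCompact x)
      fun y hy => fiberContract_bsForm_eq_sum hy.2 w,
    setIntegral_congr_set (configFiber_ae_eq hΩ x),
    integral_finsetSum _ fun i _ => integrableOn_smul_newtonField_apply hΩ.isCompact hα _ x i]
  simp only [h2]

/-- Near a point where the boundary is smooth, the exterior derivative of `BS Ω α` is the limit of
the traces of the derivatives of the regularised potentials of `α`. -/
theorem extDerivWithin_BS (hΩ : IsCompactDomain Ω) (hα : ContDiffOn ℝ 1 α Ω)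
    (hclosed : IsClosedForm Ω α) (hdir : IsDirichletForm Ω α) {U : Set (Eu (2 * k + 1))}
    {f : Eu (2 * k + 1) → ℝ} (hc : IsRegularChart Ω U f) {p : Eu (2 * k + 1)} (hpU : p ∈ U)
    (hpΩ : p ∈ Ω) : DifferentiableWithinAt ℝ (BS Ω α) Ω p ∧ extDerivWithin (BS Ω α) Ω p = α p := by
  have hK := hΩ.isCompact
  have hA0 : sphereArea (2 * k + 1) ≠ 0 := sphereArea_pos.ne'
  choose M V hV hlim hcont hM using fun w : Fin (k + 1) → Eu (2 * k + 1) =>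
    exists_hasFDerivWithinAt_potential hK hc hpU hpΩ (contDiffOn_apply_form hα w)
  have hud := hc.uniqueDiffWithinAt hpU hpΩ
  have hBS : ∀ w, HasFDerivWithinAt (fun x => BS Ω α x w) ((sphereArea (2 * k + 1))⁻¹ • ∑ i,
      (EuclideanSpace.proj i : Eu (2 * k + 1) →L[ℝ] ℝ).comp
        (M (Fin.cons (EuclideanSpace.single i 1) w) p)) Ω p := by
    intro w
    have h1 : HasFDerivWithinAt (fun x => (sphereArea (2 * k + 1))⁻¹ * ∑ i,
        potential Ω (fun y => α y (Fin.cons (EuclideanSpace.single i 1) w)) 0 x i)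
        ((sphereArea (2 * k + 1))⁻¹ • ∑ i, (EuclideanSpace.proj i : Eu (2 * k + 1) →L[ℝ] ℝ).comp
          (M (Fin.cons (EuclideanSpace.single i 1) w) p)) Ω p :=
      (HasFDerivWithinAt.fun_sum fun i _ =>
        (EuclideanSpace.proj i : Eu (2 * k + 1) →L[ℝ] ℝ).hasFDerivAt.comp_hasFDerivWithinAt p
          (hM _)).const_mul _
    exact h1.congr (fun x _ => BS_apply hΩ hα x w) (BS_apply hΩ hα p w)
  have hdiff : DifferentiableWithinAt ℝ (BS Ω α) Ω p :=
    differentiableWithinAt_form fun w => (hBS w).differentiableWithinAt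
  refine ⟨hdiff, ?_⟩
  ext v
  have hfd : ∀ h w, fderivWithin ℝ (BS Ω α) Ω p h w = (sphereArea (2 * k + 1))⁻¹ *
      ∑ i, M (Fin.cons (EuclideanSpace.single i 1) w) p h i := by
    intro h w
    have h1 := (ContinuousAlternatingMap.apply ℝ (Eu (2 * k + 1)) ℝ w).hasFDerivAt.comp_hasFDerivWithinAt
      p hdiff.hasFDerivWithinAt
    have h2 := congrArg (fun L : Eu (2 * k + 1) →L[ℝ] ℝ => L h) (hud.eq h1 (hBS w))
    simpa [Finset.sum_apply] using h2
  set Q : Eu (2 * k + 1) → ℝ := fun x => ∑ i, ∑ j : Fin (k + 1), (-1 : ℝ) ^ (j : ℕ) *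
    M (Fin.cons (EuclideanSpace.single i 1) (j.removeNth v)) x (v j) i with hQ
  have hlhs : extDerivWithin (BS Ω α) Ω p v = (sphereArea (2 * k + 1))⁻¹ * Q p := by
    rw [extDerivWithin, ContinuousAlternatingMap.alternatizeUncurryFin_apply]
    simp only [hfd, hQ]
    rw [Finset.sum_comm, Finset.mul_sum]
    refine Finset.sum_congr rfl fun j _ => ?_
    rw [Finset.mul_sum, Finset.smul_sum, Finset.mul_sum]
    exact Finset.sum_congr rfl fun i _ => by simp; ring
  -- in the interior, both sides are limits of the regularised identity
  have hint : ∀ᶠ x in 𝓝[interior Ω] p, Q x = sphereArea (2 * k + 1) * α x v := by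
    have hVall : (⋂ i, ⋂ j : Fin (k + 1), V (Fin.cons (EuclideanSpace.single i 1) (j.removeNth v)))
        ∈ 𝓝 p := Filter.iInter_mem.mpr fun i => Filter.iInter_mem.mpr fun j => hV _
    filter_upwards [self_mem_nhdsWithin, mem_nhdsWithin_of_mem_nhds hVall] with x hx hxV
    obtain ⟨A, hA⟩ := exists_bound_apply_form hK hα v
    have h1 := tendsto_sum_potentialDeriv hK
      ((contDiffOn_apply_form hα v).continuousOn.mono interior_subset) hA hx
    have h2 : Tendsto (fun ε => ∑ i, ∑ j : Fin (k + 1), (-1 : ℝ) ^ (j : ℕ) * potentialDeriv Ω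
        (fun y => α y (Fin.cons (EuclideanSpace.single i 1) (j.removeNth v))) ε x (v j) i)
        (𝓝[>] 0) (𝓝 (Q x)) := by
      refine tendsto_finsetSum _ fun i _ => tendsto_finsetSum _ fun j _ => ?_
      have h3 := hlim (Fin.cons (EuclideanSpace.single i 1) (j.removeNth v)) x
        ⟨mem_iInter.mp (mem_iInter.mp hxV i) j, hx⟩
      exact ((((EuclideanSpace.proj i : Eu (2 * k + 1) →L[ℝ] ℝ).comp
        (ContinuousLinearMap.apply ℝ (Eu (2 * k + 1)) (v j))).continuous.tendsto _).comp h3).const_mul _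
    refine tendsto_nhds_unique h2 (h1.congr' ?_)
    filter_upwards [self_mem_nhdsWithin] with ε hε
    exact sum_potentialDeriv_eq hΩ hα hclosed hdir v hε x
  have hne : (𝓝[interior Ω] p).NeBot := by
    rw [← mem_closure_iff_nhdsWithin_neBot, hΩ.closure_interior]
    exact hpΩ
  have hQc : Tendsto Q (𝓝[interior Ω] p) (𝓝 (Q p)) := by
    refine tendsto_finsetSum _ fun i _ => tendsto_finsetSum _ fun j _ => ?_
    have h3 := (hcont (Fin.cons (EuclideanSpace.single i 1) (j.removeNth v))).mono interior_subset
    exact ((((EuclideanSpace.proj i : Eu (2 * k + 1) →L[ℝ] ℝ).comp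
      (ContinuousLinearMap.apply ℝ (Eu (2 * k + 1)) (v j))).continuous.tendsto _).comp h3).const_mul _
  have hαc : Tendsto (fun x => sphereArea (2 * k + 1) * α x v) (𝓝[interior Ω] p)
      (𝓝 (sphereArea (2 * k + 1) * α p v)) :=
    (((contDiffOn_apply_form hα v).continuousOn p hpΩ).mono interior_subset).tendsto.const_mul _
  have hQp : Q p = sphereArea (2 * k + 1) * α p v :=
    tendsto_nhds_unique hQc (hαc.congr' (hint.mono fun x hx => hx.symm))
  rw [hlhs, hQp, inv_mul_cancel_left₀ hA0]

end

end BiotSavart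

end

theorem mainTheorem7 (k : ℕ)
    (Ω : Set (BiotSavart.Eu (2 * k + 1))) (hΩ : BiotSavart.IsCompactDomain Ω)
    (α : BiotSavart.Eu (2 * k + 1) → BiotSavart.Eu (2 * k + 1) [⋀^Fin (k + 1)]→L[ℝ] ℝ)
    (hα : ContDiffOn ℝ ∞ α Ω)
    (hclosed : BiotSavart.IsClosedForm Ω α) (hdir : BiotSavart.IsDirichletForm Ω α) :
    (∀ x : BiotSavart.Eu (2 * k + 1),
      MeasureTheory.IntegrableOn (fun y => BiotSavart.fiberContract (BiotSavart.bsForm α (x, y)))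
        (BiotSavart.configFiber Ω x)) ∧
    ∀ x ∈ Ω, (x ∈ interior Ω ∨ BiotSavart.IsSmoothBoundaryPoint Ω x) →
      DifferentiableWithinAt ℝ (BiotSavart.BS Ω α) Ω x ∧
      extDerivWithin (BiotSavart.BS Ω α) Ω x = α x := by
  have h1 : ContDiffOn ℝ 1 α Ω := hα.of_le (WithTop.coe_le_coe.mpr le_top)
  refine ⟨fun x => BiotSavart.integrableOn_fiberContract hΩ h1 x, fun x hx hxs => ?_⟩
  have hns : x ∉ BiotSavart.singularSet Ω := by
    rintro ⟨hfr, hn⟩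
    rcases hxs with h | h
    · exact hfr.2 h
    · exact hn h
  obtain ⟨U, f, hc, hxU⟩ := BiotSavart.exists_isRegularChart hΩ.isCompact.isClosed hns
  exact BiotSavart.extDerivWithin_BS hΩ h1 hclosed hdir hc hxU hx
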